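/- **The calculus.** Fix base types, ground constants $\mathsf f : (A_1,\dots,A_n)\to B$, a set $\mathcal O$ of operation symbols $\mathsf{op} : A_{\mathsf{op}} \rightsquigarrow B_{\mathsf{op}} \mathbin{!} E_{\mathsf{op}}$ ($A_{\mathsf{op}},B_{\mathsf{op}}$ ground types, $E_{\mathsf{op}}$ a finite set of exceptions), sets $\mathcal E$ of exceptions and $\mathcal S$ of signals, and a distinguished operation $\mathsf{rip} : \mathsf{unit} \rightsquigarrow \mathsf{empty} \mathbin{!} \emptyset$ (runtime error). $\lambda_{\mathsf{coop}}$ is the fine-grain call-by-value calculus whose value types are ground types, products, sums, user function types $X \to Y \mathbin{!} (\Sigma,E)$, kernel function types $X \to Y ↯ (\Sigma,E,S,C)$ and runner types $\Sigma \Rightarrow (\Sigma',S,C)$ ($\Sigma,\Sigma',E,S$ finite, $C$ ground), with values, user computations (return, application, exception handlers, matches, operation calls, raise, running user code with a runner and a finalisation block, switching to kernel mode with a finalisation block) and kernel computations (the same without the last two constructs, and with kill, getenv, setenv and switching to user mode), with its typing rules including subsumption along subtyping. Skeletal types arise from types by erasing all effect information; skeletal typing judgements $\vdash^{\mathsf s}$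 are given by the typing rules without subsumption and without effect restrictions. **The semantics.** Let base types denote sets and constants denote maps. Skeletal types denote sets $[\![P]\!]$, where user computations denote elements of $\mathrm{Tree}_{\mathcal O}([\![P]\!]+\mathcal E)$, kernel computations with state $C$ elements of $[\![C]\!] \Rightarrow \mathrm{Tree}_{\mathcal O}(([\![P]\!]+\mathcal E)\times[\![C]\!] + \mathcal S)$, functions denote Kleisli maps, and runners denote families of co-operations $[\![A_{\mathsf{op}}]\!] \to ([\![C]\!]\Rightarrow \mathrm{Tree}_{\mathcal O}(([\![B_{\mathsf{op}}]\!] + E_{\mathsf{op}})\times[\![C]\!]+\mathcal S))$; skeletal typing derivations denote maps $[\![\Gamma]\!]\to[\![P]\!]$, unexpected exceptions, signals and operations being interpreted by $\mathsf{rip}$. A type $X$ with skeleton $X^{\mathsf s}$ denotes the subset $\langle X\rangle \subseteq [\![X^{\mathsf s}]\!]$ of elements that respect the effect information in $X$; in particular $\langle X \to Y\mathbin{!}\mathcal U\rangle$ consists of the maps on all of $[\![X^{\mathsf s}]\!]$ that take $\langle X\rangle$ into $\langle Y \mathbin{!}\mathcal U\rangle$. The meaning of a typing derivation is the skeletal meaning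 of its skeleton (the derivation with subsumption skipped). **Theorem (Coherence and soundness).** The following hold for value, user and kernel judgements alike. 1. *(Coherence)* Skeletal typing derivations are unique. The meaning of every derivation of $\Gamma\vdash V : X$ maps $\langle\Gamma\rangle$ into $\langle X\rangle$, it is the meaning of the unique skeletal derivation of $\Gamma^{\mathsf s}\vdash^{\mathsf s} V : X^{\mathsf s}$, and hence any two derivations of $\Gamma\vdash V:X$ have the same meaning. 2. *(Soundness)* Consider equations between terms that are well typed in the same context and at the same type: the $\beta$- and other computational equations of user and kernel code (for application, handlers, matches, running, and context switches), the $\eta$-equations for unit, for user and kernel functions, and for exception handlers ($\mathsf{try}\ M\ \mathsf{with}\ \{\mathsf{return}\ x\mapsto \mathsf{return}\ x, (\mathsf{raise}\ e\mapsto\mathsf{raise}\ e)_{e\in E}\}\equiv M$, and likewise for kernel code), and the kernel-theory equations relating getenv, setenv, kill and operations. Let $\equiv$ be the equational theory that they generate: the least equivalence containing them that is closed under subsumption and is a congruence for all term formers. (a) If $V\equiv W$ in context $\Gamma$ at type $X$ is derived without using the $\eta$-equations for exception handlers below a function abstraction, then $V$ and $W$ have the same meaning as maps $\langle\Gamma\rangle\to\langle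 X\rangle$. In particular every one of the listed equations holds in the semantics. (b) If it is derived without the $\eta$-equations for exception handlers at all, then $V$ and $W$ have the same meaning on all of $[\![\Gamma^{\mathsf s}]\!]$. (c) If $V\equiv W$, then $V$ and $W$ have hereditarily equal meanings: let $\approx$ be equality at ground types, componentwise at products and sums; let two functions be $\approx$-related at $X\to Y\mathbin{!}\mathcal U$ or $X \to Y ↯ \mathcal K$ if they take $\approx_X$-related arguments to related computations, where two computations are related if they are equal trees that respect the effect information, up to $\approx_Y$ at returned values; and let two runners be related at $\Sigma\Rightarrow(\Sigma',S,C)$ if their co-operations for $\Sigma$ are equal and respect $\Sigma'$ and $S$. Then related environments are taken by $V$ and $W$ to related elements of $X$. In particular, at ground types in contexts of ground types the meanings of $V$ and $W$ are equal. -/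

import Mathlib

universe u

namespace Coop

/-! ## Types -/

/-- Ground types over a set of base types. -/
inductive GTy (B : Type u) : Type u
  | base (b : B)
  | unit
  | empty
  | prod (A A' : GTy B)
  | sum (A A' : GTy B)

/-- The data over which the calculus is given: base types, ground constants with their
signatures, operation symbols `op : A_op ⇝ B_op ! E_op`, exception and signal names, and
the distinguished operation `rip : unit ⇝ empty ! ∅` (the runtime error). -/
structure Lang : Type (u + 1) where
  Base : Type u
  Const : Type u
  Op : Type u
  Exc : Type u
  Sgn : Type u
  arity : Const → ℕ
  argTy : (f : Const) → Fin (arity f) → GTy Base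
  resTy : Const → GTy Base
  opPar : Op → GTy Base
  opRes : Op → GTy Base
  opExc : Op → Finset Exc
  rip : Op
  rip_par : opPar rip = GTy.unit
  rip_res : opRes rip = GTy.empty
  rip_exc : opExc rip = ∅

/-- Exceptions that an operation may raise. -/
abbrev Lang.OpExc (L : Lang.{u}) (o : L.Op) : Type u := {e : L.Exc // e ∈ L.opExc o}

/-- User effects `(Σ, E)`. -/
structure UEff (L : Lang.{u}) : Type u where
  ops : Finset L.Op
  exc : Finset L.Exc

/-- Kernel effects `(Σ, E, S, C)`. -/
structure KEff (L : Lang.{u}) : Type u where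
  ops : Finset L.Op
  exc : Finset L.Exc
  sgn : Finset L.Sgn
  st : GTy L.Base

/-- Value types. A ground type is a value type built from base types, unit, empty, products
and sums only, see `GTy.toV`. -/
inductive VTy (L : Lang.{u}) : Type u
  | base (b : L.Base)
  | unit
  | empty
  | prod (X Y : VTy L)
  | sum (X Y : VTy L)
  | ufun (X Y : VTy L) (U : UEff L)
  | kfun (X Y : VTy L) (K : KEff L)
  | runner (ops ops' : Finset L.Op) (S : Finset L.Sgn) (C : GTy L.Base)

/-- Skeletal value types. -/
inductive STy (L : Lang.{u}) : Type u
  | base (b : L.Base)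
  | unit
  | empty
  | prod (P Q : STy L)
  | sum (P Q : STy L)
  | ufun (P Q : STy L)
  | kfun (P Q : STy L) (C : GTy L.Base)
  | runner (C : GTy L.Base)

variable {L : Lang.{u}}

/-- Ground types are value types. -/
def GTy.toV : GTy L.Base → VTy L
  | .base b => .base b
  | .unit => .unit
  | .empty => .empty
  | .prod A B => .prod A.toV B.toV
  | .sum A B => .sum A.toV B.toV

/-- The skeleton of a value type. -/
@[reducible] def VTy.skel : VTy L → STy L
  | .base b => .base b
  | .unit => .unit
  | .empty => .empty
  | .prod X Y => .prod X.skel Y.skel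
  | .sum X Y => .sum X.skel Y.skel
  | .ufun X Y _ => .ufun X.skel Y.skel
  | .kfun X Y K => .kfun X.skel Y.skel K.st
  | .runner _ _ _ C => .runner C

/-- A ground type as a skeletal type. -/
abbrev GTy.toS (A : GTy L.Base) : STy L := A.toV.skel

/-- Subtyping of value types. -/
inductive Sub : VTy L → VTy L → Prop
  | ground (A : GTy L.Base) {X : VTy L} (hX : X = A.toV) : Sub X X
  | prod {X X' Y Y' : VTy L} : Sub X X' → Sub Y Y' → Sub (.prod X Y) (.prod X' Y')
  | sum {X X' Y Y' : VTy L} : Sub X X' → Sub Y Y' → Sub (.sum X Y) (.sum X' Y')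
  | ufun {X X' Y Y' : VTy L} {U U' : UEff L} : Sub X' X →
      Sub Y Y' → U.ops ⊆ U'.ops → U.exc ⊆ U'.exc →
      Sub (.ufun X Y U) (.ufun X' Y' U')
  | kfun {X X' Y Y' : VTy L} {K K' : KEff L} : Sub X' X →
      Sub Y Y' → K.ops ⊆ K'.ops → K.exc ⊆ K'.exc → K.sgn ⊆ K'.sgn → K.st = K'.st →
      Sub (.kfun X Y K) (.kfun X' Y' K')
  | runner {ops₁ ops₁' ops₂ ops₂' : Finset L.Op} {S S' : Finset L.Sgn} {C C' : GTy L.Base} :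
      ops₁' ⊆ ops₁ → ops₂ ⊆ ops₂' → S ⊆ S' → C = C' →
      Sub (.runner ops₁ ops₂ S C) (.runner ops₁' ops₂' S' C')

/-- Subtyping of user types `X ! U ⊑ X' ! U'`. -/
structure SubU (X : VTy L) (U : UEff L) (X' : VTy L) (U' : UEff L) : Prop where
  val : Sub X X'
  ops : U.ops ⊆ U'.ops
  exc : U.exc ⊆ U'.exc

/-- Subtyping of kernel types `X ↯ K ⊑ X' ↯ K'`. -/
structure SubK (X : VTy L) (K : KEff L) (X' : VTy L) (K' : KEff L) : Prop where
  val : Sub X X'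
  ops : K.ops ⊆ K'.ops
  exc : K.exc ⊆ K'.exc
  sgn : K.sgn ⊆ K'.sgn
  st : K.st = K'.st

/-- Subtypes have the same skeleton. -/
theorem Sub.skel_eq {X Y : VTy L} (h : Sub X Y) : X.skel = Y.skel := by
  induction h with
  | ground => rfl
  | prod _ _ ih₁ ih₂ => simp [VTy.skel, ih₁, ih₂]
  | sum _ _ ih₁ ih₂ => simp [VTy.skel, ih₁, ih₂]
  | ufun _ _ _ _ ih₁ ih₂ => simp [VTy.skel, ih₁, ih₂]
  | kfun _ _ _ _ _ h ih₁ ih₂ => simp [VTy.skel, ih₁, ih₂, h]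
  | runner _ _ _ h => simp [VTy.skel, h]

/-! ## Terms

Variables are de Bruijn indices; index `0` is the innermost binder. -/

mutual

/-- Values. -/
inductive Val (L : Lang.{u}) : Type u
  | var (i : ℕ)
  | const (f : L.Const) (Vs : Fin (L.arity f) → Val L)
  | unit
  | pair (V W : Val L)
  | inl (X Y : VTy L) (V : Val L)
  | inr (X Y : VTy L) (V : Val L)
  /-- `fun (x : X) ↦ M`, binding `x`. -/
  | ufun (X : VTy L) (M : UTm L)
  /-- `funK (x : X) ↦ K`, binding `x`. -/
  | kfun (X : VTy L) (K : KTm L)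
  /-- `{(op x ↦ K_op)_{op ∈ ops}}_C`, binding `x` in each clause. -/
  | runner (ops : Finset L.Op) (Ks : {o : L.Op // o ∈ ops} → KTm L) (C : GTy L.Base)

/-- User computations. -/
inductive UTm (L : Lang.{u}) : Type u
  | ret (V : Val L)
  | app (V W : Val L)
  /-- `try M with {return x ↦ N, (raise e ↦ N_e)_{e ∈ E}}`. -/
  | tryWith (M : UTm L) (N : UTm L) (E : Finset L.Exc) (Ne : {e : L.Exc // e ∈ E} → UTm L)
  /-- `match V with {(x, y) ↦ M}`; in `M`, `y` is index `0` and `x` is index `1`. -/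
  | matchPair (V : Val L) (M : UTm L)
  | matchEmpty (X : VTy L) (V : Val L)
  | matchSum (V : Val L) (M N : UTm L)
  /-- `op_X (V, (x. M), (N_e)_{e ∈ E_op})`. -/
  | op (o : L.Op) (X : VTy L) (V : Val L) (M : UTm L) (Ne : L.OpExc o → UTm L)
  | raise (X : VTy L) (e : L.Exc)
  /-- `using V @ W run M finally {return x @ c ↦ N, (raise e @ c ↦ N_e)_{e ∈ E},
  (kill s ↦ N_s)_{s ∈ S}}`; in `N`, `c` is index `0` and `x` is index `1`. -/
  | run (V W : Val L) (M : UTm L) (N : UTm L)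
      (E : Finset L.Exc) (Ne : {e : L.Exc // e ∈ E} → UTm L)
      (S : Finset L.Sgn) (Ns : {s : L.Sgn // s ∈ S} → UTm L)
  /-- `kernel K @ W finally {…}`, the clauses as in `run`. -/
  | kernel (K : KTm L) (W : Val L) (N : UTm L)
      (E : Finset L.Exc) (Ne : {e : L.Exc // e ∈ E} → UTm L)
      (S : Finset L.Sgn) (Ns : {s : L.Sgn // s ∈ S} → UTm L)

/-- Kernel computations. -/
inductive KTm (L : Lang.{u}) : Type u
  | ret (C : GTy L.Base) (V : Val L)
  | app (V W : Val L)
  | tryWith (K : KTm L) (N : KTm L) (E : Finset L.Exc) (Ne : {e : L.Exc // e ∈ E} → KTm L)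
  | matchPair (V : Val L) (K : KTm L)
  | matchEmpty (X : VTy L) (C : GTy L.Base) (V : Val L)
  | matchSum (V : Val L) (K N : KTm L)
  | op (o : L.Op) (X : VTy L) (V : Val L) (K : KTm L) (Ne : L.OpExc o → KTm L)
  | raise (X : VTy L) (C : GTy L.Base) (e : L.Exc)
  | kill (X : VTy L) (C : GTy L.Base) (s : L.Sgn)
  /-- `getenv_C (c. K)`, binding `c`. -/
  | getenv (C : GTy L.Base) (K : KTm L)
  | setenv (V : Val L) (K : KTm L)
  /-- `user M with {return x ↦ K, (raise e ↦ K_e)_{e ∈ E}}`. -/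
  | user (M : UTm L) (K : KTm L) (E : Finset L.Exc) (Ke : {e : L.Exc // e ∈ E} → KTm L)

end

/-! ## Renaming and substitution -/

/-- A renaming under one binder. -/
def liftRen (r : ℕ → ℕ) : ℕ → ℕ
  | 0 => 0
  | n + 1 => r n + 1

mutual

/-- Renaming in values. -/
def Val.ren (r : ℕ → ℕ) : Val L → Val L
  | .var i => .var (r i)
  | .const f Vs => .const f (fun i => (Vs i).ren r)
  | .unit => .unit
  | .pair V W => .pair (V.ren r) (W.ren r)
  | .inl X Y V => .inl X Y (V.ren r)
  | .inr X Y V => .inr X Y (V.ren r)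
  | .ufun X M => .ufun X (M.ren (liftRen r))
  | .kfun X K => .kfun X (K.ren (liftRen r))
  | .runner ops Ks C => .runner ops (fun o => (Ks o).ren (liftRen r)) C

/-- Renaming in user computations. -/
def UTm.ren (r : ℕ → ℕ) : UTm L → UTm L
  | .ret V => .ret (V.ren r)
  | .app V W => .app (V.ren r) (W.ren r)
  | .tryWith M N E Ne =>
      .tryWith (M.ren r) (N.ren (liftRen r)) E (fun e => (Ne e).ren r)
  | .matchPair V M => .matchPair (V.ren r) (M.ren (liftRen (liftRen r)))
  | .matchEmpty X V => .matchEmpty X (V.ren r)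
  | .matchSum V M N => .matchSum (V.ren r) (M.ren (liftRen r)) (N.ren (liftRen r))
  | .op o X V M Ne => .op o X (V.ren r) (M.ren (liftRen r)) (fun e => (Ne e).ren r)
  | .raise X e => .raise X e
  | .run V W M N E Ne S Ns =>
      .run (V.ren r) (W.ren r) (M.ren r) (N.ren (liftRen (liftRen r)))
        E (fun e => (Ne e).ren (liftRen r)) S (fun s => (Ns s).ren r)
  | .kernel K W N E Ne S Ns =>
      .kernel (K.ren r) (W.ren r) (N.ren (liftRen (liftRen r)))
        E (fun e => (Ne e).ren (liftRen r)) S (fun s => (Ns s).ren r)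

/-- Renaming in kernel computations. -/
def KTm.ren (r : ℕ → ℕ) : KTm L → KTm L
  | .ret C V => .ret C (V.ren r)
  | .app V W => .app (V.ren r) (W.ren r)
  | .tryWith K N E Ne =>
      .tryWith (K.ren r) (N.ren (liftRen r)) E (fun e => (Ne e).ren r)
  | .matchPair V K => .matchPair (V.ren r) (K.ren (liftRen (liftRen r)))
  | .matchEmpty X C V => .matchEmpty X C (V.ren r)
  | .matchSum V K N => .matchSum (V.ren r) (K.ren (liftRen r)) (N.ren (liftRen r))
  | .op o X V K Ne => .op o X (V.ren r) (K.ren (liftRen r)) (fun e => (Ne e).ren r)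
  | .raise X C e => .raise X C e
  | .kill X C s => .kill X C s
  | .getenv C K => .getenv C (K.ren (liftRen r))
  | .setenv V K => .setenv (V.ren r) (K.ren r)
  | .user M K E Ke => .user (M.ren r) (K.ren (liftRen r)) E (fun e => (Ke e).ren r)

end

/-- A substitution under one binder. -/
def liftSub (s : ℕ → Val L) : ℕ → Val L
  | 0 => .var 0
  | n + 1 => (s n).ren Nat.succ

mutual

/-- Simultaneous capture-avoiding substitution in values. -/
def Val.subst (s : ℕ → Val L) : Val L → Val L
  | .var i => s i
  | .const f Vs => .const f (fun i => (Vs i).subst s)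
  | .unit => .unit
  | .pair V W => .pair (V.subst s) (W.subst s)
  | .inl X Y V => .inl X Y (V.subst s)
  | .inr X Y V => .inr X Y (V.subst s)
  | .ufun X M => .ufun X (M.subst (liftSub s))
  | .kfun X K => .kfun X (K.subst (liftSub s))
  | .runner ops Ks C => .runner ops (fun o => (Ks o).subst (liftSub s)) C

/-- Simultaneous capture-avoiding substitution in user computations. -/
def UTm.subst (s : ℕ → Val L) : UTm L → UTm L
  | .ret V => .ret (V.subst s)
  | .app V W => .app (V.subst s) (W.subst s)
  | .tryWith M N E Ne =>
      .tryWith (M.subst s) (N.subst (liftSub s)) E (fun e => (Ne e).subst s)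
  | .matchPair V M => .matchPair (V.subst s) (M.subst (liftSub (liftSub s)))
  | .matchEmpty X V => .matchEmpty X (V.subst s)
  | .matchSum V M N => .matchSum (V.subst s) (M.subst (liftSub s)) (N.subst (liftSub s))
  | .op o X V M Ne => .op o X (V.subst s) (M.subst (liftSub s)) (fun e => (Ne e).subst s)
  | .raise X e => .raise X e
  | .run V W M N E Ne S Ns =>
      .run (V.subst s) (W.subst s) (M.subst s) (N.subst (liftSub (liftSub s)))
        E (fun e => (Ne e).subst (liftSub s)) S (fun k => (Ns k).subst s)
  | .kernel K W N E Ne S Ns =>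
      .kernel (K.subst s) (W.subst s) (N.subst (liftSub (liftSub s)))
        E (fun e => (Ne e).subst (liftSub s)) S (fun k => (Ns k).subst s)

/-- Simultaneous capture-avoiding substitution in kernel computations. -/
def KTm.subst (s : ℕ → Val L) : KTm L → KTm L
  | .ret C V => .ret C (V.subst s)
  | .app V W => .app (V.subst s) (W.subst s)
  | .tryWith K N E Ne =>
      .tryWith (K.subst s) (N.subst (liftSub s)) E (fun e => (Ne e).subst s)
  | .matchPair V K => .matchPair (V.subst s) (K.subst (liftSub (liftSub s)))
  | .matchEmpty X C V => .matchEmpty X C (V.subst s)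
  | .matchSum V K N => .matchSum (V.subst s) (K.subst (liftSub s)) (N.subst (liftSub s))
  | .op o X V K Ne => .op o X (V.subst s) (K.subst (liftSub s)) (fun e => (Ne e).subst s)
  | .raise X C e => .raise X C e
  | .kill X C k => .kill X C k
  | .getenv C K => .getenv C (K.subst (liftSub s))
  | .setenv V K => .setenv (V.subst s) (K.subst s)
  | .user M K E Ke => .user (M.subst s) (K.subst (liftSub s)) E (fun e => (Ke e).subst s)

end

/-- The substitution `[V/x]` for the innermost variable `x`. -/
def sub1 (V : Val L) : ℕ → Val L
  | 0 => V
  | n + 1 => .var n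

/-- The substitution `[V/x, W/y]`, where `y` is the innermost variable (index `0`) and `x` the
next one (index `1`). -/
def sub2 (V W : Val L) : ℕ → Val L
  | 0 => W
  | 1 => V
  | n + 2 => .var n

/-- Weakening by `k` innermost variables. -/
def wk (k : ℕ) : ℕ → ℕ := fun n => n + k

/-- Exchange of the two innermost variables. -/
def swap : ℕ → ℕ
  | 0 => 1
  | 1 => 0
  | n + 2 => n + 2

/-! ## Typing derivations -/

/-- `Lookup Γ i X`: the variable with index `i` has type `X` in the context `Γ`. -/
inductive Lookup {α : Type u} : List α → ℕ → α → Type u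
  | zero {Γ : List α} {X : α} : Lookup (X :: Γ) 0 X
  | succ {Γ : List α} {i : ℕ} {X Y : α} : Lookup Γ i X → Lookup (Y :: Γ) (i + 1) X

mutual

/-- Derivations of `Γ ⊢ V : X`. -/
inductive HasV : List (VTy L) → Val L → VTy L → Type u
  | var {Γ : List (VTy L)} {i : ℕ} {X : VTy L} : Lookup Γ i X → HasV Γ (.var i) X
  | const {Γ : List (VTy L)} {f : L.Const} {Vs : Fin (L.arity f) → Val L} {X : VTy L} :
      (∀ i, HasV Γ (Vs i) (L.argTy f i).toV) → X = (L.resTy f).toV → HasV Γ (.const f Vs) X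
  | unit {Γ : List (VTy L)} : HasV Γ .unit .unit
  | pair {Γ : List (VTy L)} {V W : Val L} {X Y : VTy L} :
      HasV Γ V X → HasV Γ W Y → HasV Γ (.pair V W) (.prod X Y)
  | inl {Γ : List (VTy L)} {V : Val L} {X Y : VTy L} :
      HasV Γ V X → HasV Γ (.inl X Y V) (.sum X Y)
  | inr {Γ : List (VTy L)} {W : Val L} {X Y : VTy L} :
      HasV Γ W Y → HasV Γ (.inr X Y W) (.sum X Y)
  | ufun {Γ : List (VTy L)} {X Y : VTy L} {M : UTm L} {U : UEff L} :
      HasU (X :: Γ) M Y U → HasV Γ (.ufun X M) (.ufun X Y U)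
  | kfun {Γ : List (VTy L)} {X Y : VTy L} {K : KTm L} {E : KEff L} :
      HasK (X :: Γ) K Y E → HasV Γ (.kfun X K) (.kfun X Y E)
  | runner {Γ : List (VTy L)} {ops ops' : Finset L.Op} {S : Finset L.Sgn} {C : GTy L.Base}
      {Ks : {o : L.Op // o ∈ ops} → KTm L} :
      (∀ o : {o : L.Op // o ∈ ops},
        HasK ((L.opPar o).toV :: Γ) (Ks o) (L.opRes o).toV ⟨ops', L.opExc o, S, C⟩) →
      HasV Γ (.runner ops Ks C) (.runner ops ops' S C)
  | subsume {Γ : List (VTy L)} {V : Val L} {X X' : VTy L} :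
      HasV Γ V X → Sub X X' → HasV Γ V X'

/-- Derivations of `Γ ⊢ M : X ! U`. -/
inductive HasU : List (VTy L) → UTm L → VTy L → UEff L → Type u
  | ret {Γ : List (VTy L)} {V : Val L} {X : VTy L} {U : UEff L} :
      HasV Γ V X → HasU Γ (.ret V) X U
  | app {Γ : List (VTy L)} {V W : Val L} {X Y : VTy L} {U : UEff L} :
      HasV Γ V (.ufun X Y U) → HasV Γ W X → HasU Γ (.app V W) Y U
  | tryWith {Γ : List (VTy L)} {M N : UTm L} {ops : Finset L.Op} {E E' : Finset L.Exc}
      {Ne : {e : L.Exc // e ∈ E} → UTm L} {X Y : VTy L} :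
      HasU Γ M X ⟨ops, E⟩ → HasU (X :: Γ) N Y ⟨ops, E'⟩ →
      (∀ e, HasU Γ (Ne e) Y ⟨ops, E'⟩) → HasU Γ (.tryWith M N E Ne) Y ⟨ops, E'⟩
  | matchPair {Γ : List (VTy L)} {V : Val L} {M : UTm L} {X Y Z : VTy L} {U : UEff L} :
      HasV Γ V (.prod X Y) → HasU (Y :: X :: Γ) M Z U → HasU Γ (.matchPair V M) Z U
  | matchEmpty {Γ : List (VTy L)} {V : Val L} {Z : VTy L} {U : UEff L} :
      HasV Γ V .empty → HasU Γ (.matchEmpty Z V) Z U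
  | matchSum {Γ : List (VTy L)} {V : Val L} {M N : UTm L} {X Y Z : VTy L} {U : UEff L} :
      HasV Γ V (.sum X Y) → HasU (X :: Γ) M Z U → HasU (Y :: Γ) N Z U →
      HasU Γ (.matchSum V M N) Z U
  | op {Γ : List (VTy L)} {o : L.Op} {V : Val L} {M : UTm L} {Ne : L.OpExc o → UTm L}
      {X : VTy L} {U : UEff L} :
      o ∈ U.ops → HasV Γ V (L.opPar o).toV → HasU ((L.opRes o).toV :: Γ) M X U →
      (∀ e, HasU Γ (Ne e) X U) → HasU Γ (.op o X V M Ne) X U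
  | raise {Γ : List (VTy L)} {X : VTy L} {e : L.Exc} {U : UEff L} :
      e ∈ U.exc → HasU Γ (.raise X e) X U
  | run {Γ : List (VTy L)} {V W : Val L} {M N : UTm L} {E E' : Finset L.Exc}
      {Ne : {e : L.Exc // e ∈ E} → UTm L} {S : Finset L.Sgn}
      {Ns : {s : L.Sgn // s ∈ S} → UTm L} {ops ops' : Finset L.Op} {C : GTy L.Base}
      {X Y : VTy L} :
      HasV Γ V (.runner ops ops' S C) → HasV Γ W C.toV → HasU Γ M X ⟨ops, E⟩ →
      HasU (C.toV :: X :: Γ) N Y ⟨ops', E'⟩ →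
      (∀ e, HasU (C.toV :: Γ) (Ne e) Y ⟨ops', E'⟩) →
      (∀ s, HasU Γ (Ns s) Y ⟨ops', E'⟩) →
      HasU Γ (.run V W M N E Ne S Ns) Y ⟨ops', E'⟩
  | kernel {Γ : List (VTy L)} {K : KTm L} {W : Val L} {N : UTm L} {E E' : Finset L.Exc}
      {Ne : {e : L.Exc // e ∈ E} → UTm L} {S : Finset L.Sgn}
      {Ns : {s : L.Sgn // s ∈ S} → UTm L} {ops : Finset L.Op} {C : GTy L.Base}
      {X Y : VTy L} :
      HasK Γ K X ⟨ops, E, S, C⟩ → HasV Γ W C.toV →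
      HasU (C.toV :: X :: Γ) N Y ⟨ops, E'⟩ →
      (∀ e, HasU (C.toV :: Γ) (Ne e) Y ⟨ops, E'⟩) →
      (∀ s, HasU Γ (Ns s) Y ⟨ops, E'⟩) →
      HasU Γ (.kernel K W N E Ne S Ns) Y ⟨ops, E'⟩
  | subsume {Γ : List (VTy L)} {M : UTm L} {X X' : VTy L} {U U' : UEff L} :
      HasU Γ M X U → SubU X U X' U' → HasU Γ M X' U'

/-- Derivations of `Γ ⊢ K : X ↯ E`. -/
inductive HasK : List (VTy L) → KTm L → VTy L → KEff L → Type u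
  | ret {Γ : List (VTy L)} {V : Val L} {X : VTy L} {ops : Finset L.Op} {E : Finset L.Exc}
      {S : Finset L.Sgn} {C : GTy L.Base} :
      HasV Γ V X → HasK Γ (.ret C V) X ⟨ops, E, S, C⟩
  | app {Γ : List (VTy L)} {V W : Val L} {X Y : VTy L} {E : KEff L} :
      HasV Γ V (.kfun X Y E) → HasV Γ W X → HasK Γ (.app V W) Y E
  | tryWith {Γ : List (VTy L)} {K N : KTm L} {ops : Finset L.Op} {E E' : Finset L.Exc}
      {S : Finset L.Sgn} {C : GTy L.Base} {Ne : {e : L.Exc // e ∈ E} → KTm L} {X Y : VTy L} :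
      HasK Γ K X ⟨ops, E, S, C⟩ → HasK (X :: Γ) N Y ⟨ops, E', S, C⟩ →
      (∀ e, HasK Γ (Ne e) Y ⟨ops, E', S, C⟩) →
      HasK Γ (.tryWith K N E Ne) Y ⟨ops, E', S, C⟩
  | matchPair {Γ : List (VTy L)} {V : Val L} {K : KTm L} {X Y Z : VTy L} {E : KEff L} :
      HasV Γ V (.prod X Y) → HasK (Y :: X :: Γ) K Z E → HasK Γ (.matchPair V K) Z E
  | matchEmpty {Γ : List (VTy L)} {V : Val L} {Z : VTy L} {ops : Finset L.Op}
      {E : Finset L.Exc} {S : Finset L.Sgn} {C : GTy L.Base} :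
      HasV Γ V .empty → HasK Γ (.matchEmpty Z C V) Z ⟨ops, E, S, C⟩
  | matchSum {Γ : List (VTy L)} {V : Val L} {K N : KTm L} {X Y Z : VTy L} {E : KEff L} :
      HasV Γ V (.sum X Y) → HasK (X :: Γ) K Z E → HasK (Y :: Γ) N Z E →
      HasK Γ (.matchSum V K N) Z E
  | op {Γ : List (VTy L)} {o : L.Op} {V : Val L} {K : KTm L} {Ne : L.OpExc o → KTm L}
      {X : VTy L} {E : KEff L} :
      o ∈ E.ops → HasV Γ V (L.opPar o).toV → HasK ((L.opRes o).toV :: Γ) K X E →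
      (∀ e, HasK Γ (Ne e) X E) → HasK Γ (.op o X V K Ne) X E
  | raise {Γ : List (VTy L)} {X : VTy L} {e : L.Exc} {ops : Finset L.Op}
      {E : Finset L.Exc} {S : Finset L.Sgn} {C : GTy L.Base} :
      e ∈ E → HasK Γ (.raise X C e) X ⟨ops, E, S, C⟩
  | kill {Γ : List (VTy L)} {X : VTy L} {s : L.Sgn} {ops : Finset L.Op}
      {E : Finset L.Exc} {S : Finset L.Sgn} {C : GTy L.Base} :
      s ∈ S → HasK Γ (.kill X C s) X ⟨ops, E, S, C⟩
  | getenv {Γ : List (VTy L)} {K : KTm L} {X : VTy L} {ops : Finset L.Op}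
      {E : Finset L.Exc} {S : Finset L.Sgn} {C : GTy L.Base} :
      HasK (C.toV :: Γ) K X ⟨ops, E, S, C⟩ → HasK Γ (.getenv C K) X ⟨ops, E, S, C⟩
  | setenv {Γ : List (VTy L)} {V : Val L} {K : KTm L} {X : VTy L} {ops : Finset L.Op}
      {E : Finset L.Exc} {S : Finset L.Sgn} {C : GTy L.Base} :
      HasV Γ V C.toV → HasK Γ K X ⟨ops, E, S, C⟩ → HasK Γ (.setenv V K) X ⟨ops, E, S, C⟩
  | user {Γ : List (VTy L)} {M : UTm L} {K : KTm L} {ops : Finset L.Op}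
      {E E' : Finset L.Exc} {S : Finset L.Sgn} {C : GTy L.Base}
      {Ke : {e : L.Exc // e ∈ E} → KTm L} {X Y : VTy L} :
      HasU Γ M X ⟨ops, E⟩ → HasK (X :: Γ) K Y ⟨ops, E', S, C⟩ →
      (∀ e, HasK Γ (Ke e) Y ⟨ops, E', S, C⟩) →
      HasK Γ (.user M K E Ke) Y ⟨ops, E', S, C⟩
  | subsume {Γ : List (VTy L)} {K : KTm L} {X X' : VTy L} {E E' : KEff L} :
      HasK Γ K X E → SubK X E X' E' → HasK Γ K X' E'

end

/-! ## Skeletal typing derivations -/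

mutual

/-- Derivations of `Γ ⊢ˢ V : P`. -/
inductive SkV : List (STy L) → Val L → STy L → Type u
  | var {Γ : List (STy L)} {i : ℕ} {P : STy L} : Lookup Γ i P → SkV Γ (.var i) P
  | const {Γ : List (STy L)} {f : L.Const} {Vs : Fin (L.arity f) → Val L} {P : STy L} :
      (∀ i, SkV Γ (Vs i) (L.argTy f i).toS) → P = (L.resTy f).toS → SkV Γ (.const f Vs) P
  | unit {Γ : List (STy L)} : SkV Γ .unit .unit
  | pair {Γ : List (STy L)} {V W : Val L} {P Q : STy L} :
      SkV Γ V P → SkV Γ W Q → SkV Γ (.pair V W) (.prod P Q)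
  | inl {Γ : List (STy L)} {V : Val L} {X Y : VTy L} {P Q : STy L} :
      SkV Γ V P → P = X.skel → Q = Y.skel → SkV Γ (.inl X Y V) (.sum P Q)
  | inr {Γ : List (STy L)} {W : Val L} {X Y : VTy L} {P Q : STy L} :
      SkV Γ W Q → P = X.skel → Q = Y.skel → SkV Γ (.inr X Y W) (.sum P Q)
  | ufun {Γ : List (STy L)} {X : VTy L} {M : UTm L} {P Q : STy L} :
      SkU (P :: Γ) M Q → P = X.skel → SkV Γ (.ufun X M) (.ufun P Q)
  | kfun {Γ : List (STy L)} {X : VTy L} {K : KTm L} {P Q : STy L} {C : GTy L.Base} :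
      SkK (P :: Γ) K Q C → P = X.skel → SkV Γ (.kfun X K) (.kfun P Q C)
  | runner {Γ : List (STy L)} {ops : Finset L.Op} {C : GTy L.Base}
      {Ks : {o : L.Op // o ∈ ops} → KTm L} :
      (∀ o : {o : L.Op // o ∈ ops},
        SkK ((L.opPar o).toS :: Γ) (Ks o) (L.opRes o).toS C) →
      SkV Γ (.runner ops Ks C) (.runner C)

/-- Derivations of `Γ ⊢ˢ M : P!`. -/
inductive SkU : List (STy L) → UTm L → STy L → Type u
  | ret {Γ : List (STy L)} {V : Val L} {P : STy L} : SkV Γ V P → SkU Γ (.ret V) P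
  | app {Γ : List (STy L)} {V W : Val L} {P Q : STy L} :
      SkV Γ V (.ufun P Q) → SkV Γ W P → SkU Γ (.app V W) Q
  | tryWith {Γ : List (STy L)} {M N : UTm L} {E : Finset L.Exc}
      {Ne : {e : L.Exc // e ∈ E} → UTm L} {P Q : STy L} :
      SkU Γ M P → SkU (P :: Γ) N Q → (∀ e, SkU Γ (Ne e) Q) → SkU Γ (.tryWith M N E Ne) Q
  | matchPair {Γ : List (STy L)} {V : Val L} {M : UTm L} {P P' Q : STy L} :
      SkV Γ V (.prod P P') → SkU (P' :: P :: Γ) M Q → SkU Γ (.matchPair V M) Q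
  | matchEmpty {Γ : List (STy L)} {V : Val L} {Z : VTy L} {Q : STy L} :
      SkV Γ V .empty → Q = Z.skel → SkU Γ (.matchEmpty Z V) Q
  | matchSum {Γ : List (STy L)} {V : Val L} {M N : UTm L} {P P' Q : STy L} :
      SkV Γ V (.sum P P') → SkU (P :: Γ) M Q → SkU (P' :: Γ) N Q → SkU Γ (.matchSum V M N) Q
  | op {Γ : List (STy L)} {o : L.Op} {X : VTy L} {V : Val L} {M : UTm L}
      {Ne : L.OpExc o → UTm L} {P : STy L} :
      SkV Γ V (L.opPar o).toS → SkU ((L.opRes o).toS :: Γ) M P → (∀ e, SkU Γ (Ne e) P) →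
      P = X.skel → SkU Γ (.op o X V M Ne) P
  | raise {Γ : List (STy L)} {X : VTy L} {e : L.Exc} {P : STy L} :
      P = X.skel → SkU Γ (.raise X e) P
  | run {Γ : List (STy L)} {V W : Val L} {M N : UTm L} {E : Finset L.Exc}
      {Ne : {e : L.Exc // e ∈ E} → UTm L} {S : Finset L.Sgn}
      {Ns : {s : L.Sgn // s ∈ S} → UTm L} {C : GTy L.Base} {P Q : STy L} :
      SkV Γ V (.runner C) → SkV Γ W C.toS → SkU Γ M P → SkU (C.toS :: P :: Γ) N Q →
      (∀ e, SkU (C.toS :: Γ) (Ne e) Q) → (∀ s, SkU Γ (Ns s) Q) →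
      SkU Γ (.run V W M N E Ne S Ns) Q
  | kernel {Γ : List (STy L)} {K : KTm L} {W : Val L} {N : UTm L} {E : Finset L.Exc}
      {Ne : {e : L.Exc // e ∈ E} → UTm L} {S : Finset L.Sgn}
      {Ns : {s : L.Sgn // s ∈ S} → UTm L} {C : GTy L.Base} {P Q : STy L} :
      SkK Γ K P C → SkV Γ W C.toS → SkU (C.toS :: P :: Γ) N Q →
      (∀ e, SkU (C.toS :: Γ) (Ne e) Q) → (∀ s, SkU Γ (Ns s) Q) →
      SkU Γ (.kernel K W N E Ne S Ns) Q

/-- Derivations of `Γ ⊢ˢ K : P ↯ C`. -/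
inductive SkK : List (STy L) → KTm L → STy L → GTy L.Base → Type u
  | ret {Γ : List (STy L)} {V : Val L} {P : STy L} {C : GTy L.Base} :
      SkV Γ V P → SkK Γ (.ret C V) P C
  | app {Γ : List (STy L)} {V W : Val L} {P Q : STy L} {C : GTy L.Base} :
      SkV Γ V (.kfun P Q C) → SkV Γ W P → SkK Γ (.app V W) Q C
  | tryWith {Γ : List (STy L)} {K N : KTm L} {E : Finset L.Exc}
      {Ne : {e : L.Exc // e ∈ E} → KTm L} {P Q : STy L} {C : GTy L.Base} :
      SkK Γ K P C → SkK (P :: Γ) N Q C → (∀ e, SkK Γ (Ne e) Q C) →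
      SkK Γ (.tryWith K N E Ne) Q C
  | matchPair {Γ : List (STy L)} {V : Val L} {K : KTm L} {P P' Q : STy L} {C : GTy L.Base} :
      SkV Γ V (.prod P P') → SkK (P' :: P :: Γ) K Q C → SkK Γ (.matchPair V K) Q C
  | matchEmpty {Γ : List (STy L)} {V : Val L} {Z : VTy L} {Q : STy L} {C : GTy L.Base} :
      SkV Γ V .empty → Q = Z.skel → SkK Γ (.matchEmpty Z C V) Q C
  | matchSum {Γ : List (STy L)} {V : Val L} {K N : KTm L} {P P' Q : STy L}
      {C : GTy L.Base} :
      SkV Γ V (.sum P P') → SkK (P :: Γ) K Q C → SkK (P' :: Γ) N Q C →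
      SkK Γ (.matchSum V K N) Q C
  | op {Γ : List (STy L)} {o : L.Op} {X : VTy L} {V : Val L} {K : KTm L}
      {Ne : L.OpExc o → KTm L} {P : STy L} {C : GTy L.Base} :
      SkV Γ V (L.opPar o).toS → SkK ((L.opRes o).toS :: Γ) K P C → (∀ e, SkK Γ (Ne e) P C) →
      P = X.skel → SkK Γ (.op o X V K Ne) P C
  | raise {Γ : List (STy L)} {X : VTy L} {e : L.Exc} {P : STy L} {C : GTy L.Base} :
      P = X.skel → SkK Γ (.raise X C e) P C
  | kill {Γ : List (STy L)} {X : VTy L} {s : L.Sgn} {P : STy L} {C : GTy L.Base} :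
      P = X.skel → SkK Γ (.kill X C s) P C
  | getenv {Γ : List (STy L)} {K : KTm L} {P : STy L} {C : GTy L.Base} :
      SkK (C.toS :: Γ) K P C → SkK Γ (.getenv C K) P C
  | setenv {Γ : List (STy L)} {V : Val L} {K : KTm L} {P : STy L} {C : GTy L.Base} :
      SkV Γ V C.toS → SkK Γ K P C → SkK Γ (.setenv V K) P C
  | user {Γ : List (STy L)} {M : UTm L} {K : KTm L} {E : Finset L.Exc}
      {Ke : {e : L.Exc // e ∈ E} → KTm L} {P Q : STy L} {C : GTy L.Base} :
      SkU Γ M P → SkK (P :: Γ) K Q C → (∀ e, SkK Γ (Ke e) Q C) →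
      SkK Γ (.user M K E Ke) Q C

end

/-- The skeleton of a context. -/
@[reducible] def skelCtx : List (VTy L) → List (STy L)
  | [] => []
  | X :: Γ => X.skel :: skelCtx Γ

/-- The skeleton of a variable lookup. -/
def Lookup.skel : {Γ : List (VTy L)} → {i : ℕ} → {X : VTy L} →
    Lookup Γ i X → Lookup (skelCtx Γ) i X.skel
  | _, _, _, .zero => .zero
  | _, _, _, .succ h => .succ h.skel

mutual

/-- The skeleton of a value typing derivation: each rule is replaced with the matching skeletal
one, and subsumption is skipped. -/
def HasV.skel : {Γ : List (VTy L)} → {V : Val L} → {X : VTy L} →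
    HasV Γ V X → SkV (skelCtx Γ) V X.skel
  | _, _, _, .var h => .var h.skel
  | _, _, _, .const h hX => .const (fun i => (h i).skel) (congrArg VTy.skel hX)
  | _, _, _, .unit => .unit
  | _, _, _, .pair h h' => .pair h.skel h'.skel
  | _, _, _, .inl h => .inl h.skel rfl rfl
  | _, _, _, .inr h => .inr h.skel rfl rfl
  | _, _, _, .ufun h => .ufun h.skel rfl
  | _, _, _, .kfun h => .kfun h.skel rfl
  | _, _, _, .runner h => .runner (fun o => (h o).skel)
  | _, _, _, .subsume h hs => hs.skel_eq ▸ h.skel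

/-- The skeleton of a user typing derivation. -/
def HasU.skel : {Γ : List (VTy L)} → {M : UTm L} → {X : VTy L} → {U : UEff L} →
    HasU Γ M X U → SkU (skelCtx Γ) M X.skel
  | _, _, _, _, .ret h => .ret h.skel
  | _, _, _, _, .app h h' => .app h.skel h'.skel
  | _, _, _, _, .tryWith h h' he => .tryWith h.skel h'.skel (fun e => (he e).skel)
  | _, _, _, _, .matchPair h h' => .matchPair h.skel h'.skel
  | _, _, _, _, .matchEmpty h => .matchEmpty h.skel rfl
  | _, _, _, _, .matchSum h h' h'' => .matchSum h.skel h'.skel h''.skel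
  | _, _, _, _, .op _ h h' he => .op h.skel h'.skel (fun e => (he e).skel) rfl
  | _, _, _, _, .raise _ => .raise rfl
  | _, _, _, _, .run h h' hM hN he hs =>
      .run h.skel h'.skel hM.skel hN.skel (fun e => (he e).skel) (fun s => (hs s).skel)
  | _, _, _, _, .kernel h h' hN he hs =>
      .kernel h.skel h'.skel hN.skel (fun e => (he e).skel) (fun s => (hs s).skel)
  | _, _, _, _, .subsume h hs => hs.val.skel_eq ▸ h.skel

/-- The skeleton of a kernel typing derivation. -/
def HasK.skel : {Γ : List (VTy L)} → {K : KTm L} → {X : VTy L} → {E : KEff L} →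
    HasK Γ K X E → SkK (skelCtx Γ) K X.skel E.st
  | _, _, _, _, .ret h => .ret h.skel
  | _, _, _, _, .app h h' => .app h.skel h'.skel
  | _, _, _, _, .tryWith h h' he => .tryWith h.skel h'.skel (fun e => (he e).skel)
  | _, _, _, _, .matchPair h h' => .matchPair h.skel h'.skel
  | _, _, _, _, .matchEmpty h => .matchEmpty h.skel rfl
  | _, _, _, _, .matchSum h h' h'' => .matchSum h.skel h'.skel h''.skel
  | _, _, _, _, .op _ h h' he => .op h.skel h'.skel (fun e => (he e).skel) rfl
  | _, _, _, _, .raise _ => .raise rfl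
  | _, _, _, _, .kill _ => .kill rfl
  | _, _, _, _, .getenv h => .getenv h.skel
  | _, _, _, _, .setenv h h' => .setenv h.skel h'.skel
  | _, _, _, _, .user h h' he => .user h.skel h'.skel (fun e => (he e).skel)
  | _, _, _, _, .subsume h hs => hs.val.skel_eq ▸ hs.st ▸ h.skel

end

/-! ## Denotations of types -/

/-- Denotation of ground types, given denotations of base types. -/
@[reducible] def GTy.den {B : Type u} (b : B → Type u) : GTy B → Type u
  | .base x => b x
  | .unit => PUnit
  | .empty => PEmpty
  | .prod A A' => A.den b × A'.den b
  | .sum A A' => A.den b ⊕ A'.den b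

/-- Sets denoting the base types and maps denoting the ground constants. -/
structure Model (L : Lang.{u}) : Type (u + 1) where
  base : L.Base → Type u
  const : (f : L.Const) → ((i : Fin (L.arity f)) → (L.argTy f i).den base) →
    (L.resTy f).den base

section Semantics

variable (m : Model L)

/-- Parameter set of an operation. -/
abbrev OpPar (o : L.Op) : Type u := (L.opPar o).den m.base

/-- Result set of an operation. -/
abbrev OpRes (o : L.Op) : Type u := (L.opRes o).den m.base

/-- Computation trees over all operations: a node `op (a, κ, (ν_e)_{e ∈ E_op})` has a branch for
every result and a branch for every exception of `op`. -/
inductive Tree (X : Type u) : Type u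
  | ret (x : X)
  | node (o : L.Op) (a : OpPar m o) (κ : OpRes m o → Tree X) (ν : L.OpExc o → Tree X)

variable {m}

/-- Kleisli extension. -/
def Tree.bind {X Y : Type u} (f : X → Tree m Y) : Tree m X → Tree m Y
  | .ret x => f x
  | .node o a κ ν => .node o a (fun b => (κ b).bind f) (fun e => (ν e).bind f)

variable (m)

/-- The runtime error. -/
def ripTree {X : Type u} : Tree m X :=
  .node L.rip (cast (by rw [OpPar, L.rip_par]) PUnit.unit.{u + 1})
    (fun b => PEmpty.elim (cast (by rw [OpRes, L.rip_res]) b))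
    (fun e => absurd (L.rip_exc ▸ e.2 : e.1 ∈ (∅ : Finset L.Exc)) (Finset.notMem_empty _))

/-- The skeletal user monad. -/
abbrev UMon (X : Type u) : Type u := Tree m (X ⊕ L.Exc)

/-- The kernel monad over all operations and all signals, with exceptions `E` and state `C`. -/
abbrev KMon (E C X : Type u) : Type u := C → Tree m (((X ⊕ E) × C) ⊕ L.Sgn)

/-- Skeletal runners with state `C`. -/
abbrev RunnerSk (C : Type u) : Type u :=
  (o : L.Op) → OpPar m o → KMon m (L.OpExc o) C (OpRes m o)

/-- Denotations of skeletal types. -/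
@[reducible] def STy.den : STy L → Type u
  | .base b => m.base b
  | .unit => PUnit
  | .empty => PEmpty
  | .prod P Q => P.den × Q.den
  | .sum P Q => P.den ⊕ Q.den
  | .ufun P Q => P.den → UMon m Q.den
  | .kfun P Q C => P.den → KMon m L.Exc (C.den m.base) Q.den
  | .runner C => RunnerSk m (C.den m.base)

/-- A ground type denotes the same set as a ground type and as a skeletal type. -/
def GTy.equiv : (A : GTy L.Base) → A.den m.base ≃ A.toS.den m
  | .base _ => Equiv.refl _
  | .unit => Equiv.refl _
  | .empty => Equiv.refl _
  | .prod A B => Equiv.prodCongr (GTy.equiv A) (GTy.equiv B)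
  | .sum A B => Equiv.sumCongr (GTy.equiv A) (GTy.equiv B)

/-- Denotations of skeletal contexts. -/
@[reducible] def Env : List (STy L) → Type u
  | [] => PUnit
  | P :: Γ => P.den m × Env Γ

/-! ## Refinement subsets -/

variable {m}

/-- `t.Within ops Q`: the tree `t` only uses operations in `ops`, and its leaves satisfy `Q`.
These are the trees in `Tree_ops Q`. -/
def Tree.Within {X : Type u} (ops : Finset L.Op) (Q : X → Prop) : Tree m X → Prop
  | .ret x => Q x
  | .node o _ κ ν => o ∈ ops ∧ (∀ b, (κ b).Within ops Q) ∧ (∀ e, (ν e).Within ops Q)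

/-- The subset `U_{ops, E} X₀` of the skeletal user monad. -/
def URef {X : Type u} (X₀ : Set X) (U : UEff L) : Set (UMon m X) :=
  {t | t.Within U.ops (fun
    | .inl x => x ∈ X₀
    | .inr e => e ∈ U.exc)}

/-- The subset `K_{C, ops, E₀, S} X₀` of the kernel monad. -/
def KRef {E C X : Type u} (X₀ : Set X) (ops : Finset L.Op) (E₀ : Set E) (S : Finset L.Sgn) :
    Set (KMon m E C X) :=
  {k | ∀ c, (k c).Within ops (fun
    | .inl (.inl x, _) => x ∈ X₀
    | .inl (.inr e, _) => e ∈ E₀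
    | .inr s => s ∈ S)}

variable (m)

/-- The denotation of a value type as a subset of the denotation of its skeleton. -/
def VTy.ref : (X : VTy L) → Set (X.skel.den m)
  | .base _ => Set.univ
  | .unit => Set.univ
  | .empty => Set.univ
  | .prod X Y => {p : X.skel.den m × Y.skel.den m | p.1 ∈ X.ref ∧ p.2 ∈ Y.ref}
  | .sum X Y => {p : X.skel.den m ⊕ Y.skel.den m | Sum.elim (· ∈ X.ref) (· ∈ Y.ref) p}
  | .ufun X Y U => {f : X.skel.den m → UMon m (Y.skel.den m) |
      ∀ x ∈ X.ref, f x ∈ URef Y.ref U}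
  | .kfun X Y K => {f : X.skel.den m → KMon m L.Exc (K.st.den m.base) (Y.skel.den m) |
      ∀ x ∈ X.ref, f x ∈ KRef Y.ref K.ops {e | e ∈ K.exc} K.sgn}
  | .runner ops ops' S C => {R : RunnerSk m (C.den m.base) |
      ∀ o ∈ ops, ∀ a, R o a ∈ KRef Set.univ ops' Set.univ S}

/-- The denotation of a user type `X ! U`. -/
def UTyRef (X : VTy L) (U : UEff L) : Set (UMon m (X.skel.den m)) := URef (X.ref m) U

/-- The denotation of a kernel type `X ↯ K`. -/
def KTyRef (X : VTy L) (K : KEff L) :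
    Set (KMon m L.Exc (K.st.den m.base) (X.skel.den m)) :=
  KRef (X.ref m) K.ops {e | e ∈ K.exc} K.sgn

/-- The denotation of a context. -/
def CtxRef : (Γ : List (VTy L)) → Set (Env m (skelCtx Γ))
  | [] => Set.univ
  | X :: Γ => {γ : X.skel.den m × Env m (skelCtx Γ) | γ.1 ∈ X.ref m ∧ γ.2 ∈ CtxRef Γ}

/-! ## Skeletal semantics of terms -/

variable {m}

/-- The semantics of variables. -/
def Lookup.den : {Γ : List (STy L)} → {i : ℕ} → {P : STy L} → Lookup Γ i P → Env m Γ → P.den m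
  | _, _, _, .zero, γ => γ.1
  | _, _, _, .succ h, γ => h.den γ.2

open Classical in
/-- The member of a finite family given by an index `x`, with a default for indices outside of
the index set `E`. -/
noncomputable def clause {α T : Type u} (E : Finset α) (N : {x : α // x ∈ E} → T) (dflt : T)
    (x : α) : T :=
  if h : x ∈ E then N ⟨x, h⟩ else dflt

/-- The monad morphism from trees to kernel computations induced by a skeletal runner. -/
def runTree {C X : Type u} (R : RunnerSk m C) : Tree m X → C → Tree m ((X × C) ⊕ L.Sgn)
  | .ret x => fun c => .ret (.inl (x, c))
  | .node o a κ ν => fun c => (R o a c).bind (fun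
      | .inl (.inl b, c') => runTree R (κ b) c'
      | .inl (.inr e, c') => runTree R (ν e) c'
      | .inr s => .ret (.inr s))

/-- Exception handling in user mode; exceptions outside of `E` are runtime errors. -/
noncomputable def handleU {P Q : Type u} (N : P → UMon m Q)
    (E : Finset L.Exc) (Ne : {e : L.Exc // e ∈ E} → UMon m Q) (t : UMon m P) : UMon m Q :=
  t.bind (fun
    | .inl p => N p
    | .inr e => clause E Ne (ripTree m) e)

/-- Exception handling in kernel mode; exceptions outside of `E` are runtime errors, and signals
are passed on. -/
noncomputable def handleK {C P Q : Type u} (N : P → KMon m L.Exc C Q)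
    (E : Finset L.Exc) (Ne : {e : L.Exc // e ∈ E} → KMon m L.Exc C Q)
    (k : KMon m L.Exc C P) : KMon m L.Exc C Q :=
  fun c => (k c).bind (fun
    | .inl (.inl p, c') => N p c'
    | .inl (.inr e, c') => clause E Ne (fun _ => ripTree m) e c'
    | .inr s => .ret (.inr s))

/-- Running user code in kernel mode, with clauses for its value and its exceptions; exceptions
outside of `E` are runtime errors. -/
noncomputable def userK {C P Q : Type u} (N : P → KMon m L.Exc C Q)
    (E : Finset L.Exc) (Ne : {e : L.Exc // e ∈ E} → KMon m L.Exc C Q)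
    (t : UMon m P) : KMon m L.Exc C Q :=
  fun c => t.bind (fun
    | .inl p => N p c
    | .inr e => clause E Ne (fun _ => ripTree m) e c)

/-- The finalisation map: a kernel computation is run in a state, and its outcomes are handled by
the clauses for returned values, for exceptions in `E`, and for signals in `S`; all other
exceptions and signals are runtime errors. -/
noncomputable def finalise {C P Q : Type u} (N : P → C → UMon m Q)
    (E : Finset L.Exc) (Ne : {e : L.Exc // e ∈ E} → C → UMon m Q)
    (S : Finset L.Sgn) (Ns : {s : L.Sgn // s ∈ S} → UMon m Q)
    (k : KMon m L.Exc C P) (c : C) : UMon m Q :=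
  (k c).bind (fun
    | .inl (.inl p, c') => N p c'
    | .inl (.inr e, c') => clause E (fun e => Ne e c') (ripTree m) e
    | .inr s => clause S Ns (ripTree m) s)

/-- The map restricting the exceptions of a kernel computation to those of the operation `o`; all
other exceptions are runtime errors. -/
noncomputable def restrictExc {C P : Type u} (o : L.Op) (i : P → OpRes m o)
    (k : KMon m L.Exc C P) : KMon m (L.OpExc o) C (OpRes m o) :=
  fun c => (k c).bind (fun
    | .inl (.inl p, c') => .ret (.inl (.inl (i p), c'))
    | .inl (.inr e, c') =>
        clause (L.opExc o) (fun e => .ret (.inl (.inr e, c'))) (ripTree m) e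
    | .inr s => .ret (.inr s))

open Classical in
/-- The skeletal runner given by co-operations for `ops`; all other ones are runtime errors. -/
noncomputable def mkRunner {C : Type u} (ops : Finset L.Op)
    (R : (o : {o : L.Op // o ∈ ops}) → OpPar m o.1 → KMon m (L.OpExc o.1) C (OpRes m o.1)) :
    RunnerSk m C :=
  fun o a => if h : o ∈ ops then R ⟨o, h⟩ a else fun _ => ripTree m

mutual

/-- Skeletal semantics of values. -/
noncomputable def SkV.den : {Γ : List (STy L)} → {V : Val L} → {P : STy L} →
    SkV Γ V P → Env m Γ → P.den m
  | _, _, _, .var h, γ => h.den γ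
  | _, _, _, .const (f := f) h hP, γ =>
      cast (congrArg (STy.den m) hP.symm)
        ((L.resTy f).equiv m (m.const f (fun i => ((L.argTy f i).equiv m).symm ((h i).den γ))))
  | _, _, _, .unit, _ => PUnit.unit
  | _, _, _, .pair h h', γ => (h.den γ, h'.den γ)
  | _, _, _, .inl h _ _, γ => Sum.inl (h.den γ)
  | _, _, _, .inr h _ _, γ => Sum.inr (h.den γ)
  | _, _, _, .ufun h _, γ => fun x => h.den (x, γ)
  | _, _, _, .kfun h _, γ => fun x => h.den (x, γ)
  | _, _, _, .runner (ops := ops) h, γ => mkRunner ops (fun o a =>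
      restrictExc o.1 ((L.opRes o.1).equiv m).symm ((h o).den ((L.opPar o.1).equiv m a, γ)))

/-- Skeletal semantics of user computations. -/
noncomputable def SkU.den : {Γ : List (STy L)} → {M : UTm L} → {P : STy L} →
    SkU Γ M P → Env m Γ → UMon m (P.den m)
  | _, _, _, .ret h, γ => .ret (.inl (h.den γ))
  | _, _, _, .app h h', γ => h.den γ (h'.den γ)
  | _, _, _, .tryWith (E := E) h hN hE, γ =>
      handleU (fun p => hN.den (p, γ)) E (fun e => (hE e).den γ) (h.den γ)
  | _, _, _, .matchPair h hM, γ => hM.den ((h.den γ).2, (h.den γ).1, γ)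
  | _, _, _, .matchEmpty h _, γ => PEmpty.elim (h.den γ)
  | _, _, _, .matchSum h hM hN, γ =>
      Sum.elim (fun p => hM.den (p, γ)) (fun p => hN.den (p, γ)) (h.den γ)
  | _, _, _, .op (o := o) h hM hE _, γ =>
      .node o (((L.opPar o).equiv m).symm (h.den γ))
        (fun b => hM.den ((L.opRes o).equiv m b, γ)) (fun e => (hE e).den γ)
  | _, _, _, .raise (e := e) _, _ => .ret (.inr e)
  | _, _, _, .run (E := E) (S := S) (C := C) hV hW hM hN hE hS, γ =>
      finalise (fun p c => hN.den (C.equiv m c, p, γ))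
        E (fun e c => (hE e).den (C.equiv m c, γ)) S (fun s => (hS s).den γ)
        (runTree (hV.den γ) (hM.den γ)) ((C.equiv m).symm (hW.den γ))
  | _, _, _, .kernel (E := E) (S := S) (C := C) hK hW hN hE hS, γ =>
      finalise (fun p c => hN.den (C.equiv m c, p, γ))
        E (fun e c => (hE e).den (C.equiv m c, γ)) S (fun s => (hS s).den γ)
        (hK.den γ) ((C.equiv m).symm (hW.den γ))

/-- Skeletal semantics of kernel computations. -/
noncomputable def SkK.den : {Γ : List (STy L)} → {K : KTm L} → {P : STy L} → {C : GTy L.Base} →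
    SkK Γ K P C → Env m Γ → KMon m L.Exc (C.den m.base) (P.den m)
  | _, _, _, _, .ret h, γ => fun c => .ret (.inl (.inl (h.den γ), c))
  | _, _, _, _, .app h h', γ => h.den γ (h'.den γ)
  | _, _, _, _, .tryWith (E := E) h hN hE, γ =>
      handleK (fun p => hN.den (p, γ)) E (fun e => (hE e).den γ) (h.den γ)
  | _, _, _, _, .matchPair h hK, γ => hK.den ((h.den γ).2, (h.den γ).1, γ)
  | _, _, _, _, .matchEmpty h _, γ => PEmpty.elim (h.den γ)
  | _, _, _, _, .matchSum h hK hN, γ =>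
      Sum.elim (fun p => hK.den (p, γ)) (fun p => hN.den (p, γ)) (h.den γ)
  | _, _, _, _, .op (o := o) h hK hE _, γ => fun c =>
      .node o (((L.opPar o).equiv m).symm (h.den γ))
        (fun b => hK.den ((L.opRes o).equiv m b, γ) c) (fun e => (hE e).den γ c)
  | _, _, _, _, .raise (e := e) _, _ => fun c => .ret (.inl (.inr e, c))
  | _, _, _, _, .kill (s := s) _, _ => fun _ => .ret (.inr s)
  | _, _, _, _, .getenv (C := C) h, γ => fun c => h.den (C.equiv m c, γ) c
  | _, _, _, _, .setenv (C := C) h h', γ => fun _ => h'.den γ ((C.equiv m).symm (h.den γ))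
  | _, _, _, _, .user (E := E) h hK hE, γ =>
      userK (fun p => hK.den (p, γ)) E (fun e => (hE e).den γ) (h.den γ)

end

variable (m)

/-- The meaning of a derivation of `Γ ⊢ V : X`. -/
noncomputable def HasV.den {Γ : List (VTy L)} {V : Val L} {X : VTy L} (D : HasV Γ V X) :
    Env m (skelCtx Γ) → X.skel.den m :=
  D.skel.den

/-- The meaning of a derivation of `Γ ⊢ M : X ! U`. -/
noncomputable def HasU.den {Γ : List (VTy L)} {M : UTm L} {X : VTy L} {U : UEff L}
    (D : HasU Γ M X U) : Env m (skelCtx Γ) → UMon m (X.skel.den m) :=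
  D.skel.den

/-- The meaning of a derivation of `Γ ⊢ K : X ↯ E`. -/
noncomputable def HasK.den {Γ : List (VTy L)} {K : KTm L} {X : VTy L} {E : KEff L}
    (D : HasK Γ K X E) : Env m (skelCtx Γ) → KMon m L.Exc (E.st.den m.base) (X.skel.den m) :=
  D.skel.den

end Semantics

/-! ## Equational theory

The equations below are between raw terms; they are instantiated only at terms that are both well
typed in the given context and at the given type. Type annotations on the right-hand side of an
equation may be arbitrary, as long as this is the case. -/

/-- Equations between values. -/
inductive AxV : Val L → Val L → Prop
  | ufunEta (X : VTy L) (V : Val L) : AxV (.ufun X (.app (V.ren (wk 1)) (.var 0))) V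
  | kfunEta (X : VTy L) (V : Val L) : AxV (.kfun X (.app (V.ren (wk 1)) (.var 0))) V

/-- Computational equations between user computations. -/
inductive AxU : UTm L → UTm L → Prop
  | beta (X : VTy L) (M : UTm L) (V : Val L) :
      AxU (.app (.ufun X M) V) (M.subst (sub1 V))
  | tryRet (V : Val L) (N : UTm L) (E : Finset L.Exc) (Ne : {e : L.Exc // e ∈ E} → UTm L) :
      AxU (.tryWith (.ret V) N E Ne) (N.subst (sub1 V))
  | tryRaise (X : VTy L) (N : UTm L) (E : Finset L.Exc) (Ne : {e : L.Exc // e ∈ E} → UTm L)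
      (e : {e : L.Exc // e ∈ E}) :
      AxU (.tryWith (.raise X e.1) N E Ne) (Ne e)
  | tryOp (o : L.Op) (X X' : VTy L) (V : Val L) (M : UTm L) (Me : L.OpExc o → UTm L)
      (N : UTm L) (E : Finset L.Exc) (Ne : {e : L.Exc // e ∈ E} → UTm L) :
      AxU (.tryWith (.op o X V M Me) N E Ne)
        (.op o X' V
          (.tryWith M (N.ren (liftRen (wk 1))) E (fun e => (Ne e).ren (wk 1)))
          (fun e' => .tryWith (Me e') N E Ne))
  | matchPair (V W : Val L) (M : UTm L) :
      AxU (.matchPair (.pair V W) M) (M.subst (sub2 V W))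
  | matchEmpty (X : VTy L) (V : Val L) (N : UTm L) : AxU (.matchEmpty X V) N
  | matchInl (X Y : VTy L) (V : Val L) (M N : UTm L) :
      AxU (.matchSum (.inl X Y V) M N) (M.subst (sub1 V))
  | matchInr (X Y : VTy L) (W : Val L) (M N : UTm L) :
      AxU (.matchSum (.inr X Y W) M N) (N.subst (sub1 W))
  | runRet (V W V' : Val L) (N : UTm L) (E : Finset L.Exc)
      (Ne : {e : L.Exc // e ∈ E} → UTm L) (S : Finset L.Sgn)
      (Ns : {s : L.Sgn // s ∈ S} → UTm L) :
      AxU (.run V W (.ret V') N E Ne S Ns) (N.subst (sub2 V' W))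
  | runRaise (V W : Val L) (X : VTy L) (N : UTm L) (E : Finset L.Exc)
      (Ne : {e : L.Exc // e ∈ E} → UTm L) (S : Finset L.Sgn)
      (Ns : {s : L.Sgn // s ∈ S} → UTm L) (e : {e : L.Exc // e ∈ E}) :
      AxU (.run V W (.raise X e.1) N E Ne S Ns) ((Ne e).subst (sub1 W))
  | runOp (ops : Finset L.Op) (Ks : {o : L.Op // o ∈ ops} → KTm L) (C : GTy L.Base)
      (W : Val L) (o : {o : L.Op // o ∈ ops}) (X : VTy L) (V : Val L) (M : UTm L)
      (Me : L.OpExc o.1 → UTm L) (N : UTm L) (E : Finset L.Exc)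
      (Ne : {e : L.Exc // e ∈ E} → UTm L) (S : Finset L.Sgn)
      (Ns : {s : L.Sgn // s ∈ S} → UTm L) :
      AxU (.run (.runner ops Ks C) W (.op o.1 X V M Me) N E Ne S Ns)
        (.kernel ((Ks o).subst (sub1 V)) W
          (.run ((Val.runner ops Ks C).ren (wk 2)) (.var 0) (M.ren (wk 1))
            (N.ren (liftRen (liftRen (wk 2))))
            E (fun e => (Ne e).ren (liftRen (wk 2)))
            S (fun s => (Ns s).ren (wk 2)))
          (L.opExc o.1)
          (fun e' =>
            .run ((Val.runner ops Ks C).ren (wk 1)) (.var 0) ((Me e').ren (wk 1))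
              (N.ren (liftRen (liftRen (wk 1))))
              E (fun e => (Ne e).ren (liftRen (wk 1)))
              S (fun s => (Ns s).ren (wk 1)))
          S Ns)
  | kernelRet (C : GTy L.Base) (V W : Val L) (N : UTm L) (E : Finset L.Exc)
      (Ne : {e : L.Exc // e ∈ E} → UTm L) (S : Finset L.Sgn)
      (Ns : {s : L.Sgn // s ∈ S} → UTm L) :
      AxU (.kernel (.ret C V) W N E Ne S Ns) (N.subst (sub2 V W))
  | kernelRaise (X : VTy L) (C : GTy L.Base) (W : Val L) (N : UTm L) (E : Finset L.Exc)
      (Ne : {e : L.Exc // e ∈ E} → UTm L) (S : Finset L.Sgn)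
      (Ns : {s : L.Sgn // s ∈ S} → UTm L) (e : {e : L.Exc // e ∈ E}) :
      AxU (.kernel (.raise X C e.1) W N E Ne S Ns) ((Ne e).subst (sub1 W))
  | kernelKill (X : VTy L) (C : GTy L.Base) (W : Val L) (N : UTm L) (E : Finset L.Exc)
      (Ne : {e : L.Exc // e ∈ E} → UTm L) (S : Finset L.Sgn)
      (Ns : {s : L.Sgn // s ∈ S} → UTm L) (s : {s : L.Sgn // s ∈ S}) :
      AxU (.kernel (.kill X C s.1) W N E Ne S Ns) (Ns s)
  | kernelGetenv (C : GTy L.Base) (K : KTm L) (W : Val L) (N : UTm L) (E : Finset L.Exc)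
      (Ne : {e : L.Exc // e ∈ E} → UTm L) (S : Finset L.Sgn)
      (Ns : {s : L.Sgn // s ∈ S} → UTm L) :
      AxU (.kernel (.getenv C K) W N E Ne S Ns)
        (.kernel (K.subst (sub1 W)) W N E Ne S Ns)
  | kernelSetenv (V : Val L) (K : KTm L) (W : Val L) (N : UTm L) (E : Finset L.Exc)
      (Ne : {e : L.Exc // e ∈ E} → UTm L) (S : Finset L.Sgn)
      (Ns : {s : L.Sgn // s ∈ S} → UTm L) :
      AxU (.kernel (.setenv V K) W N E Ne S Ns) (.kernel K V N E Ne S Ns)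
  | kernelOp (o : L.Op) (X X' : VTy L) (V : Val L) (K : KTm L) (Ke : L.OpExc o → KTm L)
      (W : Val L) (N : UTm L) (E : Finset L.Exc)
      (Ne : {e : L.Exc // e ∈ E} → UTm L) (S : Finset L.Sgn)
      (Ns : {s : L.Sgn // s ∈ S} → UTm L) :
      AxU (.kernel (.op o X V K Ke) W N E Ne S Ns)
        (.op o X' V
          (.kernel K (W.ren (wk 1)) (N.ren (liftRen (liftRen (wk 1))))
            E (fun e => (Ne e).ren (liftRen (wk 1))) S (fun s => (Ns s).ren (wk 1)))
          (fun e' => .kernel (Ke e') W N E Ne S Ns))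

/-- Equations between kernel computations: the computational ones and those of the kernel
theory. -/
inductive AxK : KTm L → KTm L → Prop
  | beta (X : VTy L) (K : KTm L) (V : Val L) :
      AxK (.app (.kfun X K) V) (K.subst (sub1 V))
  | tryRet (C : GTy L.Base) (V : Val L) (N : KTm L) (E : Finset L.Exc)
      (Ne : {e : L.Exc // e ∈ E} → KTm L) :
      AxK (.tryWith (.ret C V) N E Ne) (N.subst (sub1 V))
  | tryRaise (X : VTy L) (C : GTy L.Base) (N : KTm L) (E : Finset L.Exc)
      (Ne : {e : L.Exc // e ∈ E} → KTm L) (e : {e : L.Exc // e ∈ E}) :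
      AxK (.tryWith (.raise X C e.1) N E Ne) (Ne e)
  | tryKill (X X' : VTy L) (C : GTy L.Base) (s : L.Sgn) (N : KTm L) (E : Finset L.Exc)
      (Ne : {e : L.Exc // e ∈ E} → KTm L) :
      AxK (.tryWith (.kill X C s) N E Ne) (.kill X' C s)
  | tryOp (o : L.Op) (X X' : VTy L) (V : Val L) (K : KTm L) (Ke : L.OpExc o → KTm L)
      (N : KTm L) (E : Finset L.Exc) (Ne : {e : L.Exc // e ∈ E} → KTm L) :
      AxK (.tryWith (.op o X V K Ke) N E Ne)
        (.op o X' V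
          (.tryWith K (N.ren (liftRen (wk 1))) E (fun e => (Ne e).ren (wk 1)))
          (fun e' => .tryWith (Ke e') N E Ne))
  | tryGetenv (C : GTy L.Base) (K N : KTm L) (E : Finset L.Exc)
      (Ne : {e : L.Exc // e ∈ E} → KTm L) :
      AxK (.tryWith (.getenv C K) N E Ne)
        (.getenv C (.tryWith K (N.ren (liftRen (wk 1))) E (fun e => (Ne e).ren (wk 1))))
  | trySetenv (V : Val L) (K N : KTm L) (E : Finset L.Exc)
      (Ne : {e : L.Exc // e ∈ E} → KTm L) :
      AxK (.tryWith (.setenv V K) N E Ne) (.setenv V (.tryWith K N E Ne))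
  | matchPair (V W : Val L) (K : KTm L) :
      AxK (.matchPair (.pair V W) K) (K.subst (sub2 V W))
  | matchEmpty (X : VTy L) (C : GTy L.Base) (V : Val L) (K : KTm L) :
      AxK (.matchEmpty X C V) K
  | matchInl (X Y : VTy L) (V : Val L) (K N : KTm L) :
      AxK (.matchSum (.inl X Y V) K N) (K.subst (sub1 V))
  | matchInr (X Y : VTy L) (W : Val L) (K N : KTm L) :
      AxK (.matchSum (.inr X Y W) K N) (N.subst (sub1 W))
  | userRet (V : Val L) (N : KTm L) (E : Finset L.Exc) (Ne : {e : L.Exc // e ∈ E} → KTm L) :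
      AxK (.user (.ret V) N E Ne) (N.subst (sub1 V))
  | userRaise (X : VTy L) (N : KTm L) (E : Finset L.Exc) (Ne : {e : L.Exc // e ∈ E} → KTm L)
      (e : {e : L.Exc // e ∈ E}) :
      AxK (.user (.raise X e.1) N E Ne) (Ne e)
  | userOp (o : L.Op) (X X' : VTy L) (V : Val L) (M : UTm L) (Me : L.OpExc o → UTm L)
      (N : KTm L) (E : Finset L.Exc) (Ne : {e : L.Exc // e ∈ E} → KTm L) :
      AxK (.user (.op o X V M Me) N E Ne)
        (.op o X' V
          (.user M (N.ren (liftRen (wk 1))) E (fun e => (Ne e).ren (wk 1)))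
          (fun e' => .user (Me e') N E Ne))
  | getSet (C : GTy L.Base) (K : KTm L) :
      AxK (.getenv C (.setenv (.var 0) (K.ren (wk 1)))) K
  | setGet (C : GTy L.Base) (V : Val L) (K : KTm L) :
      AxK (.setenv V (.getenv C K)) (.setenv V (K.subst (sub1 V)))
  | setSet (V W : Val L) (K : KTm L) :
      AxK (.setenv V (.setenv W K)) (.setenv W K)
  | getKill (X : VTy L) (C : GTy L.Base) (s : L.Sgn) :
      AxK (.getenv C (.kill X C s)) (.kill X C s)
  | setKill (X : VTy L) (C : GTy L.Base) (V : Val L) (s : L.Sgn) :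
      AxK (.setenv V (.kill X C s)) (.kill X C s)
  | getOp (C : GTy L.Base) (o : L.Op) (X : VTy L) (V : Val L) (K : KTm L)
      (Ke : L.OpExc o → KTm L) :
      AxK (.getenv C (.op o X (V.ren (wk 1)) K Ke))
        (.op o X V (.getenv C (K.ren swap)) (fun e => .getenv C (Ke e)))
  | setOp (o : L.Op) (X : VTy L) (V W : Val L) (K : KTm L) (Ke : L.OpExc o → KTm L) :
      AxK (.setenv W (.op o X V K Ke))
        (.op o X V (.setenv (W.ren (wk 1)) K) (fun e => .setenv W (Ke e)))

/-- The `η`-equations for exception handlers: user computations. -/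
inductive EtaU : UTm L → UTm L → Prop
  | tryEta (M : UTm L) (E : Finset L.Exc) (X : VTy L) :
      EtaU (.tryWith M (.ret (.var 0)) E (fun e => .raise X e.1)) M

/-- The `η`-equations for exception handlers: kernel computations. -/
inductive EtaK : KTm L → KTm L → Prop
  | tryEta (K : KTm L) (E : Finset L.Exc) (X : VTy L) (C : GTy L.Base) :
      EtaK (.tryWith K (.ret C (.var 0)) E (fun e => .raise X C e.1)) K

/-- Three variants of the equational theory.
* `full`: all equations, and congruence for all term formers.
* `mild`: all equations, and congruence for all term formers, but below a function abstraction
  only the equations of the variant `noTryEta` may be used.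
* `noTryEta`: all equations but the `η`-equations for exception handlers, and congruence for all
  term formers.

The reason for the distinction is that a member of the denotation of a function type is a map on
the whole skeletal denotation of the argument type. For instance, by `η` and congruence
`fun f ↦ try f () with {return x ↦ return x}` equals `fun f ↦ f ()` at the type
`(unit → unit ! (∅, ∅)) → unit ! (∅, ∅)`, but when applied to a (skeletal) map that raises an
exception `e`, the former gives a runtime error and the latter raises `e`. -/
inductive Variant
  | full
  | mild
  | noTryEta

/-- The variant to which the equations below a function abstraction belong. -/
def Variant.body : Variant → Variant
  | .full => .full
  | .mild => .noTryEta
  | .noTryEta => .noTryEta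

mutual

/-- The equality judgement `Γ ⊢ V ≡ W : X`. -/
inductive EqV : Variant → List (VTy L) → Val L → Val L → VTy L → Prop
  | refl {v : Variant} {Γ : List (VTy L)} {V : Val L} {X : VTy L} :
      HasV Γ V X → EqV v Γ V V X
  | symm {v : Variant} {Γ : List (VTy L)} {V W : Val L} {X : VTy L} :
      EqV v Γ V W X → EqV v Γ W V X
  | trans {v : Variant} {Γ : List (VTy L)} {V V' V'' : Val L} {X : VTy L} :
      EqV v Γ V V' X → EqV v Γ V' V'' X → EqV v Γ V V'' X
  | subsume {v : Variant} {Γ : List (VTy L)} {V W : Val L} {X X' : VTy L} :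
      EqV v Γ V W X → Sub X X' → EqV v Γ V W X'
  | ax {v : Variant} {Γ : List (VTy L)} {V W : Val L} {X : VTy L} :
      AxV V W → HasV Γ V X → HasV Γ W X → EqV v Γ V W X
  | unitEta {v : Variant} {Γ : List (VTy L)} {V : Val L} :
      HasV Γ V .unit → EqV v Γ V .unit .unit
  | const {v : Variant} {Γ : List (VTy L)} {f : L.Const} {Vs Vs' : Fin (L.arity f) → Val L} :
      (∀ i, EqV v Γ (Vs i) (Vs' i) (L.argTy f i).toV) →
      EqV v Γ (.const f Vs) (.const f Vs') (L.resTy f).toV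
  | pair {v : Variant} {Γ : List (VTy L)} {V V' W W' : Val L} {X Y : VTy L} :
      EqV v Γ V V' X → EqV v Γ W W' Y → EqV v Γ (.pair V W) (.pair V' W') (.prod X Y)
  | inl {v : Variant} {Γ : List (VTy L)} {V V' : Val L} {X Y : VTy L} :
      EqV v Γ V V' X → EqV v Γ (.inl X Y V) (.inl X Y V') (.sum X Y)
  | inr {v : Variant} {Γ : List (VTy L)} {W W' : Val L} {X Y : VTy L} :
      EqV v Γ W W' Y → EqV v Γ (.inr X Y W) (.inr X Y W') (.sum X Y)
  | ufun {v : Variant} {Γ : List (VTy L)} {X Y : VTy L} {M M' : UTm L} {U : UEff L} :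
      EqU v.body (X :: Γ) M M' Y U → EqV v Γ (.ufun X M) (.ufun X M') (.ufun X Y U)
  | kfun {v : Variant} {Γ : List (VTy L)} {X Y : VTy L} {K K' : KTm L} {E : KEff L} :
      EqK v.body (X :: Γ) K K' Y E → EqV v Γ (.kfun X K) (.kfun X K') (.kfun X Y E)
  | runner {v : Variant} {Γ : List (VTy L)} {ops ops' : Finset L.Op} {S : Finset L.Sgn}
      {C : GTy L.Base} {Ks Ks' : {o : L.Op // o ∈ ops} → KTm L} :
      (∀ o : {o : L.Op // o ∈ ops}, EqK v ((L.opPar o).toV :: Γ) (Ks o) (Ks' o)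
        (L.opRes o).toV ⟨ops', L.opExc o, S, C⟩) →
      EqV v Γ (.runner ops Ks C) (.runner ops Ks' C) (.runner ops ops' S C)

/-- The equality judgement `Γ ⊢ M ≡ N : X ! U`. -/
inductive EqU : Variant → List (VTy L) → UTm L → UTm L → VTy L → UEff L → Prop
  | refl {v : Variant} {Γ : List (VTy L)} {M : UTm L} {X : VTy L} {U : UEff L} :
      HasU Γ M X U → EqU v Γ M M X U
  | symm {v : Variant} {Γ : List (VTy L)} {M N : UTm L} {X : VTy L} {U : UEff L} :
      EqU v Γ M N X U → EqU v Γ N M X U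
  | trans {v : Variant} {Γ : List (VTy L)} {M M' M'' : UTm L} {X : VTy L} {U : UEff L} :
      EqU v Γ M M' X U → EqU v Γ M' M'' X U → EqU v Γ M M'' X U
  | subsume {v : Variant} {Γ : List (VTy L)} {M N : UTm L} {X X' : VTy L} {U U' : UEff L} :
      EqU v Γ M N X U → SubU X U X' U' → EqU v Γ M N X' U'
  | ax {v : Variant} {Γ : List (VTy L)} {M N : UTm L} {X : VTy L} {U : UEff L} :
      AxU M N → HasU Γ M X U → HasU Γ N X U → EqU v Γ M N X U
  | eta {v : Variant} {Γ : List (VTy L)} {M N : UTm L} {X : VTy L} {U : UEff L} :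
      v ≠ .noTryEta → EtaU M N → HasU Γ M X U → HasU Γ N X U → EqU v Γ M N X U
  | ret {v : Variant} {Γ : List (VTy L)} {V V' : Val L} {X : VTy L} {U : UEff L} :
      EqV v Γ V V' X → EqU v Γ (.ret V) (.ret V') X U
  | app {v : Variant} {Γ : List (VTy L)} {V V' W W' : Val L} {X Y : VTy L} {U : UEff L} :
      EqV v Γ V V' (.ufun X Y U) → EqV v Γ W W' X → EqU v Γ (.app V W) (.app V' W') Y U
  | tryWith {v : Variant} {Γ : List (VTy L)} {M M' N N' : UTm L} {ops : Finset L.Op}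
      {E E' : Finset L.Exc} {Ne Ne' : {e : L.Exc // e ∈ E} → UTm L} {X Y : VTy L} :
      EqU v Γ M M' X ⟨ops, E⟩ → EqU v (X :: Γ) N N' Y ⟨ops, E'⟩ →
      (∀ e, EqU v Γ (Ne e) (Ne' e) Y ⟨ops, E'⟩) →
      EqU v Γ (.tryWith M N E Ne) (.tryWith M' N' E Ne') Y ⟨ops, E'⟩
  | matchPair {v : Variant} {Γ : List (VTy L)} {V V' : Val L} {M M' : UTm L} {X Y Z : VTy L}
      {U : UEff L} :
      EqV v Γ V V' (.prod X Y) → EqU v (Y :: X :: Γ) M M' Z U →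
      EqU v Γ (.matchPair V M) (.matchPair V' M') Z U
  | matchEmpty {v : Variant} {Γ : List (VTy L)} {V V' : Val L} {Z : VTy L} {U : UEff L} :
      EqV v Γ V V' .empty → EqU v Γ (.matchEmpty Z V) (.matchEmpty Z V') Z U
  | matchSum {v : Variant} {Γ : List (VTy L)} {V V' : Val L} {M M' N N' : UTm L}
      {X Y Z : VTy L} {U : UEff L} :
      EqV v Γ V V' (.sum X Y) → EqU v (X :: Γ) M M' Z U → EqU v (Y :: Γ) N N' Z U →
      EqU v Γ (.matchSum V M N) (.matchSum V' M' N') Z U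
  | op {v : Variant} {Γ : List (VTy L)} {o : L.Op} {V V' : Val L} {M M' : UTm L}
      {Ne Ne' : L.OpExc o → UTm L} {X : VTy L} {U : UEff L} :
      o ∈ U.ops → EqV v Γ V V' (L.opPar o).toV →
      EqU v ((L.opRes o).toV :: Γ) M M' X U → (∀ e, EqU v Γ (Ne e) (Ne' e) X U) →
      EqU v Γ (.op o X V M Ne) (.op o X V' M' Ne') X U
  | run {v : Variant} {Γ : List (VTy L)} {V V' W W' : Val L} {M M' N N' : UTm L}
      {E E' : Finset L.Exc} {Ne Ne' : {e : L.Exc // e ∈ E} → UTm L} {S : Finset L.Sgn}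
      {Ns Ns' : {s : L.Sgn // s ∈ S} → UTm L} {ops ops' : Finset L.Op} {C : GTy L.Base}
      {X Y : VTy L} :
      EqV v Γ V V' (.runner ops ops' S C) → EqV v Γ W W' C.toV → EqU v Γ M M' X ⟨ops, E⟩ →
      EqU v (C.toV :: X :: Γ) N N' Y ⟨ops', E'⟩ →
      (∀ e, EqU v (C.toV :: Γ) (Ne e) (Ne' e) Y ⟨ops', E'⟩) →
      (∀ s, EqU v Γ (Ns s) (Ns' s) Y ⟨ops', E'⟩) →
      EqU v Γ (.run V W M N E Ne S Ns) (.run V' W' M' N' E Ne' S Ns') Y ⟨ops', E'⟩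
  | kernel {v : Variant} {Γ : List (VTy L)} {K K' : KTm L} {W W' : Val L} {N N' : UTm L}
      {E E' : Finset L.Exc} {Ne Ne' : {e : L.Exc // e ∈ E} → UTm L} {S : Finset L.Sgn}
      {Ns Ns' : {s : L.Sgn // s ∈ S} → UTm L} {ops : Finset L.Op} {C : GTy L.Base}
      {X Y : VTy L} :
      EqK v Γ K K' X ⟨ops, E, S, C⟩ → EqV v Γ W W' C.toV →
      EqU v (C.toV :: X :: Γ) N N' Y ⟨ops, E'⟩ →
      (∀ e, EqU v (C.toV :: Γ) (Ne e) (Ne' e) Y ⟨ops, E'⟩) →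
      (∀ s, EqU v Γ (Ns s) (Ns' s) Y ⟨ops, E'⟩) →
      EqU v Γ (.kernel K W N E Ne S Ns) (.kernel K' W' N' E Ne' S Ns') Y ⟨ops, E'⟩

/-- The equality judgement `Γ ⊢ K ≡ K' : X ↯ E`. -/
inductive EqK : Variant → List (VTy L) → KTm L → KTm L → VTy L → KEff L → Prop
  | refl {v : Variant} {Γ : List (VTy L)} {K : KTm L} {X : VTy L} {E : KEff L} :
      HasK Γ K X E → EqK v Γ K K X E
  | symm {v : Variant} {Γ : List (VTy L)} {K K' : KTm L} {X : VTy L} {E : KEff L} :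
      EqK v Γ K K' X E → EqK v Γ K' K X E
  | trans {v : Variant} {Γ : List (VTy L)} {K K' K'' : KTm L} {X : VTy L} {E : KEff L} :
      EqK v Γ K K' X E → EqK v Γ K' K'' X E → EqK v Γ K K'' X E
  | subsume {v : Variant} {Γ : List (VTy L)} {K K' : KTm L} {X X' : VTy L} {E E' : KEff L} :
      EqK v Γ K K' X E → SubK X E X' E' → EqK v Γ K K' X' E'
  | ax {v : Variant} {Γ : List (VTy L)} {K K' : KTm L} {X : VTy L} {E : KEff L} :
      AxK K K' → HasK Γ K X E → HasK Γ K' X E → EqK v Γ K K' X E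
  | eta {v : Variant} {Γ : List (VTy L)} {K K' : KTm L} {X : VTy L} {E : KEff L} :
      v ≠ .noTryEta → EtaK K K' → HasK Γ K X E → HasK Γ K' X E → EqK v Γ K K' X E
  | ret {v : Variant} {Γ : List (VTy L)} {V V' : Val L} {X : VTy L} {ops : Finset L.Op}
      {E : Finset L.Exc} {S : Finset L.Sgn} {C : GTy L.Base} :
      EqV v Γ V V' X → EqK v Γ (.ret C V) (.ret C V') X ⟨ops, E, S, C⟩
  | app {v : Variant} {Γ : List (VTy L)} {V V' W W' : Val L} {X Y : VTy L} {E : KEff L} :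
      EqV v Γ V V' (.kfun X Y E) → EqV v Γ W W' X → EqK v Γ (.app V W) (.app V' W') Y E
  | tryWith {v : Variant} {Γ : List (VTy L)} {K K' N N' : KTm L} {ops : Finset L.Op}
      {E E' : Finset L.Exc} {S : Finset L.Sgn} {C : GTy L.Base}
      {Ne Ne' : {e : L.Exc // e ∈ E} → KTm L} {X Y : VTy L} :
      EqK v Γ K K' X ⟨ops, E, S, C⟩ → EqK v (X :: Γ) N N' Y ⟨ops, E', S, C⟩ →
      (∀ e, EqK v Γ (Ne e) (Ne' e) Y ⟨ops, E', S, C⟩) →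
      EqK v Γ (.tryWith K N E Ne) (.tryWith K' N' E Ne') Y ⟨ops, E', S, C⟩
  | matchPair {v : Variant} {Γ : List (VTy L)} {V V' : Val L} {K K' : KTm L} {X Y Z : VTy L}
      {E : KEff L} :
      EqV v Γ V V' (.prod X Y) → EqK v (Y :: X :: Γ) K K' Z E →
      EqK v Γ (.matchPair V K) (.matchPair V' K') Z E
  | matchEmpty {v : Variant} {Γ : List (VTy L)} {V V' : Val L} {Z : VTy L}
      {ops : Finset L.Op} {E : Finset L.Exc} {S : Finset L.Sgn} {C : GTy L.Base} :
      EqV v Γ V V' .empty →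
      EqK v Γ (.matchEmpty Z C V) (.matchEmpty Z C V') Z ⟨ops, E, S, C⟩
  | matchSum {v : Variant} {Γ : List (VTy L)} {V V' : Val L} {K K' N N' : KTm L}
      {X Y Z : VTy L} {E : KEff L} :
      EqV v Γ V V' (.sum X Y) → EqK v (X :: Γ) K K' Z E → EqK v (Y :: Γ) N N' Z E →
      EqK v Γ (.matchSum V K N) (.matchSum V' K' N') Z E
  | op {v : Variant} {Γ : List (VTy L)} {o : L.Op} {V V' : Val L} {K K' : KTm L}
      {Ne Ne' : L.OpExc o → KTm L} {X : VTy L} {E : KEff L} :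
      o ∈ E.ops → EqV v Γ V V' (L.opPar o).toV →
      EqK v ((L.opRes o).toV :: Γ) K K' X E → (∀ e, EqK v Γ (Ne e) (Ne' e) X E) →
      EqK v Γ (.op o X V K Ne) (.op o X V' K' Ne') X E
  | getenv {v : Variant} {Γ : List (VTy L)} {K K' : KTm L} {X : VTy L} {ops : Finset L.Op}
      {E : Finset L.Exc} {S : Finset L.Sgn} {C : GTy L.Base} :
      EqK v (C.toV :: Γ) K K' X ⟨ops, E, S, C⟩ →
      EqK v Γ (.getenv C K) (.getenv C K') X ⟨ops, E, S, C⟩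
  | setenv {v : Variant} {Γ : List (VTy L)} {V V' : Val L} {K K' : KTm L} {X : VTy L}
      {ops : Finset L.Op} {E : Finset L.Exc} {S : Finset L.Sgn} {C : GTy L.Base} :
      EqV v Γ V V' C.toV → EqK v Γ K K' X ⟨ops, E, S, C⟩ →
      EqK v Γ (.setenv V K) (.setenv V' K') X ⟨ops, E, S, C⟩
  | user {v : Variant} {Γ : List (VTy L)} {M M' : UTm L} {K K' : KTm L}
      {ops : Finset L.Op} {E E' : Finset L.Exc} {S : Finset L.Sgn} {C : GTy L.Base}
      {Ke Ke' : {e : L.Exc // e ∈ E} → KTm L} {X Y : VTy L} :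
      EqU v Γ M M' X ⟨ops, E⟩ → EqK v (X :: Γ) K K' Y ⟨ops, E', S, C⟩ →
      (∀ e, EqK v Γ (Ke e) (Ke' e) Y ⟨ops, E', S, C⟩) →
      EqK v Γ (.user M K E Ke) (.user M' K' E Ke') Y ⟨ops, E', S, C⟩

end

/-! ## Hereditary equality

Elements of the denotation of a function type are maps on the whole skeletal denotation of the
argument type. The relations below identify such maps when they agree, hereditarily, on the
refinement subset. -/

section Hereditary

variable {m : Model L}

/-- Two trees that only use operations in `ops`, have the same operation nodes, and have leaves
related by `Q`. -/
inductive Tree.Rel {X : Type u} (ops : Finset L.Op) (Q : X → X → Prop) :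
    Tree m X → Tree m X → Prop
  | ret {x x' : X} : Q x x' → Tree.Rel ops Q (.ret x) (.ret x')
  | node {o : L.Op} {a : OpPar m o} {κ κ' : OpRes m o → Tree m X}
      {ν ν' : L.OpExc o → Tree m X} :
      o ∈ ops → (∀ b, Tree.Rel ops Q (κ b) (κ' b)) → (∀ e, Tree.Rel ops Q (ν e) (ν' e)) →
      Tree.Rel ops Q (.node o a κ ν) (.node o a κ' ν')

/-- Lifting of a relation to user computations. -/
def URel {X : Type u} (R : X → X → Prop) (U : UEff L) : UMon m X → UMon m X → Prop :=
  Tree.Rel U.ops (fun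
    | .inl x, .inl x' => R x x'
    | .inr e, .inr e' => e = e' ∧ e ∈ U.exc
    | _, _ => False)

/-- Lifting of a relation to kernel computations. -/
def KRel {E C X : Type u} (R : X → X → Prop) (ops : Finset L.Op) (E₀ : Set E)
    (S : Finset L.Sgn) (k k' : KMon m E C X) : Prop :=
  ∀ c, Tree.Rel ops (fun
    | .inl (.inl x, d), .inl (.inl x', d') => R x x' ∧ d = d'
    | .inl (.inr e, d), .inl (.inr e', d') => e = e' ∧ e ∈ E₀ ∧ d = d'
    | .inr s, .inr s' => s = s' ∧ s ∈ S
    | _, _ => False) (k c) (k' c)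

variable (m)

/-- Hereditary equality at a value type. -/
def VTy.rel : (X : VTy L) → X.skel.den m → X.skel.den m → Prop
  | .base b => fun x x' : m.base b => x = x'
  | .unit => fun x x' : PUnit => x = x'
  | .empty => fun x x' : PEmpty => x = x'
  | .prod X Y => fun p p' : X.skel.den m × Y.skel.den m => X.rel p.1 p'.1 ∧ Y.rel p.2 p'.2
  | .sum X Y => Sum.LiftRel X.rel Y.rel
  | .ufun X Y U => fun f f' : X.skel.den m → UMon m (Y.skel.den m) =>
      ∀ x x', X.rel x x' → URel Y.rel U (f x) (f' x')
  | .kfun X Y K => fun f f' : X.skel.den m → KMon m L.Exc (K.st.den m.base) (Y.skel.den m) =>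
      ∀ x x', X.rel x x' → KRel Y.rel K.ops {e | e ∈ K.exc} K.sgn (f x) (f' x')
  | .runner ops ops' S C => fun R R' : RunnerSk m (C.den m.base) =>
      ∀ o ∈ ops, ∀ a, KRel Eq ops' Set.univ S (R o a) (R' o a)

/-- Hereditary equality at a user type. -/
def UTyRel (X : VTy L) (U : UEff L) :
    UMon m (X.skel.den m) → UMon m (X.skel.den m) → Prop :=
  URel (X.rel m) U

/-- Hereditary equality at a kernel type. -/
def KTyRel (X : VTy L) (K : KEff L) (k k' : KMon m L.Exc (K.st.den m.base) (X.skel.den m)) :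
    Prop :=
  KRel (X.rel m) K.ops {e | e ∈ K.exc} K.sgn k k'

/-- Hereditary equality of environments. -/
def CtxRel : (Γ : List (VTy L)) → Env m (skelCtx Γ) → Env m (skelCtx Γ) → Prop
  | [] => fun _ _ => True
  | X :: Γ => fun γ γ' : X.skel.den m × Env m (skelCtx Γ) =>
      X.rel m γ.1 γ'.1 ∧ CtxRel Γ γ.2 γ'.2

end Hereditary

end Coop

namespace Coop

variable {L : Lang.{u}}

theorem Lookup.type_unique {α : Type u} : {Γ : List α} → {i : ℕ} → {X Y : α} →
    Lookup Γ i X → Lookup Γ i Y → X = Y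
  | _, _, _, _, .zero, .zero => rfl
  | _, _, _, _, .succ h, .succ h' => h.type_unique h'

theorem Lookup.unique {α : Type u} : {Γ : List α} → {i : ℕ} → {X : α} →
    (h h' : Lookup Γ i X) → h = h'
  | _, _, _, .zero, .zero => rfl
  | _, _, _, .succ h, .succ h' => congrArg _ (h.unique h')

/-! ## Uniqueness of skeletal typing -/

mutual

theorem SkV.type_unique : {Γ : List (STy L)} → {V : Val L} → {P P' : STy L} →
    SkV Γ V P → SkV Γ V P' → P = P'
  | _, _, _, _, .var h, .var h' => h.type_unique h'
  | _, _, _, _, .const _ hP, .const _ hP' => hP.trans hP'.symm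
  | _, _, _, _, .unit, .unit => rfl
  | _, _, _, _, .pair h k, .pair h' k' => by rw [h.type_unique h', k.type_unique k']
  | _, _, _, _, .inl _ hP hQ, .inl _ hP' hQ' => by rw [hP, hP', hQ, hQ']
  | _, _, _, _, .inr _ hP hQ, .inr _ hP' hQ' => by rw [hP, hP', hQ, hQ']
  | _, _, _, _, .ufun h hP, .ufun h' hP' => by
      subst hP hP'
      rw [h.type_unique h']
  | _, _, _, _, .kfun h hP, .kfun h' hP' => by
      subst hP hP'
      rw [(h.type_unique h').1, (h.type_unique h').2]
  | _, _, _, _, .runner _, .runner _ => rfl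

theorem SkU.type_unique : {Γ : List (STy L)} → {M : UTm L} → {P P' : STy L} →
    SkU Γ M P → SkU Γ M P' → P = P'
  | _, _, _, _, .ret h, .ret h' => h.type_unique h'
  | _, _, _, _, .app h _, .app h' _ => by
      cases h.type_unique h'
      rfl
  | _, _, _, _, .tryWith h hN _, .tryWith h' hN' _ => by
      cases h.type_unique h'
      exact hN.type_unique hN'
  | _, _, _, _, .matchPair h hM, .matchPair h' hM' => by
      cases h.type_unique h'
      exact hM.type_unique hM'
  | _, _, _, _, .matchEmpty _ hQ, .matchEmpty _ hQ' => hQ.trans hQ'.symm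
  | _, _, _, _, .matchSum h hM _, .matchSum h' hM' _ => by
      cases h.type_unique h'
      exact hM.type_unique hM'
  | _, _, _, _, .op _ _ _ hP, .op _ _ _ hP' => hP.trans hP'.symm
  | _, _, _, _, .raise hP, .raise hP' => hP.trans hP'.symm
  | _, _, _, _, .run hV _ hM hN _ _, .run hV' _ hM' hN' _ _ => by
      cases hV.type_unique hV'
      cases hM.type_unique hM'
      exact hN.type_unique hN'
  | _, _, _, _, .kernel hK _ hN _ _, .kernel hK' _ hN' _ _ => by
      obtain ⟨rfl, rfl⟩ := hK.type_unique hK'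
      exact hN.type_unique hN'

theorem SkK.type_unique : {Γ : List (STy L)} → {K : KTm L} → {P P' : STy L} →
    {C C' : GTy L.Base} → SkK Γ K P C → SkK Γ K P' C' → P = P' ∧ C = C'
  | _, _, _, _, _, _, .ret h, .ret h' => ⟨h.type_unique h', rfl⟩
  | _, _, _, _, _, _, .app h _, .app h' _ => by
      cases h.type_unique h'
      exact ⟨rfl, rfl⟩
  | _, _, _, _, _, _, .tryWith h hN _, .tryWith h' hN' _ => by
      obtain ⟨rfl, rfl⟩ := h.type_unique h'
      exact hN.type_unique hN'
  | _, _, _, _, _, _, .matchPair h hK, .matchPair h' hK' => by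
      cases h.type_unique h'
      exact hK.type_unique hK'
  | _, _, _, _, _, _, .matchEmpty _ hQ, .matchEmpty _ hQ' => ⟨hQ.trans hQ'.symm, rfl⟩
  | _, _, _, _, _, _, .matchSum h hK _, .matchSum h' hK' _ => by
      cases h.type_unique h'
      exact hK.type_unique hK'
  | _, _, _, _, _, _, .op _ hK _ _, .op _ hK' _ _ => hK.type_unique hK'
  | _, _, _, _, _, _, .raise hP, .raise hP' => ⟨hP.trans hP'.symm, rfl⟩
  | _, _, _, _, _, _, .kill hP, .kill hP' => ⟨hP.trans hP'.symm, rfl⟩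
  | _, _, _, _, _, _, .getenv h, .getenv h' => h.type_unique h'
  | _, _, _, _, _, _, .setenv _ h, .setenv _ h' => h.type_unique h'
  | _, _, _, _, _, _, .user hM hK _, .user hM' hK' _ => by
      cases hM.type_unique hM'
      exact hK.type_unique hK'

end

mutual

theorem SkV.unique : {Γ : List (STy L)} → {V : Val L} → {P : STy L} →
    (d d' : SkV Γ V P) → d = d'
  | _, _, _, .var h, .var h' => congrArg _ (h.unique h')
  | _, _, _, .const h _, .const h' _ => by
      congr 1; exact funext fun i => (h i).unique (h' i)
  | _, _, _, .unit, .unit => rfl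
  | _, _, _, .pair h k, .pair h' k' => by rw [h.unique h', k.unique k']
  | _, _, _, .inl h _ _, .inl h' _ _ => by rw [h.unique h']
  | _, _, _, .inr h _ _, .inr h' _ _ => by rw [h.unique h']
  | _, _, _, .ufun h _, .ufun h' _ => by rw [h.unique h']
  | _, _, _, .kfun h _, .kfun h' _ => by rw [h.unique h']
  | _, _, _, .runner h, .runner h' => by
      congr 1; exact funext fun i => (h i).unique (h' i)

theorem SkU.unique : {Γ : List (STy L)} → {M : UTm L} → {P : STy L} →
    (d d' : SkU Γ M P) → d = d'
  | _, _, _, .ret h, .ret h' => by rw [h.unique h']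
  | _, _, _, .app h k, .app h' k' => by
      cases k.type_unique k'
      rw [h.unique h', k.unique k']
  | _, _, _, .tryWith h hN hE, .tryWith h' hN' hE' => by
      cases h.type_unique h'
      rw [h.unique h', hN.unique hN', funext fun i => (hE i).unique (hE' i)]
  | _, _, _, .matchPair h hM, .matchPair h' hM' => by
      cases h.type_unique h'
      rw [h.unique h', hM.unique hM']
  | _, _, _, .matchEmpty h _, .matchEmpty h' _ => by rw [h.unique h']
  | _, _, _, .matchSum h hM hN, .matchSum h' hM' hN' => by
      cases h.type_unique h'
      rw [h.unique h', hM.unique hM', hN.unique hN']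
  | _, _, _, .op h hM hE _, .op h' hM' hE' _ => by
      rw [h.unique h', hM.unique hM', funext fun i => (hE i).unique (hE' i)]
  | _, _, _, .raise _, .raise _ => rfl
  | _, _, _, .run hV hW hM hN hE hS, .run hV' hW' hM' hN' hE' hS' => by
      cases hV.type_unique hV'
      cases hM.type_unique hM'
      rw [hV.unique hV', hW.unique hW', hM.unique hM', hN.unique hN',
        funext fun i => (hE i).unique (hE' i), funext fun i => (hS i).unique (hS' i)]
  | _, _, _, .kernel hK hW hN hE hS, .kernel hK' hW' hN' hE' hS' => by
      obtain ⟨rfl, rfl⟩ := hK.type_unique hK'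
      rw [hK.unique hK', hW.unique hW', hN.unique hN',
        funext fun i => (hE i).unique (hE' i), funext fun i => (hS i).unique (hS' i)]

theorem SkK.unique : {Γ : List (STy L)} → {K : KTm L} → {P : STy L} → {C : GTy L.Base} →
    (d d' : SkK Γ K P C) → d = d'
  | _, _, _, _, .ret h, .ret h' => by rw [h.unique h']
  | _, _, _, _, .app h k, .app h' k' => by
      cases k.type_unique k'
      rw [h.unique h', k.unique k']
  | _, _, _, _, .tryWith h hN hE, .tryWith h' hN' hE' => by
      obtain ⟨rfl, -⟩ := h.type_unique h'
      rw [h.unique h', hN.unique hN', funext fun i => (hE i).unique (hE' i)]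
  | _, _, _, _, .matchPair h hM, .matchPair h' hM' => by
      cases h.type_unique h'
      rw [h.unique h', hM.unique hM']
  | _, _, _, _, .matchEmpty h _, .matchEmpty h' _ => by rw [h.unique h']
  | _, _, _, _, .matchSum h hM hN, .matchSum h' hM' hN' => by
      cases h.type_unique h'
      rw [h.unique h', hM.unique hM', hN.unique hN']
  | _, _, _, _, .op h hM hE _, .op h' hM' hE' _ => by
      rw [h.unique h', hM.unique hM', funext fun i => (hE i).unique (hE' i)]
  | _, _, _, _, .raise _, .raise _ => rfl
  | _, _, _, _, .kill _, .kill _ => rfl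
  | _, _, _, _, .getenv h, .getenv h' => by rw [h.unique h']
  | _, _, _, _, .setenv h k, .setenv h' k' => by rw [h.unique h', k.unique k']
  | _, _, _, _, .user h hK hE, .user h' hK' hE' => by
      cases h.type_unique h'
      rw [h.unique h', hK.unique hK', funext fun i => (hE i).unique (hE' i)]

end

/-! ## Semantics of renaming and substitution -/

section Substitution

variable {m : Model L}

/-- The action of a map of environments on environments with one more component. -/
def liftEnv {Γ Δ : List (STy L)} (P : STy L) (f : Env m Δ → Env m Γ) :
    Env m (P :: Δ) → Env m (P :: Γ) :=
  fun δ => (δ.1, f δ.2)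

/-- The renaming `r` takes variables of `Γ` to variables of `Δ`, and denotes `f`. -/
def DenRen {Γ Δ : List (STy L)} (r : ℕ → ℕ) (f : Env m Δ → Env m Γ) : Prop :=
  ∀ i P (h : Lookup Γ i P), ∃ h' : Lookup Δ (r i) P, ∀ δ, h'.den δ = h.den (f δ)

/-- The substitution `s` takes variables of `Γ` to values in context `Δ`, and denotes `f`. -/
def DenSub {Γ Δ : List (STy L)} (s : ℕ → Val L) (f : Env m Δ → Env m Γ) : Prop :=
  ∀ i P (h : Lookup Γ i P), ∃ h' : SkV Δ (s i) P, ∀ δ, h'.den δ = h.den (f δ)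

theorem DenRen.lift {Γ Δ : List (STy L)} {r : ℕ → ℕ} {f : Env m Δ → Env m Γ}
    (hr : DenRen r f) (P : STy L) : DenRen (liftRen r) (liftEnv P f) := by
  intro i Q h
  cases h with
  | zero => exact ⟨.zero, fun _ => rfl⟩
  | succ h =>
    obtain ⟨h', e⟩ := hr _ _ h
    exact ⟨.succ h', fun δ => e δ.2⟩

theorem DenRen.wk_one {Γ : List (STy L)} (P : STy L) :
    DenRen (m := m) (wk 1) (fun δ : Env m (P :: Γ) => δ.2) :=
  fun _ _ h => ⟨.succ h, fun _ => rfl⟩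

theorem DenRen.wk_two {Γ : List (STy L)} (P Q : STy L) :
    DenRen (m := m) (wk 2) (fun δ : Env m (P :: Q :: Γ) => δ.2.2) :=
  fun _ _ h => ⟨.succ (.succ h), fun _ => rfl⟩

theorem DenRen.swap {Γ : List (STy L)} (P Q : STy L) :
    DenRen (m := m) (Γ := Q :: P :: Γ) swap
      (fun δ : Env m (P :: Q :: Γ) => (δ.2.1, δ.1, δ.2.2)) := by
  intro i R h
  cases h with
  | zero => exact ⟨.succ .zero, fun _ => rfl⟩
  | succ h =>
    cases h with
    | zero => exact ⟨.zero, fun _ => rfl⟩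
    | succ h => exact ⟨.succ (.succ h), fun _ => rfl⟩

mutual

theorem SkV.exists_ren : {Γ Δ : List (STy L)} → {V : Val L} → {P : STy L} →
    {r : ℕ → ℕ} → {f : Env m Δ → Env m Γ} → DenRen r f → (d : SkV Γ V P) →
    ∃ d' : SkV Δ (V.ren r) P, ∀ δ, d'.den δ = d.den (f δ)
  | _, _, _, _, _, _, hr, .var h => by
      obtain ⟨h', e⟩ := hr _ _ h
      exact ⟨.var h', e⟩
  | _, _, _, _, _, _, hr, .const h hP => by
      choose h' e using fun i => (h i).exists_ren hr
      exact ⟨.const h' hP, fun δ => by simp only [SkV.den, e]⟩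
  | _, _, _, _, _, _, _, .unit => ⟨.unit, fun _ => rfl⟩
  | _, _, _, _, _, _, hr, .pair h k => by
      obtain ⟨h', e⟩ := h.exists_ren hr
      obtain ⟨k', e'⟩ := k.exists_ren hr
      exact ⟨.pair h' k', fun δ => by simp only [SkV.den, e, e']⟩
  | _, _, _, _, _, _, hr, .inl h hP hQ => by
      obtain ⟨h', e⟩ := h.exists_ren hr
      exact ⟨.inl h' hP hQ, fun δ => by simp only [SkV.den, e]⟩
  | _, _, _, _, _, _, hr, .inr h hP hQ => by
      obtain ⟨h', e⟩ := h.exists_ren hr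
      exact ⟨.inr h' hP hQ, fun δ => by simp only [SkV.den, e]⟩
  | _, _, _, _, _, _, hr, .ufun h hP => by
      obtain ⟨h', e⟩ := h.exists_ren (hr.lift _)
      exact ⟨.ufun h' hP, fun δ => by simp only [SkV.den, e, liftEnv]⟩
  | _, _, _, _, _, _, hr, .kfun h hP => by
      obtain ⟨h', e⟩ := h.exists_ren (hr.lift _)
      exact ⟨.kfun h' hP, fun δ => by simp only [SkV.den, e, liftEnv]⟩
  | _, _, _, _, _, _, hr, .runner h => by
      choose h' e using fun o => (h o).exists_ren (hr.lift _)
      exact ⟨.runner h', fun δ => by simp only [SkV.den, e, liftEnv]⟩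

theorem SkU.exists_ren : {Γ Δ : List (STy L)} → {M : UTm L} → {P : STy L} →
    {r : ℕ → ℕ} → {f : Env m Δ → Env m Γ} → DenRen r f → (d : SkU Γ M P) →
    ∃ d' : SkU Δ (M.ren r) P, ∀ δ, d'.den δ = d.den (f δ)
  | _, _, _, _, _, _, hr, .ret h => by
      obtain ⟨h', e⟩ := h.exists_ren hr
      exact ⟨.ret h', fun δ => by simp only [SkU.den, e]⟩
  | _, _, _, _, _, _, hr, .app h k => by
      obtain ⟨h', e⟩ := h.exists_ren hr
      obtain ⟨k', e'⟩ := k.exists_ren hr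
      exact ⟨.app h' k', fun δ => by simp only [SkU.den, e, e']⟩
  | _, _, _, _, _, _, hr, .tryWith h hN hE => by
      obtain ⟨h', e⟩ := h.exists_ren hr
      obtain ⟨hN', eN⟩ := hN.exists_ren (hr.lift _)
      choose hE' eE using fun e => (hE e).exists_ren hr
      exact ⟨.tryWith h' hN' hE', fun δ => by simp only [SkU.den, e, eN, eE, liftEnv]⟩
  | _, _, _, _, _, _, hr, .matchPair h hM => by
      obtain ⟨h', e⟩ := h.exists_ren hr
      obtain ⟨hM', eM⟩ := hM.exists_ren ((hr.lift _).lift _)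
      exact ⟨.matchPair h' hM', fun δ => by simp only [SkU.den, e, eM, liftEnv]⟩
  | _, _, _, _, _, _, hr, .matchEmpty h hQ => by
      obtain ⟨h', e⟩ := h.exists_ren hr
      exact ⟨.matchEmpty h' hQ, fun δ => by simp only [SkU.den, e]⟩
  | _, _, _, _, _, _, hr, .matchSum h hM hN => by
      obtain ⟨h', e⟩ := h.exists_ren hr
      obtain ⟨hM', eM⟩ := hM.exists_ren (hr.lift _)
      obtain ⟨hN', eN⟩ := hN.exists_ren (hr.lift _)
      exact ⟨.matchSum h' hM' hN', fun δ => by simp only [SkU.den, e, eM, eN, liftEnv]⟩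
  | _, _, _, _, _, _, hr, .op h hM hE hP => by
      obtain ⟨h', e⟩ := h.exists_ren hr
      obtain ⟨hM', eM⟩ := hM.exists_ren (hr.lift _)
      choose hE' eE using fun e => (hE e).exists_ren hr
      exact ⟨.op h' hM' hE' hP, fun δ => by simp only [SkU.den, e, eM, eE, liftEnv]⟩
  | _, _, _, _, _, _, _, .raise hP => ⟨.raise hP, fun _ => rfl⟩
  | _, _, _, _, _, _, hr, .run hV hW hM hN hE hS => by
      obtain ⟨hV', eV⟩ := hV.exists_ren hr
      obtain ⟨hW', eW⟩ := hW.exists_ren hr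
      obtain ⟨hM', eM⟩ := hM.exists_ren hr
      obtain ⟨hN', eN⟩ := hN.exists_ren ((hr.lift _).lift _)
      choose hE' eE using fun e => (hE e).exists_ren (hr.lift _)
      choose hS' eS using fun s => (hS s).exists_ren hr
      exact ⟨.run hV' hW' hM' hN' hE' hS',
        fun δ => by simp only [SkU.den, eV, eW, eM, eN, eE, eS, liftEnv]⟩
  | _, _, _, _, _, _, hr, .kernel hK hW hN hE hS => by
      obtain ⟨hK', eK⟩ := hK.exists_ren hr
      obtain ⟨hW', eW⟩ := hW.exists_ren hr
      obtain ⟨hN', eN⟩ := hN.exists_ren ((hr.lift _).lift _)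
      choose hE' eE using fun e => (hE e).exists_ren (hr.lift _)
      choose hS' eS using fun s => (hS s).exists_ren hr
      exact ⟨.kernel hK' hW' hN' hE' hS',
        fun δ => by simp only [SkU.den, eK, eW, eN, eE, eS, liftEnv]⟩

theorem SkK.exists_ren : {Γ Δ : List (STy L)} → {K : KTm L} → {P : STy L} →
    {C : GTy L.Base} → {r : ℕ → ℕ} → {f : Env m Δ → Env m Γ} → DenRen r f →
    (d : SkK Γ K P C) → ∃ d' : SkK Δ (K.ren r) P C, ∀ δ, d'.den δ = d.den (f δ)
  | _, _, _, _, _, _, _, hr, .ret h => by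
      obtain ⟨h', e⟩ := h.exists_ren hr
      exact ⟨.ret h', fun δ => by simp only [SkK.den, e]⟩
  | _, _, _, _, _, _, _, hr, .app h k => by
      obtain ⟨h', e⟩ := h.exists_ren hr
      obtain ⟨k', e'⟩ := k.exists_ren hr
      exact ⟨.app h' k', fun δ => by simp only [SkK.den, e, e']⟩
  | _, _, _, _, _, _, _, hr, .tryWith h hN hE => by
      obtain ⟨h', e⟩ := h.exists_ren hr
      obtain ⟨hN', eN⟩ := hN.exists_ren (hr.lift _)
      choose hE' eE using fun e => (hE e).exists_ren hr
      exact ⟨.tryWith h' hN' hE', fun δ => by simp only [SkK.den, e, eN, eE, liftEnv]⟩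
  | _, _, _, _, _, _, _, hr, .matchPair h hM => by
      obtain ⟨h', e⟩ := h.exists_ren hr
      obtain ⟨hM', eM⟩ := hM.exists_ren ((hr.lift _).lift _)
      exact ⟨.matchPair h' hM', fun δ => by simp only [SkK.den, e, eM, liftEnv]⟩
  | _, _, _, _, _, _, _, hr, .matchEmpty h hQ => by
      obtain ⟨h', e⟩ := h.exists_ren hr
      exact ⟨.matchEmpty h' hQ, fun δ => by simp only [SkK.den, e]⟩
  | _, _, _, _, _, _, _, hr, .matchSum h hM hN => by
      obtain ⟨h', e⟩ := h.exists_ren hr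
      obtain ⟨hM', eM⟩ := hM.exists_ren (hr.lift _)
      obtain ⟨hN', eN⟩ := hN.exists_ren (hr.lift _)
      exact ⟨.matchSum h' hM' hN', fun δ => by simp only [SkK.den, e, eM, eN, liftEnv]⟩
  | _, _, _, _, _, _, _, hr, .op h hM hE hP => by
      obtain ⟨h', e⟩ := h.exists_ren hr
      obtain ⟨hM', eM⟩ := hM.exists_ren (hr.lift _)
      choose hE' eE using fun e => (hE e).exists_ren hr
      exact ⟨.op h' hM' hE' hP, fun δ => by simp only [SkK.den, e, eM, eE, liftEnv]⟩
  | _, _, _, _, _, _, _, _, .raise hP => ⟨.raise hP, fun _ => rfl⟩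
  | _, _, _, _, _, _, _, _, .kill hP => ⟨.kill hP, fun _ => rfl⟩
  | _, _, _, _, _, _, _, hr, .getenv h => by
      obtain ⟨h', e⟩ := h.exists_ren (hr.lift _)
      exact ⟨.getenv h', fun δ => by simp only [SkK.den, e, liftEnv]⟩
  | _, _, _, _, _, _, _, hr, .setenv h k => by
      obtain ⟨h', e⟩ := h.exists_ren hr
      obtain ⟨k', e'⟩ := k.exists_ren hr
      exact ⟨.setenv h' k', fun δ => by simp only [SkK.den, e, e']⟩
  | _, _, _, _, _, _, _, hr, .user h hN hE => by
      obtain ⟨h', e⟩ := h.exists_ren hr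
      obtain ⟨hN', eN⟩ := hN.exists_ren (hr.lift _)
      choose hE' eE using fun e => (hE e).exists_ren hr
      exact ⟨.user h' hN' hE', fun δ => by simp only [SkK.den, e, eN, eE, liftEnv]⟩

end

theorem DenSub.lift {Γ Δ : List (STy L)} {s : ℕ → Val L} {f : Env m Δ → Env m Γ}
    (hs : DenSub s f) (P : STy L) : DenSub (liftSub s) (liftEnv P f) := by
  intro i Q h
  cases h with
  | zero => exact ⟨.var .zero, fun _ => rfl⟩
  | succ h =>
    obtain ⟨h', e⟩ := hs _ _ h
    obtain ⟨h'', e'⟩ := h'.exists_ren (DenRen.wk_one (m := m) P)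
    exact ⟨h'', fun δ => (e' δ).trans (e δ.2)⟩

theorem DenSub.sub1 {Γ : List (STy L)} {V : Val L} {P : STy L} (d : SkV Γ V P) :
    DenSub (m := m) (Γ := P :: Γ) (sub1 V) (fun γ => (d.den γ, γ)) := by
  intro i Q h
  cases h with
  | zero => exact ⟨d, fun _ => rfl⟩
  | succ h => exact ⟨.var h, fun _ => rfl⟩

theorem DenSub.sub2 {Γ : List (STy L)} {V W : Val L} {P Q : STy L} (d : SkV Γ V P)
    (d' : SkV Γ W Q) :
    DenSub (m := m) (Γ := Q :: P :: Γ) (sub2 V W) (fun γ => (d'.den γ, d.den γ, γ)) := by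
  intro i Q h
  cases h with
  | zero => exact ⟨d', fun _ => rfl⟩
  | succ h =>
    cases h with
    | zero => exact ⟨d, fun _ => rfl⟩
    | succ h => exact ⟨.var h, fun _ => rfl⟩

mutual

theorem SkV.exists_subst : {Γ Δ : List (STy L)} → {V : Val L} → {P : STy L} →
    {s : ℕ → Val L} → {f : Env m Δ → Env m Γ} → DenSub s f → (d : SkV Γ V P) →
    ∃ d' : SkV Δ (V.subst s) P, ∀ δ, d'.den δ = d.den (f δ)
  | _, _, _, _, _, _, hs, .var h => by
      obtain ⟨h', e⟩ := hs _ _ h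
      exact ⟨h', e⟩
  | _, _, _, _, _, _, hs, .const h hP => by
      choose h' e using fun i => (h i).exists_subst hs
      exact ⟨.const h' hP, fun δ => by simp only [SkV.den, e]⟩
  | _, _, _, _, _, _, _, .unit => ⟨.unit, fun _ => rfl⟩
  | _, _, _, _, _, _, hs, .pair h k => by
      obtain ⟨h', e⟩ := h.exists_subst hs
      obtain ⟨k', e'⟩ := k.exists_subst hs
      exact ⟨.pair h' k', fun δ => by simp only [SkV.den, e, e']⟩
  | _, _, _, _, _, _, hs, .inl h hP hQ => by
      obtain ⟨h', e⟩ := h.exists_subst hs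
      exact ⟨.inl h' hP hQ, fun δ => by simp only [SkV.den, e]⟩
  | _, _, _, _, _, _, hs, .inr h hP hQ => by
      obtain ⟨h', e⟩ := h.exists_subst hs
      exact ⟨.inr h' hP hQ, fun δ => by simp only [SkV.den, e]⟩
  | _, _, _, _, _, _, hs, .ufun h hP => by
      obtain ⟨h', e⟩ := h.exists_subst (hs.lift _)
      exact ⟨.ufun h' hP, fun δ => by simp only [SkV.den, e, liftEnv]⟩
  | _, _, _, _, _, _, hs, .kfun h hP => by
      obtain ⟨h', e⟩ := h.exists_subst (hs.lift _)
      exact ⟨.kfun h' hP, fun δ => by simp only [SkV.den, e, liftEnv]⟩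
  | _, _, _, _, _, _, hs, .runner h => by
      choose h' e using fun o => (h o).exists_subst (hs.lift _)
      exact ⟨.runner h', fun δ => by simp only [SkV.den, e, liftEnv]⟩

theorem SkU.exists_subst : {Γ Δ : List (STy L)} → {M : UTm L} → {P : STy L} →
    {s : ℕ → Val L} → {f : Env m Δ → Env m Γ} → DenSub s f → (d : SkU Γ M P) →
    ∃ d' : SkU Δ (M.subst s) P, ∀ δ, d'.den δ = d.den (f δ)
  | _, _, _, _, _, _, hs, .ret h => by
      obtain ⟨h', e⟩ := h.exists_subst hs
      exact ⟨.ret h', fun δ => by simp only [SkU.den, e]⟩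
  | _, _, _, _, _, _, hs, .app h k => by
      obtain ⟨h', e⟩ := h.exists_subst hs
      obtain ⟨k', e'⟩ := k.exists_subst hs
      exact ⟨.app h' k', fun δ => by simp only [SkU.den, e, e']⟩
  | _, _, _, _, _, _, hs, .tryWith h hN hE => by
      obtain ⟨h', e⟩ := h.exists_subst hs
      obtain ⟨hN', eN⟩ := hN.exists_subst (hs.lift _)
      choose hE' eE using fun e => (hE e).exists_subst hs
      exact ⟨.tryWith h' hN' hE', fun δ => by simp only [SkU.den, e, eN, eE, liftEnv]⟩
  | _, _, _, _, _, _, hs, .matchPair h hM => by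
      obtain ⟨h', e⟩ := h.exists_subst hs
      obtain ⟨hM', eM⟩ := hM.exists_subst ((hs.lift _).lift _)
      exact ⟨.matchPair h' hM', fun δ => by simp only [SkU.den, e, eM, liftEnv]⟩
  | _, _, _, _, _, _, hs, .matchEmpty h hQ => by
      obtain ⟨h', e⟩ := h.exists_subst hs
      exact ⟨.matchEmpty h' hQ, fun δ => by simp only [SkU.den, e]⟩
  | _, _, _, _, _, _, hs, .matchSum h hM hN => by
      obtain ⟨h', e⟩ := h.exists_subst hs
      obtain ⟨hM', eM⟩ := hM.exists_subst (hs.lift _)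
      obtain ⟨hN', eN⟩ := hN.exists_subst (hs.lift _)
      exact ⟨.matchSum h' hM' hN', fun δ => by simp only [SkU.den, e, eM, eN, liftEnv]⟩
  | _, _, _, _, _, _, hs, .op h hM hE hP => by
      obtain ⟨h', e⟩ := h.exists_subst hs
      obtain ⟨hM', eM⟩ := hM.exists_subst (hs.lift _)
      choose hE' eE using fun e => (hE e).exists_subst hs
      exact ⟨.op h' hM' hE' hP, fun δ => by simp only [SkU.den, e, eM, eE, liftEnv]⟩
  | _, _, _, _, _, _, _, .raise hP => ⟨.raise hP, fun _ => rfl⟩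
  | _, _, _, _, _, _, hs, .run hV hW hM hN hE hS => by
      obtain ⟨hV', eV⟩ := hV.exists_subst hs
      obtain ⟨hW', eW⟩ := hW.exists_subst hs
      obtain ⟨hM', eM⟩ := hM.exists_subst hs
      obtain ⟨hN', eN⟩ := hN.exists_subst ((hs.lift _).lift _)
      choose hE' eE using fun e => (hE e).exists_subst (hs.lift _)
      choose hS' eS using fun s => (hS s).exists_subst hs
      exact ⟨.run hV' hW' hM' hN' hE' hS',
        fun δ => by simp only [SkU.den, eV, eW, eM, eN, eE, eS, liftEnv]⟩
  | _, _, _, _, _, _, hs, .kernel hK hW hN hE hS => by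
      obtain ⟨hK', eK⟩ := hK.exists_subst hs
      obtain ⟨hW', eW⟩ := hW.exists_subst hs
      obtain ⟨hN', eN⟩ := hN.exists_subst ((hs.lift _).lift _)
      choose hE' eE using fun e => (hE e).exists_subst (hs.lift _)
      choose hS' eS using fun s => (hS s).exists_subst hs
      exact ⟨.kernel hK' hW' hN' hE' hS',
        fun δ => by simp only [SkU.den, eK, eW, eN, eE, eS, liftEnv]⟩

theorem SkK.exists_subst : {Γ Δ : List (STy L)} → {K : KTm L} → {P : STy L} →
    {C : GTy L.Base} → {s : ℕ → Val L} → {f : Env m Δ → Env m Γ} → DenSub s f →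
    (d : SkK Γ K P C) → ∃ d' : SkK Δ (K.subst s) P C, ∀ δ, d'.den δ = d.den (f δ)
  | _, _, _, _, _, _, _, hs, .ret h => by
      obtain ⟨h', e⟩ := h.exists_subst hs
      exact ⟨.ret h', fun δ => by simp only [SkK.den, e]⟩
  | _, _, _, _, _, _, _, hs, .app h k => by
      obtain ⟨h', e⟩ := h.exists_subst hs
      obtain ⟨k', e'⟩ := k.exists_subst hs
      exact ⟨.app h' k', fun δ => by simp only [SkK.den, e, e']⟩
  | _, _, _, _, _, _, _, hs, .tryWith h hN hE => by
      obtain ⟨h', e⟩ := h.exists_subst hs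
      obtain ⟨hN', eN⟩ := hN.exists_subst (hs.lift _)
      choose hE' eE using fun e => (hE e).exists_subst hs
      exact ⟨.tryWith h' hN' hE', fun δ => by simp only [SkK.den, e, eN, eE, liftEnv]⟩
  | _, _, _, _, _, _, _, hs, .matchPair h hM => by
      obtain ⟨h', e⟩ := h.exists_subst hs
      obtain ⟨hM', eM⟩ := hM.exists_subst ((hs.lift _).lift _)
      exact ⟨.matchPair h' hM', fun δ => by simp only [SkK.den, e, eM, liftEnv]⟩
  | _, _, _, _, _, _, _, hs, .matchEmpty h hQ => by
      obtain ⟨h', e⟩ := h.exists_subst hs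
      exact ⟨.matchEmpty h' hQ, fun δ => by simp only [SkK.den, e]⟩
  | _, _, _, _, _, _, _, hs, .matchSum h hM hN => by
      obtain ⟨h', e⟩ := h.exists_subst hs
      obtain ⟨hM', eM⟩ := hM.exists_subst (hs.lift _)
      obtain ⟨hN', eN⟩ := hN.exists_subst (hs.lift _)
      exact ⟨.matchSum h' hM' hN', fun δ => by simp only [SkK.den, e, eM, eN, liftEnv]⟩
  | _, _, _, _, _, _, _, hs, .op h hM hE hP => by
      obtain ⟨h', e⟩ := h.exists_subst hs
      obtain ⟨hM', eM⟩ := hM.exists_subst (hs.lift _)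
      choose hE' eE using fun e => (hE e).exists_subst hs
      exact ⟨.op h' hM' hE' hP, fun δ => by simp only [SkK.den, e, eM, eE, liftEnv]⟩
  | _, _, _, _, _, _, _, _, .raise hP => ⟨.raise hP, fun _ => rfl⟩
  | _, _, _, _, _, _, _, _, .kill hP => ⟨.kill hP, fun _ => rfl⟩
  | _, _, _, _, _, _, _, hs, .getenv h => by
      obtain ⟨h', e⟩ := h.exists_subst (hs.lift _)
      exact ⟨.getenv h', fun δ => by simp only [SkK.den, e, liftEnv]⟩
  | _, _, _, _, _, _, _, hs, .setenv h k => by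
      obtain ⟨h', e⟩ := h.exists_subst hs
      obtain ⟨k', e'⟩ := k.exists_subst hs
      exact ⟨.setenv h' k', fun δ => by simp only [SkK.den, e, e']⟩
  | _, _, _, _, _, _, _, hs, .user h hN hE => by
      obtain ⟨h', e⟩ := h.exists_subst hs
      obtain ⟨hN', eN⟩ := hN.exists_subst (hs.lift _)
      choose hE' eE using fun e => (hE e).exists_subst hs
      exact ⟨.user h' hN' hE', fun δ => by simp only [SkK.den, e, eN, eE, liftEnv]⟩

end

theorem SkV.den_ren {Γ Δ : List (STy L)} {V : Val L} {P : STy L} {r : ℕ → ℕ}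
    {f : Env m Δ → Env m Γ} (hr : DenRen r f) (d : SkV Γ V P)
    (d' : SkV Δ (V.ren r) P) (δ : Env m Δ) : d'.den δ = d.den (f δ) := by
  obtain ⟨d'', e⟩ := d.exists_ren hr
  rw [d'.unique d'', e]

theorem SkU.den_subst {Γ Δ : List (STy L)} {M : UTm L} {P : STy L} {s : ℕ → Val L}
    {f : Env m Δ → Env m Γ} (hs : DenSub s f) (d : SkU Γ M P)
    (d' : SkU Δ (M.subst s) P) (δ : Env m Δ) : d'.den δ = d.den (f δ) := by
  obtain ⟨d'', e⟩ := d.exists_subst hs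
  rw [d'.unique d'', e]

theorem SkK.den_ren {Γ Δ : List (STy L)} {K : KTm L} {P : STy L} {C : GTy L.Base} {r : ℕ → ℕ}
    {f : Env m Δ → Env m Γ} (hr : DenRen r f) (d : SkK Γ K P C)
    (d' : SkK Δ (K.ren r) P C) (δ : Env m Δ) : d'.den δ = d.den (f δ) := by
  obtain ⟨d'', e⟩ := d.exists_ren hr
  rw [d'.unique d'', e]

theorem SkK.den_subst {Γ Δ : List (STy L)} {K : KTm L} {P : STy L} {C : GTy L.Base} {s : ℕ → Val L}
    {f : Env m Δ → Env m Γ} (hs : DenSub s f) (d : SkK Γ K P C)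
    (d' : SkK Δ (K.subst s) P C) (δ : Env m Δ) : d'.den δ = d.den (f δ) := by
  obtain ⟨d'', e⟩ := d.exists_subst hs
  rw [d'.unique d'', e]

end Substitution

/-! ## Soundness of the computational equations -/

section Trees

variable {m : Model L}

theorem Tree.bind_assoc {X Y Z : Type u} (f : X → Tree m Y) (g : Y → Tree m Z) :
    (t : Tree m X) → (t.bind f).bind g = t.bind (fun x => (f x).bind g)
  | .ret _ => rfl
  | .node _ _ κ ν => by
      simp only [Tree.bind]
      congr 1
      · exact funext fun b => (κ b).bind_assoc f g
      · exact funext fun e => (ν e).bind_assoc f g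

theorem rip_res_elim (b : OpRes m L.rip) : False :=
  (cast (by rw [OpRes, L.rip_res]) b : PEmpty.{u + 1}).elim

theorem rip_exc_elim (e : L.OpExc L.rip) : False :=
  Finset.notMem_empty _ (L.rip_exc ▸ e.2 : e.1 ∈ (∅ : Finset L.Exc))

theorem ripTree_bind {X Y : Type u} (f : X → Tree m Y) : (ripTree m).bind f = ripTree m := by
  simp only [ripTree, Tree.bind]
  congr 1
  · exact funext fun b => (rip_res_elim b).elim
  · exact funext fun e => (rip_exc_elim e).elim

theorem clause_coe {α T : Type u} {E : Finset α} (N : {x : α // x ∈ E} → T) (dflt : T)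
    (x : {x : α // x ∈ E}) : clause E N dflt x.1 = N x := by
  rw [clause, dif_pos x.2]

theorem clause_of_mem {α T : Type u} {E : Finset α} (N : {x : α // x ∈ E} → T) (dflt : T)
    {x : α} (h : x ∈ E) : clause E N dflt x = N ⟨x, h⟩ := by
  rw [clause, dif_pos h]

theorem clause_of_notMem {α T : Type u} {E : Finset α} (N : {x : α // x ∈ E} → T) (dflt : T)
    {x : α} (h : x ∉ E) : clause E N dflt x = dflt := by
  rw [clause, dif_neg h]

theorem mkRunner_coe {C : Type u} {ops : Finset L.Op}
    (R : (o : {o : L.Op // o ∈ ops}) → OpPar m o.1 → KMon m (L.OpExc o.1) C (OpRes m o.1))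
    (o : {o : L.Op // o ∈ ops}) (a : OpPar m o.1) : mkRunner ops R o.1 a = R o a := by
  rw [mkRunner, dif_pos o.2]

theorem mkRunner_of_notMem {C : Type u} {ops : Finset L.Op}
    (R : (o : {o : L.Op // o ∈ ops}) → OpPar m o.1 → KMon m (L.OpExc o.1) C (OpRes m o.1))
    {o : L.Op} (h : o ∉ ops) (a : OpPar m o) : mkRunner ops R o a = fun _ => ripTree m := by
  rw [mkRunner, dif_neg h]

end Trees

section Axioms

variable {m : Model L} {Γ : List (STy L)}

theorem AxV.den_eq {V W : Val L} (h : AxV V W) {P : STy L} (d : SkV Γ V P) (d' : SkV Γ W P)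
    (γ : Env m Γ) : d.den γ = d'.den γ := by
  cases h with
  | ufunEta X =>
    cases d with
    | ufun h hP =>
      cases h with
      | app h k =>
        cases k with
        | var k =>
        cases k
        funext x
        simp only [SkV.den, SkU.den, d'.den_ren (DenRen.wk_one (m := m) _) h, Lookup.den]
  | kfunEta X =>
    cases d with
    | kfun h hP =>
      cases h with
      | app h k =>
        cases k with
        | var k =>
        cases k
        funext x
        simp only [SkV.den, SkK.den, d'.den_ren (DenRen.wk_one (m := m) _) h, Lookup.den]

theorem AxU.den_eq {M N : UTm L} (h : AxU M N) {P : STy L} (d : SkU Γ M P) (d' : SkU Γ N P)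
    (γ : Env m Γ) : d.den γ = d'.den γ := by
  cases h with
  | beta X M V =>
    cases d with
    | app h k =>
      cases h with
      | ufun h _ => rw [h.den_subst (DenSub.sub1 k) d']; rfl
  | tryRet V N E Ne =>
    cases d with
    | tryWith h hN hE =>
      cases h with
      | ret h => rw [hN.den_subst (DenSub.sub1 h) d']; rfl
  | tryRaise X N E Ne e =>
    cases d with
    | tryWith h hN hE =>
      cases h with
      | raise h =>
        rw [d'.unique (hE e)]
        simp only [SkU.den, handleU, Tree.bind, clause_coe]
  | tryOp o X X' V M Me N E Ne =>
    cases d with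
    | tryWith h hN hE =>
      cases h with
      | op hV hM hMe _ =>
        cases d' with
        | op hV' hM' hE' hX' =>
        obtain ⟨hN', eN⟩ := hN.exists_ren ((DenRen.wk_one (m := m) (L.opRes o).toS).lift _)
        choose hE'' eE using fun e => (hE e).exists_ren (DenRen.wk_one (m := m) (L.opRes o).toS)
        rw [hV'.unique hV, hM'.unique (.tryWith hM hN' hE''),
          funext fun e => (hE' e).unique (.tryWith (hMe e) hN hE)]
        simp only [SkU.den, handleU, Tree.bind, eN, eE, liftEnv]
  | matchPair V W M =>
    cases d with
    | matchPair h hM =>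
      cases h with
      | pair h k => rw [hM.den_subst (DenSub.sub2 h k) d']; rfl
  | matchEmpty X V N =>
    cases d with
    | matchEmpty h _ => exact (h.den γ).elim
  | matchInl X Y V M N =>
    cases d with
    | matchSum h hM hN =>
      cases h with
      | inl h => rw [hM.den_subst (DenSub.sub1 h) d']; rfl
  | matchInr X Y W M N =>
    cases d with
    | matchSum h hM hN =>
      cases h with
      | inr h => rw [hN.den_subst (DenSub.sub1 h) d']; rfl
  | runRet V W V' N E Ne S Ns =>
    cases d with
    | run hV hW hM hN hE hS =>
      cases hM with
      | ret h =>
        rw [hN.den_subst (DenSub.sub2 h hW) d']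
        simp only [SkU.den, finalise, runTree, Tree.bind, Equiv.apply_symm_apply]
  | runRaise V W X N E Ne S Ns e =>
    cases d with
    | run hV hW hM hN hE hS =>
      cases hM with
      | raise _ =>
        rw [(hE e).den_subst (DenSub.sub1 hW) d']
        simp only [SkU.den, finalise, runTree, Tree.bind, clause_coe, Equiv.apply_symm_apply]
  | runOp ops Ks C W o X V M Me N E Ne S Ns =>
    cases d with
    | run hV hW hM hN hE hS =>
      cases hV with
      | runner hKs =>
      cases hM with
      | op h hM hMe _ =>
        obtain ⟨hK, eK⟩ := (hKs o).exists_subst (DenSub.sub1 (m := m) h)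
        have r₁ := DenRen.wk_one (m := m) (Γ := Γ) C.toS
        have r₂ := DenRen.wk_two (m := m) (Γ := Γ) C.toS (L.opRes o.1).toS
        have r₃ : DenRen (m := m) (Γ := (L.opRes o.1).toS :: Γ)
            (Δ := C.toS :: (L.opRes o.1).toS :: Γ) (wk 1) (fun δ => δ.2) := DenRen.wk_one _
        obtain ⟨hV₁, eV₁⟩ := (SkV.runner hKs).exists_ren r₁
        obtain ⟨hV₂, eV₂⟩ := (SkV.runner hKs).exists_ren r₂
        obtain ⟨hM₂, eM₂⟩ := hM.exists_ren r₃
        choose hMe₁ eMe₁ using fun e => (hMe e).exists_ren r₁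
        obtain ⟨hN₁, eN₁⟩ := hN.exists_ren ((r₁.lift _).lift _)
        obtain ⟨hN₂, eN₂⟩ := hN.exists_ren ((r₂.lift _).lift _)
        choose hE₁ eE₁ using fun e => (hE e).exists_ren (r₁.lift _)
        choose hE₂ eE₂ using fun e => (hE e).exists_ren (r₂.lift _)
        choose hS₁ eS₁ using fun e => (hS e).exists_ren r₁
        choose hS₂ eS₂ using fun e => (hS e).exists_ren r₂
        rw [d'.unique (.kernel hK hW (.run hV₂ (.var .zero) hM₂ hN₂ hE₂ hS₂)
          (fun e => .run hV₁ (.var .zero) (hMe₁ e) hN₁ hE₁ hS₁) hS)]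
        simp only [SkU.den, SkV.den, finalise, runTree, Lookup.den, eK, eV₁, eV₂, eM₂, eMe₁, eN₁,
          eN₂, eE₁, eE₂, eS₁, eS₂, liftEnv, mkRunner_coe, restrictExc, Tree.bind_assoc,
          Equiv.apply_symm_apply, Equiv.symm_apply_apply]
        congr 1
        funext x
        rcases x with ⟨x | e, c⟩ | s
        · simp only [Tree.bind, Equiv.apply_symm_apply]
        · by_cases he : e ∈ L.opExc o.1
          · simp only [clause_of_mem _ _ he, Tree.bind]
          · simp only [clause_of_notMem _ _ he, ripTree_bind]
        · simp only [Tree.bind]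
  | kernelRet C V W N E Ne S Ns =>
    cases d with
    | kernel hK hW hN hE hS =>
      cases hK with
      | ret h =>
        rw [hN.den_subst (DenSub.sub2 h hW) d']
        simp only [SkU.den, SkK.den, finalise, Tree.bind, Equiv.apply_symm_apply]
  | kernelRaise X C W N E Ne S Ns e =>
    cases d with
    | kernel hK hW hN hE hS =>
      cases hK with
      | raise _ =>
        rw [(hE e).den_subst (DenSub.sub1 hW) d']
        simp only [SkU.den, SkK.den, finalise, Tree.bind, clause_coe, Equiv.apply_symm_apply]
  | kernelKill X C W N E Ne S Ns s =>
    cases d with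
    | kernel hK hW hN hE hS =>
      cases hK with
      | kill _ =>
        rw [d'.unique (hS s)]
        simp only [SkU.den, SkK.den, finalise, Tree.bind, clause_coe]
  | kernelGetenv C K W N E Ne S Ns =>
    cases d with
    | kernel hK hW hN hE hS =>
      cases hK with
      | getenv h =>
        obtain ⟨h', e⟩ := h.exists_subst (DenSub.sub1 (m := m) hW)
        rw [d'.unique (.kernel h' hW hN hE hS)]
        simp only [SkU.den, SkK.den, finalise, e, Equiv.apply_symm_apply]
  | kernelSetenv V K W N E Ne S Ns =>
    cases d with
    | kernel hK hW hN hE hS =>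
      cases hK with
      | setenv h h' =>
        rw [d'.unique (.kernel h' h hN hE hS)]
        simp only [SkU.den, SkK.den, finalise]
  | kernelOp o X X' V K Ke W N E Ne S Ns =>
    cases d with
    | kernel hK hW hN hE hS =>
      cases hK with
      | op h hK hKe _ =>
        cases d' with
        | op h' hK' hE' hX' =>
        have r := DenRen.wk_one (m := m) (Γ := Γ) (L.opRes o).toS
        obtain ⟨hW₁, eW⟩ := hW.exists_ren r
        obtain ⟨hN₁, eN⟩ := hN.exists_ren ((r.lift _).lift _)
        choose hE₁ eE using fun e => (hE e).exists_ren (r.lift _)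
        choose hS₁ eS using fun e => (hS e).exists_ren r
        rw [h'.unique h, hK'.unique (.kernel hK hW₁ hN₁ hE₁ hS₁),
          funext fun e => (hE' e).unique (.kernel (hKe e) hW hN hE hS)]
        simp only [SkU.den, SkK.den, finalise, Tree.bind, eW, eN, eE, eS, liftEnv]

theorem AxK.den_eq {K N : KTm L} (h : AxK K N) {P : STy L} {C : GTy L.Base} (d : SkK Γ K P C)
    (d' : SkK Γ N P C) (γ : Env m Γ) : d.den γ = d'.den γ := by
  cases h with
  | beta X K V =>
    cases d with
    | app h k =>
      cases h with
      | kfun h _ => rw [h.den_subst (DenSub.sub1 k) d']; rfl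
  | tryRet C V N E Ne =>
    cases d with
    | tryWith h hN hE =>
      cases h with
      | ret h => rw [hN.den_subst (DenSub.sub1 h) d']; rfl
  | tryRaise X C N E Ne e =>
    cases d with
    | tryWith h hN hE =>
      cases h with
      | raise h =>
        rw [d'.unique (hE e)]
        funext c
        simp only [SkK.den, handleK, Tree.bind, clause_coe]
  | tryKill X X' C s N E Ne =>
    cases d with
    | tryWith h hN hE =>
      cases h with
      | kill h => cases d'; rfl
  | tryOp o X X' V K Ke N E Ne =>
    cases d with
    | tryWith h hN hE =>
      cases h with
      | op hV hK hKe _ =>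
        cases d' with
        | op hV' hK' hE' hX' =>
        obtain ⟨hN', eN⟩ := hN.exists_ren ((DenRen.wk_one (m := m) (L.opRes o).toS).lift _)
        choose hE'' eE using fun e => (hE e).exists_ren (DenRen.wk_one (m := m) (L.opRes o).toS)
        rw [hV'.unique hV, hK'.unique (.tryWith hK hN' hE''),
          funext fun e => (hE' e).unique (.tryWith (hKe e) hN hE)]
        funext c
        simp only [SkK.den, handleK, Tree.bind, eN, eE, liftEnv]
  | tryGetenv C K N E Ne =>
    cases d with
    | tryWith h hN hE =>
      cases h with
      | getenv h =>
        have r := DenRen.wk_one (m := m) (Γ := Γ) C.toS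
        obtain ⟨hN', eN⟩ := hN.exists_ren (r.lift _)
        choose hE' eE using fun e => (hE e).exists_ren r
        rw [d'.unique (.getenv (.tryWith h hN' hE'))]
        funext c
        simp only [SkK.den, handleK, eN, eE, liftEnv]
  | trySetenv V K N E Ne =>
    cases d with
    | tryWith h hN hE =>
      cases h with
      | setenv h k =>
        rw [d'.unique (.setenv h (.tryWith k hN hE))]
        funext c
        simp only [SkK.den, handleK]
  | matchPair V W K =>
    cases d with
    | matchPair h hK =>
      cases h with
      | pair h k => rw [hK.den_subst (DenSub.sub2 h k) d']; rfl
  | matchEmpty X C V K =>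
    cases d with
    | matchEmpty h _ => exact (h.den γ).elim
  | matchInl X Y V K N =>
    cases d with
    | matchSum h hK hN =>
      cases h with
      | inl h => rw [hK.den_subst (DenSub.sub1 h) d']; rfl
  | matchInr X Y W K N =>
    cases d with
    | matchSum h hK hN =>
      cases h with
      | inr h => rw [hN.den_subst (DenSub.sub1 h) d']; rfl
  | userRet V N E Ne =>
    cases d with
    | user h hN hE =>
      cases h with
      | ret h => rw [hN.den_subst (DenSub.sub1 h) d']; rfl
  | userRaise X N E Ne e =>
    cases d with
    | user h hN hE =>
      cases h with
      | raise h =>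
        rw [d'.unique (hE e)]
        funext c
        simp only [SkK.den, SkU.den, userK, Tree.bind, clause_coe]
  | userOp o X X' V M Me N E Ne =>
    cases d with
    | user h hN hE =>
      cases h with
      | op hV hM hMe _ =>
        cases d' with
        | op hV' hM' hE' hX' =>
        obtain ⟨hN', eN⟩ := hN.exists_ren ((DenRen.wk_one (m := m) (L.opRes o).toS).lift _)
        choose hE'' eE using fun e => (hE e).exists_ren (DenRen.wk_one (m := m) (L.opRes o).toS)
        rw [hV'.unique hV, hM'.unique (.user hM hN' hE''),
          funext fun e => (hE' e).unique (.user (hMe e) hN hE)]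
        funext c
        simp only [SkK.den, SkU.den, userK, Tree.bind, eN, eE, liftEnv]
  | getSet C K =>
    cases d with
    | getenv h =>
      cases h with
      | setenv h k =>
        cases h with
        | var h =>
        cases h
        funext c
        simp only [SkK.den, SkV.den, Lookup.den, d'.den_ren (DenRen.wk_one (m := m) _) k,
          Equiv.symm_apply_apply]
  | setGet C V K =>
    cases d with
    | setenv h k =>
      cases k with
      | getenv k =>
        obtain ⟨k', e⟩ := k.exists_subst (DenSub.sub1 (m := m) h)
        rw [d'.unique (.setenv h k')]
        simp only [SkK.den, e, Equiv.apply_symm_apply]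
  | setSet V W K =>
    cases d with
    | setenv h k =>
      cases k with
      | setenv h' k =>
        rw [d'.unique (.setenv h' k)]
        simp only [SkK.den]
  | getKill X C s =>
    cases d with
    | getenv h => cases h; cases d'; rfl
  | setKill X C V s =>
    cases d with
    | setenv h k => cases k; cases d'; rfl
  | getOp C o X V K Ke =>
    cases d with
    | getenv h =>
      cases h with
      | op hV hK hKe hX =>
        cases d' with
        | op hV' hK' hKe' hX' =>
        obtain ⟨hK'', eK⟩ := hK.exists_ren (DenRen.swap (m := m) C.toS (L.opRes o).toS)
        rw [hK'.unique (.getenv hK''), funext fun e => (hKe' e).unique (.getenv (hKe e))]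
        funext c
        simp only [SkK.den, hV'.den_ren (DenRen.wk_one (m := m) _) hV, eK]
  | setOp o X V W K Ke =>
    cases d with
    | setenv h k =>
      cases k with
      | op hV hK hKe hX =>
        cases d' with
        | op hV' hK' hKe' hX' =>
        obtain ⟨h', e⟩ := h.exists_ren (DenRen.wk_one (m := m) (L.opRes o).toS)
        rw [hV'.unique hV, hK'.unique (.setenv h' hK),
          funext fun e => (hKe' e).unique (.setenv h (hKe e))]
        simp only [SkK.den, e]

end Axioms

/-! ## Soundness without the eta-equations for exception handlers -/

section DenEq

variable (m : Model L)

/-- The values `V` and `W` have equal skeletal meanings. -/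
def DenEqV (Γ : List (STy L)) (V W : Val L) (P : STy L) : Prop :=
  ∃ (d : SkV Γ V P) (d' : SkV Γ W P), ∀ γ : Env m Γ, d.den γ = d'.den γ

/-- The user computations `M` and `N` have equal skeletal meanings. -/
def DenEqU (Γ : List (STy L)) (M N : UTm L) (P : STy L) : Prop :=
  ∃ (d : SkU Γ M P) (d' : SkU Γ N P), ∀ γ : Env m Γ, d.den γ = d'.den γ

/-- The kernel computations `K` and `N` have equal skeletal meanings. -/
def DenEqK (Γ : List (STy L)) (K N : KTm L) (P : STy L) (C : GTy L.Base) : Prop :=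
  ∃ (d : SkK Γ K P C) (d' : SkK Γ N P C), ∀ γ : Env m Γ, d.den γ = d'.den γ

mutual

theorem EqV.den_eq : {v : Variant} → {Γ : List (VTy L)} → {V W : Val L} → {X : VTy L} →
    EqV v Γ V W X → v = .noTryEta → DenEqV m (skelCtx Γ) V W X.skel
  | _, _, _, _, _, .refl D, _ => ⟨D.skel, D.skel, fun _ => rfl⟩
  | _, _, _, _, _, .symm h, hv => by
      obtain ⟨d, d', e⟩ := h.den_eq hv
      exact ⟨d', d, fun γ => (e γ).symm⟩
  | _, _, _, _, _, .trans h h', hv => by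
      obtain ⟨d, d₁, e⟩ := h.den_eq hv
      obtain ⟨d₂, d', e'⟩ := h'.den_eq hv
      cases d₁.unique d₂
      exact ⟨d, d', fun γ => (e γ).trans (e' γ)⟩
  | _, _, _, _, _, .subsume h hs, hv => by
      have := h.den_eq hv
      rwa [hs.skel_eq] at this
  | _, _, _, _, _, .ax h D D', _ => ⟨D.skel, D'.skel, h.den_eq _ _⟩
  | _, _, _, _, _, .unitEta D, _ => ⟨D.skel, .unit, fun _ => rfl⟩
  | _, _, _, _, _, .const h, hv => by
      choose d d' e using fun i => (h i).den_eq hv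
      exact ⟨.const d rfl, .const d' rfl, fun γ => by simp only [SkV.den, e]⟩
  | _, _, _, _, _, .pair h k, hv => by
      obtain ⟨d, d', e⟩ := h.den_eq hv
      obtain ⟨f, f', e'⟩ := k.den_eq hv
      exact ⟨.pair d f, .pair d' f', fun γ => by simp only [SkV.den, e, e']⟩
  | _, _, _, _, _, .inl h, hv => by
      obtain ⟨d, d', e⟩ := h.den_eq hv
      exact ⟨.inl d rfl rfl, .inl d' rfl rfl, fun γ => by simp only [SkV.den, e]⟩
  | _, _, _, _, _, .inr h, hv => by
      obtain ⟨d, d', e⟩ := h.den_eq hv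
      exact ⟨.inr d rfl rfl, .inr d' rfl rfl, fun γ => by simp only [SkV.den, e]⟩
  | _, _, _, _, _, .ufun h, hv => by
      obtain ⟨d, d', e⟩ := h.den_eq (by rw [hv]; rfl)
      exact ⟨.ufun d rfl, .ufun d' rfl, fun γ => by simp only [SkV.den, e]⟩
  | _, _, _, _, _, .kfun h, hv => by
      obtain ⟨d, d', e⟩ := h.den_eq (by rw [hv]; rfl)
      exact ⟨.kfun d rfl, .kfun d' rfl, fun γ => by simp only [SkV.den, e]⟩
  | _, _, _, _, _, .runner h, hv => by
      choose d d' e using fun o => (h o).den_eq hv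
      exact ⟨.runner d, .runner d', fun γ => by simp only [SkV.den, e]⟩

theorem EqU.den_eq : {v : Variant} → {Γ : List (VTy L)} → {M N : UTm L} → {X : VTy L} →
    {U : UEff L} → EqU v Γ M N X U → v = .noTryEta → DenEqU m (skelCtx Γ) M N X.skel
  | _, _, _, _, _, _, .refl D, _ => ⟨D.skel, D.skel, fun _ => rfl⟩
  | _, _, _, _, _, _, .symm h, hv => by
      obtain ⟨d, d', e⟩ := h.den_eq hv
      exact ⟨d', d, fun γ => (e γ).symm⟩
  | _, _, _, _, _, _, .trans h h', hv => by
      obtain ⟨d, d₁, e⟩ := h.den_eq hv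
      obtain ⟨d₂, d', e'⟩ := h'.den_eq hv
      cases d₁.unique d₂
      exact ⟨d, d', fun γ => (e γ).trans (e' γ)⟩
  | _, _, _, _, _, _, .subsume h hs, hv => by
      have := h.den_eq hv
      rwa [hs.val.skel_eq] at this
  | _, _, _, _, _, _, .ax h D D', _ => ⟨D.skel, D'.skel, h.den_eq _ _⟩
  | _, _, _, _, _, _, .eta hv' _ _ _, hv => (hv' hv).elim
  | _, _, _, _, _, _, .ret h, hv => by
      obtain ⟨d, d', e⟩ := h.den_eq hv
      exact ⟨.ret d, .ret d', fun γ => by simp only [SkU.den, e]⟩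
  | _, _, _, _, _, _, .app h k, hv => by
      obtain ⟨d, d', e⟩ := h.den_eq hv
      obtain ⟨f, f', e'⟩ := k.den_eq hv
      exact ⟨.app d f, .app d' f', fun γ => by simp only [SkU.den, e, e']⟩
  | _, _, _, _, _, _, .tryWith h hN hE, hv => by
      obtain ⟨d, d', e⟩ := h.den_eq hv
      obtain ⟨dN, dN', eN⟩ := hN.den_eq hv
      choose dE dE' eE using fun e => (hE e).den_eq hv
      exact ⟨.tryWith d dN dE, .tryWith d' dN' dE',
        fun γ => by simp only [SkU.den, e, eN, eE]⟩
  | _, _, _, _, _, _, .matchPair h hM, hv => by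
      obtain ⟨d, d', e⟩ := h.den_eq hv
      obtain ⟨dM, dM', eM⟩ := hM.den_eq hv
      exact ⟨.matchPair d dM, .matchPair d' dM', fun γ => by simp only [SkU.den, e, eM]⟩
  | _, _, _, _, _, _, .matchEmpty h, hv => by
      obtain ⟨d, d', e⟩ := h.den_eq hv
      exact ⟨.matchEmpty d rfl, .matchEmpty d' rfl, fun γ => (d.den γ).elim⟩
  | _, _, _, _, _, _, .matchSum h hM hN, hv => by
      obtain ⟨d, d', e⟩ := h.den_eq hv
      obtain ⟨dM, dM', eM⟩ := hM.den_eq hv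
      obtain ⟨dN, dN', eN⟩ := hN.den_eq hv
      exact ⟨.matchSum d dM dN, .matchSum d' dM' dN',
        fun γ => by simp only [SkU.den, e, eM, eN]⟩
  | _, _, _, _, _, _, .op _ h hM hE, hv => by
      obtain ⟨d, d', e⟩ := h.den_eq hv
      obtain ⟨dM, dM', eM⟩ := hM.den_eq hv
      choose dE dE' eE using fun e => (hE e).den_eq hv
      exact ⟨.op d dM dE rfl, .op d' dM' dE' rfl,
        fun γ => by simp only [SkU.den, e, eM, eE]⟩
  | _, _, _, _, _, _, .run hV hW hM hN hE hS, hv => by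
      obtain ⟨dV, dV', eV⟩ := hV.den_eq hv
      obtain ⟨dW, dW', eW⟩ := hW.den_eq hv
      obtain ⟨dM, dM', eM⟩ := hM.den_eq hv
      obtain ⟨dN, dN', eN⟩ := hN.den_eq hv
      choose dE dE' eE using fun e => (hE e).den_eq hv
      choose dS dS' eS using fun s => (hS s).den_eq hv
      exact ⟨.run dV dW dM dN dE dS, .run dV' dW' dM' dN' dE' dS',
        fun γ => by simp only [SkU.den, eV, eW, eM, eN, eE, eS]⟩
  | _, _, _, _, _, _, .kernel hK hW hN hE hS, hv => by
      obtain ⟨dK, dK', eK⟩ := hK.den_eq hv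
      obtain ⟨dW, dW', eW⟩ := hW.den_eq hv
      obtain ⟨dN, dN', eN⟩ := hN.den_eq hv
      choose dE dE' eE using fun e => (hE e).den_eq hv
      choose dS dS' eS using fun s => (hS s).den_eq hv
      exact ⟨.kernel dK dW dN dE dS, .kernel dK' dW' dN' dE' dS',
        fun γ => by simp only [SkU.den, eK, eW, eN, eE, eS]⟩

theorem EqK.den_eq : {v : Variant} → {Γ : List (VTy L)} → {K N : KTm L} → {X : VTy L} →
    {E : KEff L} → EqK v Γ K N X E → v = .noTryEta → DenEqK m (skelCtx Γ) K N X.skel E.st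
  | _, _, _, _, _, _, .refl D, _ => ⟨D.skel, D.skel, fun _ => rfl⟩
  | _, _, _, _, _, _, .symm h, hv => by
      obtain ⟨d, d', e⟩ := h.den_eq hv
      exact ⟨d', d, fun γ => (e γ).symm⟩
  | _, _, _, _, _, _, .trans h h', hv => by
      obtain ⟨d, d₁, e⟩ := h.den_eq hv
      obtain ⟨d₂, d', e'⟩ := h'.den_eq hv
      cases d₁.unique d₂
      exact ⟨d, d', fun γ => (e γ).trans (e' γ)⟩
  | _, _, _, _, _, _, .subsume h hs, hv => by
      have := h.den_eq hv
      rwa [hs.val.skel_eq, hs.st] at this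
  | _, _, _, _, _, _, .ax h D D', _ => ⟨D.skel, D'.skel, h.den_eq _ _⟩
  | _, _, _, _, _, _, .eta hv' _ _ _, hv => (hv' hv).elim
  | _, _, _, _, _, _, .ret h, hv => by
      obtain ⟨d, d', e⟩ := h.den_eq hv
      exact ⟨.ret d, .ret d', fun γ => by simp only [SkK.den, e]⟩
  | _, _, _, _, _, _, .app h k, hv => by
      obtain ⟨d, d', e⟩ := h.den_eq hv
      obtain ⟨f, f', e'⟩ := k.den_eq hv
      exact ⟨.app d f, .app d' f', fun γ => by simp only [SkK.den, e, e']⟩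
  | _, _, _, _, _, _, .tryWith h hN hE, hv => by
      obtain ⟨d, d', e⟩ := h.den_eq hv
      obtain ⟨dN, dN', eN⟩ := hN.den_eq hv
      choose dE dE' eE using fun e => (hE e).den_eq hv
      exact ⟨.tryWith d dN dE, .tryWith d' dN' dE',
        fun γ => by simp only [SkK.den, e, eN, eE]⟩
  | _, _, _, _, _, _, .matchPair h hM, hv => by
      obtain ⟨d, d', e⟩ := h.den_eq hv
      obtain ⟨dM, dM', eM⟩ := hM.den_eq hv
      exact ⟨.matchPair d dM, .matchPair d' dM', fun γ => by simp only [SkK.den, e, eM]⟩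
  | _, _, _, _, _, _, .matchEmpty h, hv => by
      obtain ⟨d, d', e⟩ := h.den_eq hv
      exact ⟨.matchEmpty d rfl, .matchEmpty d' rfl, fun γ => (d.den γ).elim⟩
  | _, _, _, _, _, _, .matchSum h hM hN, hv => by
      obtain ⟨d, d', e⟩ := h.den_eq hv
      obtain ⟨dM, dM', eM⟩ := hM.den_eq hv
      obtain ⟨dN, dN', eN⟩ := hN.den_eq hv
      exact ⟨.matchSum d dM dN, .matchSum d' dM' dN',
        fun γ => by simp only [SkK.den, e, eM, eN]⟩
  | _, _, _, _, _, _, .op _ h hM hE, hv => by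
      obtain ⟨d, d', e⟩ := h.den_eq hv
      obtain ⟨dM, dM', eM⟩ := hM.den_eq hv
      choose dE dE' eE using fun e => (hE e).den_eq hv
      exact ⟨.op d dM dE rfl, .op d' dM' dE' rfl,
        fun γ => by simp only [SkK.den, e, eM, eE]⟩
  | _, _, _, _, _, _, .getenv h, hv => by
      obtain ⟨d, d', e⟩ := h.den_eq hv
      exact ⟨.getenv d, .getenv d', fun γ => by simp only [SkK.den, e]⟩
  | _, _, _, _, _, _, .setenv h k, hv => by
      obtain ⟨d, d', e⟩ := h.den_eq hv
      obtain ⟨f, f', e'⟩ := k.den_eq hv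
      exact ⟨.setenv d f, .setenv d' f', fun γ => by simp only [SkK.den, e, e']⟩
  | _, _, _, _, _, _, .user h hN hE, hv => by
      obtain ⟨d, d', e⟩ := h.den_eq hv
      obtain ⟨dN, dN', eN⟩ := hN.den_eq hv
      choose dE dE' eE using fun e => (hE e).den_eq hv
      exact ⟨.user d dN dE, .user d' dN' dE',
        fun γ => by simp only [SkK.den, e, eN, eE]⟩

end

end DenEq

/-! ## Relational lifting to trees and to the user and kernel monads -/

section Lifting

variable {m : Model L}

namespace Tree.Rel

variable {X Y : Type u} {ops ops' : Finset L.Op}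

theorem mono {Q Q' : X → X → Prop} (ho : ops ⊆ ops') (hQ : ∀ x x', Q x x' → Q' x x')
    {t t' : Tree m X} (h : Tree.Rel ops Q t t') : Tree.Rel ops' Q' t t' := by
  induction h with
  | ret h => exact .ret (hQ _ _ h)
  | node h _ _ ihκ ihν => exact .node (ho h) ihκ ihν

theorem symm {Q Q' : X → X → Prop} (hQ : ∀ x x', Q x x' → Q' x' x)
    {t t' : Tree m X} (h : Tree.Rel ops Q t t') : Tree.Rel ops Q' t' t := by
  induction h with
  | ret h => exact .ret (hQ _ _ h)
  | node h _ _ ihκ ihν => exact .node h ihκ ihν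

theorem trans {Q Q' Q'' : X → X → Prop} (hQ : ∀ x y z, Q x y → Q' y z → Q'' x z)
    {t t' t'' : Tree m X} (h : Tree.Rel ops Q t t') (h' : Tree.Rel ops Q' t' t'') :
    Tree.Rel ops Q'' t t'' := by
  induction h generalizing t'' with
  | ret h =>
    cases h' with
    | ret h' => exact .ret (hQ _ _ _ h h')
  | node h _ _ ihκ ihν =>
    cases h' with
    | node _ hκ hν => exact .node h (fun b => ihκ b (hκ b)) (fun e => ihν e (hν e))

theorem bind {Q : X → X → Prop} {Q' : Y → Y → Prop} {f f' : X → Tree m Y}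
    (hf : ∀ x x', Q x x' → Tree.Rel ops Q' (f x) (f' x'))
    {t t' : Tree m X} (h : Tree.Rel ops Q t t') : Tree.Rel ops Q' (t.bind f) (t'.bind f') := by
  induction h with
  | ret h => exact hf _ _ h
  | node h _ _ ihκ ihν => exact .node h ihκ ihν

theorem iff_within {Q : X → X → Prop} {q : X → Prop} (hQ : ∀ x x', Q x x' ↔ x = x' ∧ q x)
    {t t' : Tree m X} : Tree.Rel ops Q t t' ↔ t = t' ∧ t.Within ops q := by
  constructor
  · intro h
    induction h with
    | ret h =>
      obtain ⟨rfl, h'⟩ := (hQ _ _).1 h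
      exact ⟨rfl, h'⟩
    | node h _ _ ihκ ihν =>
      obtain rfl := funext fun b => (ihκ b).1
      obtain rfl := funext fun e => (ihν e).1
      exact ⟨rfl, h, fun b => (ihκ b).2, fun e => (ihν e).2⟩
  · rintro ⟨rfl, h⟩
    induction t with
    | ret x => exact .ret ((hQ _ _).2 ⟨rfl, h⟩)
    | node o a κ ν ihκ ihν => exact .node h.1 (fun b => ihκ b (h.2.1 b)) (fun e => ihν e (h.2.2 e))

theorem eq {Q : X → X → Prop} (hQ : ∀ x x', Q x x' → x = x') {t t' : Tree m X}
    (h : Tree.Rel ops Q t t') : t = t' :=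
  ((iff_within (q := fun _ => True) (fun _ _ => ⟨fun h => ⟨h, trivial⟩, And.left⟩)).1
    (h.mono (subset_refl _) hQ)).1

/-- A function that acts as `ret` on the leaves of a tree. -/
theorem bind_eq_self {Q : X → X → Prop} {f : X → Tree m X}
    (hf : ∀ x x', Q x x' → f x = .ret x) {t t' : Tree m X} (h : Tree.Rel ops Q t t') :
    t.bind f = t := by
  induction h with
  | ret h => exact hf _ _ h
  | node h _ _ ihκ ihν =>
    simp only [Tree.bind, ihκ, ihν]

end Tree.Rel

section User

variable {X Y : Type u}

theorem URel.mono {R R' : X → X → Prop} {U U' : UEff L} (hR : ∀ x x', R x x' → R' x x')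
    (ho : U.ops ⊆ U'.ops) (he : U.exc ⊆ U'.exc) {t t' : UMon m X} (h : URel R U t t') :
    URel R' U' t t' := by
  refine Tree.Rel.mono ho ?_ h
  rintro (x | e) (x' | e') h
  · exact hR _ _ h
  · exact h
  · exact h
  · exact ⟨h.1, he h.2⟩

theorem URel.symm {R : X → X → Prop} {U : UEff L} (hR : ∀ x x', R x x' → R x' x)
    {t t' : UMon m X} (h : URel R U t t') : URel R U t' t := by
  refine Tree.Rel.symm ?_ h
  rintro (x | e) (x' | e') h
  · exact hR _ _ h
  · exact h
  · exact h
  · exact ⟨h.1.symm, h.1 ▸ h.2⟩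

theorem URel.trans {R : X → X → Prop} {U : UEff L} (hR : ∀ x y z, R x y → R y z → R x z)
    {t t' t'' : UMon m X} (h : URel R U t t') (h' : URel R U t' t'') : URel R U t t'' := by
  refine Tree.Rel.trans ?_ h h'
  rintro (x | e) (x' | e') (x'' | e'') h h'
  all_goals first
    | exact hR _ _ _ h h'
    | exact ⟨h.1.trans h'.1, h.2⟩
    | exact h.elim
    | exact h'.elim

theorem URel.iff_ref {R : X → X → Prop} {A : Set X} {U : UEff L}
    (hR : ∀ x x', R x x' ↔ x = x' ∧ x ∈ A) {t t' : UMon m X} :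
    URel R U t t' ↔ t = t' ∧ t ∈ URef A U := by
  refine Tree.Rel.iff_within ?_
  rintro (x | e) (x' | e')
  · simpa using hR x x'
  · simp
  · simp
  · simp

theorem URel.eq {R : X → X → Prop} {U : UEff L} (hR : ∀ x x', R x x' → x = x')
    {t t' : UMon m X} (h : URel R U t t') : t = t' := by
  refine Tree.Rel.eq ?_ h
  rintro (x | e) (x' | e') h
  · rw [hR _ _ h]
  · exact h.elim
  · exact h.elim
  · rw [h.1]

end User

section Kernel

variable {X Y E C : Type u}

theorem KRel.mono {R R' : X → X → Prop} {ops ops' : Finset L.Op} {E₀ E₀' : Set E}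
    {S S' : Finset L.Sgn} (hR : ∀ x x', R x x' → R' x x') (ho : ops ⊆ ops') (he : E₀ ⊆ E₀')
    (hs : S ⊆ S') {k k' : KMon m E C X} (h : KRel R ops E₀ S k k') :
    KRel R' ops' E₀' S' k k' := by
  intro c
  refine Tree.Rel.mono ho ?_ (h c)
  rintro (⟨x | e, d⟩ | s) (⟨x' | e', d'⟩ | s') h
  all_goals first
    | exact ⟨hR _ _ h.1, h.2⟩
    | exact ⟨h.1, he h.2.1, h.2.2⟩
    | exact ⟨h.1, hs h.2⟩
    | exact h.elim

theorem KRel.symm {R : X → X → Prop} {ops : Finset L.Op} {E₀ : Set E} {S : Finset L.Sgn}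
    (hR : ∀ x x', R x x' → R x' x) {k k' : KMon m E C X} (h : KRel R ops E₀ S k k') :
    KRel R ops E₀ S k' k := by
  intro c
  refine Tree.Rel.symm ?_ (h c)
  rintro (⟨x | e, d⟩ | s) (⟨x' | e', d'⟩ | s') h
  all_goals first
    | exact ⟨hR _ _ h.1, h.2.symm⟩
    | exact ⟨h.1.symm, h.1 ▸ h.2.1, h.2.2.symm⟩
    | exact ⟨h.1.symm, h.1 ▸ h.2⟩
    | exact h.elim

theorem KRel.trans {R : X → X → Prop} {ops : Finset L.Op} {E₀ : Set E} {S : Finset L.Sgn}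
    (hR : ∀ x y z, R x y → R y z → R x z) {k k' k'' : KMon m E C X}
    (h : KRel R ops E₀ S k k') (h' : KRel R ops E₀ S k' k'') : KRel R ops E₀ S k k'' := by
  intro c
  refine Tree.Rel.trans ?_ (h c) (h' c)
  rintro (⟨x | e, d⟩ | s) (⟨x' | e', d'⟩ | s') (⟨x'' | e'', d''⟩ | s'') h h'
  all_goals first
    | exact h.elim
    | exact h'.elim
    | exact ⟨hR _ _ _ h.1 h'.1, h.2.trans h'.2⟩
    | exact ⟨h.1.trans h'.1, h.2.1, h.2.2.trans h'.2.2⟩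
    | exact ⟨h.1.trans h'.1, h.2⟩

theorem KRel.iff_ref {R : X → X → Prop} {A : Set X} {ops : Finset L.Op} {E₀ : Set E}
    {S : Finset L.Sgn} (hR : ∀ x x', R x x' ↔ x = x' ∧ x ∈ A) {k k' : KMon m E C X} :
    KRel R ops E₀ S k k' ↔ k = k' ∧ k ∈ KRef A ops E₀ S := by
  rw [KRel, funext_iff, KRef, Set.mem_ofPred_eq, ← forall_and]
  refine forall_congr' fun c => Tree.Rel.iff_within ?_
  rintro (⟨x | e, d⟩ | s) (⟨x' | e', d'⟩ | s')
  · have := hR x x'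
    simp only [this, Sum.inl.injEq, Prod.mk.injEq]
    tauto
  · simp
  · simp
  · simp
  · simp only [Sum.inl.injEq, Sum.inr.injEq, Prod.mk.injEq]
    tauto
  · simp
  · simp
  · simp
  · simp

theorem KRel.eq {R : X → X → Prop} {ops : Finset L.Op} {E₀ : Set E} {S : Finset L.Sgn}
    (hR : ∀ x x', R x x' → x = x') {k k' : KMon m E C X} (h : KRel R ops E₀ S k k') : k = k' := by
  funext c
  refine Tree.Rel.eq ?_ (h c)
  rintro (⟨x | e, d⟩ | s) (⟨x' | e', d'⟩ | s') h
  all_goals first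
    | exact h.elim
    | rw [hR _ _ h.1, h.2]
    | rw [h.1, h.2.2]
    | rw [h.1]

end Kernel

section Operators

variable {C P Q : Type u} {R : P → P → Prop} {R' : Q → Q → Prop} {ops ops' : Finset L.Op}
  {E E' : Finset L.Exc} {S S' : Finset L.Sgn}

theorem URel.handleU {N N' : P → UMon m Q} {Ne Ne' : {e : L.Exc // e ∈ E} → UMon m Q}
    {t t' : UMon m P} (h : URel R ⟨ops, E⟩ t t')
    (hN : ∀ x x', R x x' → URel R' ⟨ops, E'⟩ (N x) (N' x'))
    (hE : ∀ e, URel R' ⟨ops, E'⟩ (Ne e) (Ne' e)) :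
    URel R' ⟨ops, E'⟩ (Coop.handleU N E Ne t) (Coop.handleU N' E Ne' t') := by
  refine Tree.Rel.bind ?_ h
  rintro (x | e) (x' | e') h
  · exact hN _ _ h
  · exact h.elim
  · exact h.elim
  · obtain ⟨rfl, h⟩ := h
    simp only [clause_of_mem _ _ h]
    exact hE _

theorem KRel.handleK {N N' : P → KMon m L.Exc C Q}
    {Ne Ne' : {e : L.Exc // e ∈ E} → KMon m L.Exc C Q}
    {k k' : KMon m L.Exc C P} (h : KRel R ops {e | e ∈ E} S k k')
    (hN : ∀ x x', R x x' → KRel R' ops {e | e ∈ E'} S (N x) (N' x'))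
    (hE : ∀ e, KRel R' ops {e | e ∈ E'} S (Ne e) (Ne' e)) :
    KRel R' ops {e | e ∈ E'} S (Coop.handleK N E Ne k) (Coop.handleK N' E Ne' k') := by
  intro c
  refine Tree.Rel.bind ?_ (h c)
  rintro (⟨x | e, d⟩ | s) (⟨x' | e', d'⟩ | s') h
  · obtain ⟨h, rfl⟩ := h
    exact hN _ _ h _
  · exact h.elim
  · exact h.elim
  · exact h.elim
  · obtain ⟨rfl, h, rfl⟩ := h
    simp only [clause_of_mem _ _ (show e ∈ E from h)]
    exact hE _ _
  · exact h.elim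
  · exact h.elim
  · exact h.elim
  · exact .ret h

theorem URel.userK {N N' : P → KMon m L.Exc C Q}
    {Ne Ne' : {e : L.Exc // e ∈ E} → KMon m L.Exc C Q}
    {t t' : UMon m P} (h : URel R ⟨ops, E⟩ t t')
    (hN : ∀ x x', R x x' → KRel R' ops {e | e ∈ E'} S (N x) (N' x'))
    (hE : ∀ e, KRel R' ops {e | e ∈ E'} S (Ne e) (Ne' e)) :
    KRel R' ops {e | e ∈ E'} S (Coop.userK N E Ne t) (Coop.userK N' E Ne' t') := by
  intro c
  refine Tree.Rel.bind ?_ h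
  rintro (x | e) (x' | e') h
  · exact hN _ _ h _
  · exact h.elim
  · exact h.elim
  · obtain ⟨rfl, h⟩ := h
    simp only [clause_of_mem _ _ h]
    exact hE _ _

theorem KRel.finalise {N N' : P → C → UMon m Q}
    {Ne Ne' : {e : L.Exc // e ∈ E} → C → UMon m Q} {Ns Ns' : {s : L.Sgn // s ∈ S} → UMon m Q}
    {k k' : KMon m L.Exc C P} (h : KRel R ops {e | e ∈ E} S k k')
    (hN : ∀ x x' c, R x x' → URel R' ⟨ops, E'⟩ (N x c) (N' x' c))
    (hE : ∀ e c, URel R' ⟨ops, E'⟩ (Ne e c) (Ne' e c))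
    (hS : ∀ s, URel R' ⟨ops, E'⟩ (Ns s) (Ns' s)) (c : C) :
    URel R' ⟨ops, E'⟩ (Coop.finalise N E Ne S Ns k c) (Coop.finalise N' E Ne' S Ns' k' c) := by
  refine Tree.Rel.bind ?_ (h c)
  rintro (⟨x | e, d⟩ | s) (⟨x' | e', d'⟩ | s') h
  · obtain ⟨h, rfl⟩ := h
    exact hN _ _ _ h
  · exact h.elim
  · exact h.elim
  · exact h.elim
  · obtain ⟨rfl, h, rfl⟩ := h
    simp only [clause_of_mem _ _ (show e ∈ E from h)]
    exact hE _ _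
  · exact h.elim
  · exact h.elim
  · exact h.elim
  · obtain ⟨rfl, h⟩ := h
    simp only [clause_of_mem _ _ h]
    exact hS _

theorem URel.runTree {T T' : RunnerSk m C}
    (hT : ∀ o ∈ ops, ∀ a, KRel Eq ops' Set.univ S (T o a) (T' o a))
    {t t' : UMon m P} (h : URel R ⟨ops, E⟩ t t') :
    KRel R ops' {e | e ∈ E} S (X := P) (Coop.runTree T t) (Coop.runTree T' t') := by
  induction h with
  | @ret x x' h =>
    intro c
    refine .ret ?_
    obtain x | e := x <;> obtain x' | e' := x'
    · exact ⟨h, rfl⟩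
    · exact h
    · exact h
    · exact ⟨h.1, h.2, rfl⟩
  | node h _ _ ihκ ihν =>
    intro c
    simp only [Coop.runTree]
    refine Tree.Rel.bind ?_ (hT _ h _ c)
    rintro (⟨x | e, d⟩ | s) (⟨x' | e', d'⟩ | s') h
    · obtain ⟨rfl, rfl⟩ := h
      exact ihκ _ _
    · exact h.elim
    · exact h.elim
    · exact h.elim
    · obtain ⟨rfl, _, rfl⟩ := h
      exact ihν _ _
    · exact h.elim
    · exact h.elim
    · exact h.elim
    · exact .ret h

theorem KRel.restrictExc {o : L.Op} {i : P → OpRes m o} (hi : ∀ x x', R x x' → i x = i x')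
    {k k' : KMon m L.Exc C P} (h : KRel R ops {e | e ∈ L.opExc o} S k k') :
    KRel Eq ops Set.univ S (Coop.restrictExc o i k) (Coop.restrictExc o i k') := by
  intro c
  refine Tree.Rel.bind ?_ (h c)
  rintro (⟨x | e, d⟩ | s) (⟨x' | e', d'⟩ | s') h
  · exact .ret ⟨hi _ _ h.1, h.2⟩
  · exact h.elim
  · exact h.elim
  · exact h.elim
  · obtain ⟨rfl, h, rfl⟩ := h
    simp only [clause_of_mem _ _ (show e ∈ L.opExc o from h)]
    exact .ret ⟨rfl, trivial, rfl⟩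
  · exact h.elim
  · exact h.elim
  · exact h.elim
  · exact .ret h

end Operators

end Lifting

/-! ## A logical relation

For `s = False` the relation is hereditary equality; for `s = True` it is equality on the
refinement subset. -/

section LogicalRelation

variable (m : Model L) (s : Prop)

/-- Hereditary equality at a value type, where functions and runners are moreover required to be
equal if `s` holds. -/
def VTy.logRel : (X : VTy L) → X.skel.den m → X.skel.den m → Prop
  | .base b => fun x x' : m.base b => x = x'
  | .unit => fun x x' : PUnit => x = x'
  | .empty => fun x x' : PEmpty => x = x'
  | .prod X Y => fun p p' : X.skel.den m × Y.skel.den m =>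
      X.logRel p.1 p'.1 ∧ Y.logRel p.2 p'.2
  | .sum X Y => Sum.LiftRel X.logRel Y.logRel
  | .ufun X Y U => fun f f' : X.skel.den m → UMon m (Y.skel.den m) =>
      (s → f = f') ∧ ∀ x x', X.logRel x x' → URel Y.logRel U (f x) (f' x')
  | .kfun X Y K => fun f f' : X.skel.den m → KMon m L.Exc (K.st.den m.base) (Y.skel.den m) =>
      (s → f = f') ∧
        ∀ x x', X.logRel x x' → KRel Y.logRel K.ops {e | e ∈ K.exc} K.sgn (f x) (f' x')
  | .runner ops ops' S C => fun R R' : RunnerSk m (C.den m.base) =>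
      (s → R = R') ∧ ∀ o ∈ ops, ∀ a, KRel Eq ops' Set.univ S (R o a) (R' o a)

/-- The logical relation on environments. -/
def CtxLogRel : (Γ : List (VTy L)) → Env m (skelCtx Γ) → Env m (skelCtx Γ) → Prop
  | [] => fun _ _ => True
  | X :: Γ => fun γ γ' : X.skel.den m × Env m (skelCtx Γ) =>
      X.logRel m s γ.1 γ'.1 ∧ CtxLogRel Γ γ.2 γ'.2

variable {m s}

theorem VTy.logRel_eq (hs : s) : {X : VTy L} → {x x' : X.skel.den m} → X.logRel m s x x' → x = x'
  | .base _, _, _, h => h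
  | .unit, _, _, h => h
  | .empty, _, _, h => h
  | .prod _ _, _, _, h => Prod.ext (logRel_eq hs h.1) (logRel_eq hs h.2)
  | .sum _ _, _, _, .inl h => congrArg _ (logRel_eq hs h)
  | .sum _ _, _, _, .inr h => congrArg _ (logRel_eq hs h)
  | .ufun _ _ _, _, _, h => h.1 hs
  | .kfun _ _ _, _, _, h => h.1 hs
  | .runner _ _ _ _, _, _, h => h.1 hs

theorem VTy.logRel_symm : {X : VTy L} → {x x' : X.skel.den m} →
    X.logRel m s x x' → X.logRel m s x' x
  | .base _, _, _, h => Eq.symm h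
  | .unit, _, _, h => Eq.symm h
  | .empty, _, _, h => Eq.symm h
  | .prod _ _, _, _, h => ⟨logRel_symm h.1, logRel_symm h.2⟩
  | .sum _ _, _, _, .inl h => .inl (logRel_symm h)
  | .sum _ _, _, _, .inr h => .inr (logRel_symm h)
  | .ufun _ _ _, _, _, h => ⟨fun hs => (h.1 hs).symm,
      fun _ _ hx => (h.2 _ _ (logRel_symm hx)).symm fun _ _ => logRel_symm⟩
  | .kfun _ _ _, _, _, h => ⟨fun hs => (h.1 hs).symm,
      fun _ _ hx => (h.2 _ _ (logRel_symm hx)).symm fun _ _ => logRel_symm⟩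
  | .runner _ _ _ _, _, _, h => ⟨fun hs => (h.1 hs).symm,
      fun o ho a => (h.2 o ho a).symm fun _ _ => Eq.symm⟩

theorem VTy.logRel_trans : {X : VTy L} → {x x' x'' : X.skel.den m} →
    X.logRel m s x x' → X.logRel m s x' x'' → X.logRel m s x x''
  | .base _, _, _, _, h, h' => Eq.trans h h'
  | .unit, _, _, _, h, h' => Eq.trans h h'
  | .empty, _, _, _, h, h' => Eq.trans h h'
  | .prod _ _, _, _, _, h, h' => ⟨logRel_trans h.1 h'.1, logRel_trans h.2 h'.2⟩
  | .sum _ _, _, _, _, .inl h, .inl h' => .inl (logRel_trans h h')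
  | .sum _ _, _, _, _, .inr h, .inr h' => .inr (logRel_trans h h')
  | .ufun _ _ _, _, _, _, h, h' => ⟨fun hs => (h.1 hs).trans (h'.1 hs), fun _ _ hx =>
      (h.2 _ _ hx).trans (fun _ _ _ => logRel_trans)
        (h'.2 _ _ (logRel_trans (logRel_symm hx) hx))⟩
  | .kfun _ _ _, _, _, _, h, h' => ⟨fun hs => (h.1 hs).trans (h'.1 hs), fun _ _ hx =>
      (h.2 _ _ hx).trans (fun _ _ _ => logRel_trans)
        (h'.2 _ _ (logRel_trans (logRel_symm hx) hx))⟩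
  | .runner _ _ _ _, _, _, _, h, h' => ⟨fun hs => (h.1 hs).trans (h'.1 hs),
      fun o ho a => (h.2 o ho a).trans (R := Eq) (fun _ _ _ => Eq.trans) (h'.2 o ho a)⟩

theorem GTy.logRel_iff : {A : GTy L.Base} → {x x' : A.toS.den m} →
    A.toV.logRel m s x x' ↔ x = x'
  | .base _, _, _ => Iff.rfl
  | .unit, _, _ => Iff.rfl
  | .empty, _, _ => Iff.rfl
  | .prod _ _, _, _ => (and_congr GTy.logRel_iff GTy.logRel_iff).trans Prod.ext_iff.symm
  | .sum A B, x, x' => by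
      constructor
      · intro h
        cases h with
        | inl h => exact congrArg _ (GTy.logRel_iff.1 h)
        | inr h => exact congrArg _ (GTy.logRel_iff.1 h)
      · rintro rfl
        cases x with
        | inl x => exact .inl (GTy.logRel_iff.2 rfl)
        | inr x => exact .inr (GTy.logRel_iff.2 rfl)

theorem CtxLogRel.eq (hs : s) : {Γ : List (VTy L)} → {γ γ' : Env m (skelCtx Γ)} →
    CtxLogRel m s Γ γ γ' → γ = γ'
  | [], _, _, _ => rfl
  | _ :: _, _, _, h => Prod.ext (VTy.logRel_eq hs h.1) (CtxLogRel.eq hs h.2)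

theorem CtxLogRel.symm : {Γ : List (VTy L)} → {γ γ' : Env m (skelCtx Γ)} →
    CtxLogRel m s Γ γ γ' → CtxLogRel m s Γ γ' γ
  | [], _, _, _ => trivial
  | _ :: _, _, _, h => ⟨VTy.logRel_symm h.1, CtxLogRel.symm h.2⟩

theorem CtxLogRel.trans : {Γ : List (VTy L)} → {γ γ' γ'' : Env m (skelCtx Γ)} →
    CtxLogRel m s Γ γ γ' → CtxLogRel m s Γ γ' γ'' → CtxLogRel m s Γ γ γ''
  | [], _, _, _, _, _ => trivial
  | _ :: _, _, _, _, h, h' => ⟨VTy.logRel_trans h.1 h'.1, CtxLogRel.trans h.2 h'.2⟩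

theorem CtxLogRel.left {Γ : List (VTy L)} {γ γ' : Env m (skelCtx Γ)}
    (h : CtxLogRel m s Γ γ γ') : CtxLogRel m s Γ γ γ := h.trans h.symm

/-! ### Instances -/

theorem VTy.logRel_false : (X : VTy L) → X.logRel m False = X.rel m
  | .base _ => rfl
  | .unit => rfl
  | .empty => rfl
  | .prod X Y => by
      simp only [VTy.logRel, VTy.rel, logRel_false]
  | .sum X Y => by
      simp only [VTy.logRel, VTy.rel, logRel_false]
  | .ufun X Y U => by
      simp only [VTy.logRel, VTy.rel, logRel_false, false_imp_iff, true_and]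
  | .kfun X Y K => by
      simp only [VTy.logRel, VTy.rel, logRel_false, false_imp_iff, true_and]
  | .runner _ _ _ _ => by
      simp only [VTy.logRel, VTy.rel, false_imp_iff, true_and]

theorem CtxLogRel.false_iff : {Γ : List (VTy L)} → {γ γ' : Env m (skelCtx Γ)} →
    CtxLogRel m False Γ γ γ' ↔ CtxRel m Γ γ γ'
  | [], _, _ => Iff.rfl
  | X :: _, _, _ => and_congr (by rw [VTy.logRel_false]) CtxLogRel.false_iff

theorem VTy.logRel_true : {X : VTy L} → {x x' : X.skel.den m} →
    X.logRel m True x x' ↔ x = x' ∧ x ∈ X.ref m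
  | .base _, _, _ => ⟨fun h => ⟨h, trivial⟩, And.left⟩
  | .unit, _, _ => ⟨fun h => ⟨h, trivial⟩, And.left⟩
  | .empty, _, _ => ⟨fun h => ⟨h, trivial⟩, And.left⟩
  | .prod _ _, _, _ => by
      constructor
      · intro h
        have h₁ := logRel_true.1 h.1
        have h₂ := logRel_true.1 h.2
        exact ⟨Prod.ext h₁.1 h₂.1, h₁.2, h₂.2⟩
      · rintro ⟨rfl, h⟩
        exact ⟨logRel_true.2 ⟨rfl, h.1⟩, logRel_true.2 ⟨rfl, h.2⟩⟩
  | .sum _ _, x, _ => by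
      constructor
      · intro h
        cases h with
        | inl h =>
          have h := logRel_true.1 h
          exact ⟨congrArg _ h.1, h.2⟩
        | inr h =>
          have h := logRel_true.1 h
          exact ⟨congrArg _ h.1, h.2⟩
      · rintro ⟨rfl, h⟩
        cases x with
        | inl x => exact .inl (logRel_true.2 ⟨rfl, h⟩)
        | inr x => exact .inr (logRel_true.2 ⟨rfl, h⟩)
  | .ufun _ _ _, f, f' => by
      constructor
      · intro h
        exact ⟨h.1 trivial, fun x hx =>
          ((URel.iff_ref fun _ _ => logRel_true).1 (h.2 x x (logRel_true.2 ⟨rfl, hx⟩))).2⟩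
      · rintro ⟨rfl, h⟩
        refine ⟨fun _ => rfl, fun x x' hx => ?_⟩
        obtain ⟨rfl, hx'⟩ := logRel_true.1 hx
        exact (URel.iff_ref fun _ _ => logRel_true).2 ⟨rfl, h x hx'⟩
  | .kfun _ _ _, f, f' => by
      constructor
      · intro h
        exact ⟨h.1 trivial, fun x hx =>
          ((KRel.iff_ref fun _ _ => logRel_true).1 (h.2 x x (logRel_true.2 ⟨rfl, hx⟩))).2⟩
      · rintro ⟨rfl, h⟩
        refine ⟨fun _ => rfl, fun x x' hx => ?_⟩
        obtain ⟨rfl, hx'⟩ := logRel_true.1 hx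
        exact (KRel.iff_ref fun _ _ => logRel_true).2 ⟨rfl, h x hx'⟩
  | .runner _ _ _ _, _, _ => by
      have hR : ∀ {X : Type u} (x x' : X), x = x' ↔ x = x' ∧ x ∈ Set.univ :=
        fun _ _ => ⟨fun h => ⟨h, trivial⟩, And.left⟩
      constructor
      · intro h
        exact ⟨h.1 trivial, fun o ho a => ((KRel.iff_ref hR).1 (h.2 o ho a)).2⟩
      · rintro ⟨rfl, h⟩
        exact ⟨fun _ => rfl, fun o ho a => (KRel.iff_ref hR).2 ⟨rfl, h o ho a⟩⟩

theorem CtxLogRel.true_of_mem : {Γ : List (VTy L)} → {γ : Env m (skelCtx Γ)} →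
    γ ∈ CtxRef m Γ → CtxLogRel m True Γ γ γ
  | [], _, _ => trivial
  | _ :: _, _, h => ⟨VTy.logRel_true.2 ⟨rfl, h.1⟩, CtxLogRel.true_of_mem h.2⟩

/-! ### Subtyping -/

theorem URel.heq {X X' : Type u} (hX : X = X') {R : X → X → Prop} {R' : X' → X' → Prop}
    (hR : ∀ {x x' y y'}, x ≍ y → x' ≍ y' → R x x' → R' y y') {U U' : UEff L}
    (ho : U.ops ⊆ U'.ops) (he : U.exc ⊆ U'.exc) {t t' : UMon m X} {u u' : UMon m X'}
    (ht : t ≍ u) (ht' : t' ≍ u') (h : URel R U t t') : URel R' U' u u' := by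
  subst hX
  cases ht
  cases ht'
  exact h.mono (fun _ _ => hR .rfl .rfl) ho he

theorem KRel.heq {E C C' X X' : Type u} (hC : C = C') (hX : X = X') {R : X → X → Prop}
    {R' : X' → X' → Prop} (hR : ∀ {x x' y y'}, x ≍ y → x' ≍ y' → R x x' → R' y y')
    {ops ops' : Finset L.Op} {E₀ E₀' : Set E} {S S' : Finset L.Sgn}
    (ho : ops ⊆ ops') (he : E₀ ⊆ E₀') (hs : S ⊆ S') {k k' : KMon m E C X} {l l' : KMon m E C' X'}
    (hk : k ≍ l) (hk' : k' ≍ l') (h : KRel R ops E₀ S k k') : KRel R' ops' E₀' S' l l' := by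
  subst hC hX
  cases hk
  cases hk'
  exact h.mono (fun _ _ => hR .rfl .rfl) ho he hs

theorem prod_heq {A A' B B' : Type u} (hA : A = A') (hB : B = B') {RA : A → A → Prop}
    {RA' : A' → A' → Prop} {RB : B → B → Prop} {RB' : B' → B' → Prop}
    (hRA : ∀ {x x' y y'}, x ≍ y → x' ≍ y' → RA x x' → RA' y y')
    (hRB : ∀ {x x' y y'}, x ≍ y → x' ≍ y' → RB x x' → RB' y y')
    {p p' : A × B} {q q' : A' × B'} (hp : p ≍ q) (hp' : p' ≍ q')
    (h : RA p.1 p'.1 ∧ RB p.2 p'.2) : RA' q.1 q'.1 ∧ RB' q.2 q'.2 := by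
  subst hA hB
  cases hp
  cases hp'
  exact ⟨hRA .rfl .rfl h.1, hRB .rfl .rfl h.2⟩

theorem sum_heq {A A' B B' : Type u} (hA : A = A') (hB : B = B') {RA : A → A → Prop}
    {RA' : A' → A' → Prop} {RB : B → B → Prop} {RB' : B' → B' → Prop}
    (hRA : ∀ {x x' y y'}, x ≍ y → x' ≍ y' → RA x x' → RA' y y')
    (hRB : ∀ {x x' y y'}, x ≍ y → x' ≍ y' → RB x x' → RB' y y')
    {p p' : A ⊕ B} {q q' : A' ⊕ B'} (hp : p ≍ q) (hp' : p' ≍ q')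
    (h : Sum.LiftRel RA RB p p') : Sum.LiftRel RA' RB' q q' := by
  subst hA hB
  cases hp
  cases hp'
  exact h.mono (fun _ _ => hRA .rfl .rfl) (fun _ _ => hRB .rfl .rfl)

theorem fun_heq {A A' B B' : Type u} (hA : A = A') (hB : B = B') {RA : A → A → Prop}
    {RA' : A' → A' → Prop} {RB : B → B → Prop} {RB' : B' → B' → Prop}
    (hRA : ∀ {x x' y y'}, x ≍ y → x' ≍ y' → RA' x x' → RA y y')
    (hRB : ∀ {x x' y y'}, x ≍ y → x' ≍ y' → RB x x' → RB' y y')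
    {f f' : A → B} {g g' : A' → B'} (hf : f ≍ g) (hf' : f' ≍ g')
    (h : (s → f = f') ∧ ∀ x x', RA x x' → RB (f x) (f' x')) :
    (s → g = g') ∧ ∀ x x', RA' x x' → RB' (g x) (g' x') := by
  subst hA hB
  cases hf
  cases hf'
  exact ⟨h.1, fun x x' hx => hRB .rfl .rfl (h.2 _ _ (hRA .rfl .rfl hx))⟩

theorem Sub.den_eq {X X' : VTy L} (h : Sub X X') : X.skel.den m = X'.skel.den m :=
  congrArg _ h.skel_eq

theorem Sub.logRel {X X' : VTy L} (h : Sub X X') {x x' : X.skel.den m} {y y' : X'.skel.den m} :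
    x ≍ y → x' ≍ y' → X.logRel m s x x' → X'.logRel m s y y' := by
  induction h with
  | ground =>
    rintro ⟨⟩ ⟨⟩ h
    exact h
  | prod h h' ih ih' => exact prod_heq h.den_eq h'.den_eq ih ih'
  | sum h h' ih ih' => exact sum_heq h.den_eq h'.den_eq ih ih'
  | ufun h h' ho he ih ih' =>
    exact fun_heq h.den_eq.symm (congrArg (UMon m) h'.den_eq) ih
      (URel.heq h'.den_eq ih' ho he)
  | kfun h h' ho he hs hst ih ih' =>
    exact fun_heq h.den_eq.symm (by rw [h'.den_eq, hst]) ih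
      (KRel.heq (by rw [hst]) h'.den_eq ih' ho he hs)
  | runner ho ho' hs hC =>
    subst hC
    rintro ⟨⟩ ⟨⟩ h
    exact ⟨h.1, fun o hmem a => (h.2 o (ho hmem) a).mono (fun _ _ => id) ho' subset_rfl hs⟩

end LogicalRelation

/-! ## Compatibility of the logical relation with the term formers -/

section Compatibility

variable (m : Model L) (s : Prop)

/-- The meanings of the values `V` and `W` are logically related. -/
def LogRelV (Γ : List (VTy L)) (V W : Val L) (X : VTy L) : Prop :=
  ∃ (d : SkV (skelCtx Γ) V X.skel) (d' : SkV (skelCtx Γ) W X.skel),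
    ∀ γ γ', CtxLogRel m s Γ γ γ' → X.logRel m s (d.den γ) (d'.den γ')

/-- The meanings of the user computations `M` and `N` are logically related. -/
def LogRelU (Γ : List (VTy L)) (M N : UTm L) (X : VTy L) (U : UEff L) : Prop :=
  ∃ (d : SkU (skelCtx Γ) M X.skel) (d' : SkU (skelCtx Γ) N X.skel),
    ∀ γ γ', CtxLogRel m s Γ γ γ' → URel (X.logRel m s) U (d.den γ) (d'.den γ')

/-- The meanings of the kernel computations `K` and `N` are logically related. -/
def LogRelK (Γ : List (VTy L)) (K N : KTm L) (X : VTy L) (E : KEff L) : Prop :=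
  ∃ (d : SkK (skelCtx Γ) K X.skel E.st) (d' : SkK (skelCtx Γ) N X.skel E.st),
    ∀ γ γ', CtxLogRel m s Γ γ γ' →
      KRel (X.logRel m s) E.ops {e | e ∈ E.exc} E.sgn (d.den γ) (d'.den γ')

variable {m s}

theorem SkV.exists_heq {Γ : List (STy L)} {V : Val L} {P P' : STy L} (h : P = P')
    (d : SkV Γ V P) : ∃ d' : SkV Γ V P', ∀ γ : Env m Γ, d.den γ ≍ d'.den γ := by
  subst h
  exact ⟨d, fun _ => .rfl⟩

theorem SkU.exists_heq {Γ : List (STy L)} {M : UTm L} {P P' : STy L} (h : P = P')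
    (d : SkU Γ M P) : ∃ d' : SkU Γ M P', ∀ γ : Env m Γ, d.den γ ≍ d'.den γ := by
  subst h
  exact ⟨d, fun _ => .rfl⟩

theorem SkK.exists_heq {Γ : List (STy L)} {K : KTm L} {P P' : STy L} {C C' : GTy L.Base}
    (h : P = P') (hC : C = C') (d : SkK Γ K P C) :
    ∃ d' : SkK Γ K P' C', ∀ γ : Env m Γ, d.den γ ≍ d'.den γ := by
  subst h hC
  exact ⟨d, fun _ => .rfl⟩

theorem sumElim_of_liftRel {A B T : Type u} {R : A → A → Prop} {R' : B → B → Prop}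
    {Q : T → T → Prop} {f f' : A → T} {g g' : B → T} {p p' : A ⊕ B} (h : Sum.LiftRel R R' p p')
    (hf : ∀ x x', R x x' → Q (f x) (f' x')) (hg : ∀ x x', R' x x' → Q (g x) (g' x')) :
    Q (Sum.elim f g p) (Sum.elim f' g' p') := by
  cases h with
  | inl h => exact hf _ _ h
  | inr h => exact hg _ _ h

theorem Lookup.logRel : {Γ : List (VTy L)} → {i : ℕ} → {X : VTy L} → (h : Lookup Γ i X) →
    ∀ γ γ', CtxLogRel m s Γ γ γ' → X.logRel m s (h.skel.den γ) (h.skel.den γ')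
  | _, _, _, .zero, _, _, hγ => hγ.1
  | _, _, _, .succ h, _, _, hγ => h.logRel _ _ hγ.2

theorem CtxLogRel.cons_ground {Γ : List (VTy L)} {γ γ' : Env m (skelCtx Γ)}
    (h : CtxLogRel m s Γ γ γ') {A : GTy L.Base} (a : A.toS.den m) :
    CtxLogRel m s (A.toV :: Γ) (a, γ) (a, γ') :=
  ⟨GTy.logRel_iff.2 rfl, h⟩

namespace LogRelV

variable {Γ : List (VTy L)} {V V' W W' : Val L} {X Y : VTy L}

theorem symm (h : LogRelV m s Γ V W X) : LogRelV m s Γ W V X := by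
  obtain ⟨d, d', e⟩ := h
  exact ⟨d', d, fun γ γ' hγ => VTy.logRel_symm (e _ _ hγ.symm)⟩

theorem trans (h : LogRelV m s Γ V V' X) (h' : LogRelV m s Γ V' W X) : LogRelV m s Γ V W X := by
  obtain ⟨d, d₁, e⟩ := h
  obtain ⟨d₂, d', e'⟩ := h'
  cases d₁.unique d₂
  exact ⟨d, d', fun γ γ' hγ => VTy.logRel_trans (e _ _ hγ.left) (e' _ _ hγ)⟩

theorem subsume (h : LogRelV m s Γ V W X) (hs : Sub X Y) : LogRelV m s Γ V W Y := by
  obtain ⟨d, d', e⟩ := h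
  obtain ⟨f, hf⟩ := d.exists_heq (m := m) hs.skel_eq
  obtain ⟨f', hf'⟩ := d'.exists_heq (m := m) hs.skel_eq
  exact ⟨f, f', fun γ γ' hγ => hs.logRel (hf γ) (hf' γ') (e _ _ hγ)⟩

theorem congr_right (h : LogRelV m s Γ V V X)
    (h' : DenEqV m (skelCtx Γ) V W X.skel) : LogRelV m s Γ V W X := by
  obtain ⟨d, d₁, e⟩ := h
  obtain ⟨d₂, d', e'⟩ := h'
  cases d₁.unique d₂
  exact ⟨d, d', fun γ γ' hγ => e' γ' ▸ e _ _ hγ⟩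

theorem unitEta (h : LogRelV m s Γ V V .unit) : LogRelV m s Γ V .unit .unit := by
  obtain ⟨d, -, -⟩ := h
  exact ⟨d, .unit, fun _ _ _ => rfl⟩

theorem const {f : L.Const} {Vs Vs' : Fin (L.arity f) → Val L}
    (h : ∀ i, LogRelV m s Γ (Vs i) (Vs' i) (L.argTy f i).toV) :
    LogRelV m s Γ (.const f Vs) (.const f Vs') (L.resTy f).toV := by
  choose d d' e using h
  refine ⟨.const d rfl, .const d' rfl, fun γ γ' hγ => GTy.logRel_iff.2 ?_⟩
  simp only [SkV.den, fun i => GTy.logRel_iff.1 (e i γ γ' hγ)]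

theorem unit : LogRelV m s Γ .unit .unit .unit :=
  ⟨.unit, .unit, fun _ _ _ => rfl⟩

theorem pair (h : LogRelV m s Γ V V' X) (k : LogRelV m s Γ W W' Y) :
    LogRelV m s Γ (.pair V W) (.pair V' W') (.prod X Y) := by
  obtain ⟨d, d', e⟩ := h
  obtain ⟨f, f', e'⟩ := k
  exact ⟨.pair d f, .pair d' f', fun γ γ' hγ => ⟨e _ _ hγ, e' _ _ hγ⟩⟩

theorem inl (h : LogRelV m s Γ V V' X) :
    LogRelV m s Γ (.inl X Y V) (.inl X Y V') (.sum X Y) := by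
  obtain ⟨d, d', e⟩ := h
  exact ⟨.inl d rfl rfl, .inl d' rfl rfl, fun γ γ' hγ => .inl (e _ _ hγ)⟩

theorem inr (h : LogRelV m s Γ V V' Y) :
    LogRelV m s Γ (.inr X Y V) (.inr X Y V') (.sum X Y) := by
  obtain ⟨d, d', e⟩ := h
  exact ⟨.inr d rfl rfl, .inr d' rfl rfl, fun γ γ' hγ => .inr (e _ _ hγ)⟩

theorem ufun {M M' : UTm L} {U : UEff L} (h : LogRelU m s (X :: Γ) M M' Y U)
    (hs : s → DenEqU m (skelCtx (X :: Γ)) M M' Y.skel) :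
    LogRelV m s Γ (.ufun X M) (.ufun X M') (.ufun X Y U) := by
  obtain ⟨d, d', e⟩ := h
  refine ⟨.ufun d rfl, .ufun d' rfl, fun γ γ' hγ => ⟨fun hs' => ?_, fun x x' hx =>
    e (x, γ) (x', γ') ⟨hx, hγ⟩⟩⟩
  obtain ⟨d₁, d₁', e'⟩ := hs hs'
  cases d.unique d₁
  cases d'.unique d₁'
  cases hγ.eq hs'
  exact funext fun x => e' (x, γ)

theorem kfun {K K' : KTm L} {E : KEff L} (h : LogRelK m s (X :: Γ) K K' Y E)
    (hs : s → DenEqK m (skelCtx (X :: Γ)) K K' Y.skel E.st) :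
    LogRelV m s Γ (.kfun X K) (.kfun X K') (.kfun X Y E) := by
  obtain ⟨d, d', e⟩ := h
  refine ⟨.kfun d rfl, .kfun d' rfl, fun γ γ' hγ => ⟨fun hs' => ?_, fun x x' hx =>
    e (x, γ) (x', γ') ⟨hx, hγ⟩⟩⟩
  obtain ⟨d₁, d₁', e'⟩ := hs hs'
  cases d.unique d₁
  cases d'.unique d₁'
  cases hγ.eq hs'
  exact funext fun x => e' (x, γ)

theorem runner {ops ops' : Finset L.Op} {S : Finset L.Sgn} {C : GTy L.Base}
    {Ks Ks' : {o : L.Op // o ∈ ops} → KTm L}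
    (h : ∀ o : {o : L.Op // o ∈ ops}, LogRelK m s ((L.opPar o).toV :: Γ) (Ks o) (Ks' o)
      (L.opRes o).toV ⟨ops', L.opExc o, S, C⟩) :
    LogRelV m s Γ (.runner ops Ks C) (.runner ops Ks' C) (.runner ops ops' S C) := by
  choose d d' e using h
  have key : ∀ γ γ', CtxLogRel m s Γ γ γ' → ∀ o ∈ ops, ∀ a,
      KRel Eq ops' Set.univ S ((SkV.runner d).den γ o a) ((SkV.runner d').den γ' o a) := by
    intro γ γ' hγ o ho a
    simp only [SkV.den, mkRunner_coe _ ⟨o, ho⟩]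
    exact KRel.restrictExc (fun _ _ hx => congrArg _ (GTy.logRel_iff.1 hx))
      (e ⟨o, ho⟩ _ _ (hγ.cons_ground _))
  refine ⟨.runner d, .runner d', fun γ γ' hγ => ⟨fun _ => ?_, key γ γ' hγ⟩⟩
  funext o a
  by_cases ho : o ∈ ops
  · exact (key γ γ' hγ o ho a).eq fun _ _ => id
  · simp only [SkV.den, mkRunner_of_notMem _ ho]

end LogRelV

namespace LogRelU

variable {Γ : List (VTy L)} {V V' W W' : Val L} {M M' M'' N N' : UTm L} {X Y Z : VTy L}
  {U U' : UEff L}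

theorem symm (h : LogRelU m s Γ M N X U) : LogRelU m s Γ N M X U := by
  obtain ⟨d, d', e⟩ := h
  exact ⟨d', d, fun γ γ' hγ => (e _ _ hγ.symm).symm fun _ _ => VTy.logRel_symm⟩

theorem trans (h : LogRelU m s Γ M M' X U) (h' : LogRelU m s Γ M' M'' X U) :
    LogRelU m s Γ M M'' X U := by
  obtain ⟨d, d₁, e⟩ := h
  obtain ⟨d₂, d', e'⟩ := h'
  cases d₁.unique d₂
  exact ⟨d, d', fun γ γ' hγ =>
    (e _ _ hγ.left).trans (fun _ _ _ => VTy.logRel_trans) (e' _ _ hγ)⟩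

theorem subsume (h : LogRelU m s Γ M N X U) (hs : SubU X U Y U') : LogRelU m s Γ M N Y U' := by
  obtain ⟨d, d', e⟩ := h
  obtain ⟨f, hf⟩ := d.exists_heq (m := m) hs.val.skel_eq
  obtain ⟨f', hf'⟩ := d'.exists_heq (m := m) hs.val.skel_eq
  exact ⟨f, f', fun γ γ' hγ =>
    (e _ _ hγ).heq hs.val.den_eq hs.val.logRel hs.ops hs.exc (hf γ) (hf' γ')⟩

theorem congr_right (h : LogRelU m s Γ M M X U)
    (h' : DenEqU m (skelCtx Γ) M N X.skel) : LogRelU m s Γ M N X U := by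
  obtain ⟨d, d₁, e⟩ := h
  obtain ⟨d₂, d', e'⟩ := h'
  cases d₁.unique d₂
  exact ⟨d, d', fun γ γ' hγ => e' γ' ▸ e _ _ hγ⟩

theorem ret (h : LogRelV m s Γ V V' X) : LogRelU m s Γ (.ret V) (.ret V') X U := by
  obtain ⟨d, d', e⟩ := h
  exact ⟨.ret d, .ret d', fun γ γ' hγ => .ret (e _ _ hγ)⟩

theorem app (h : LogRelV m s Γ V V' (.ufun X Y U)) (k : LogRelV m s Γ W W' X) :
    LogRelU m s Γ (.app V W) (.app V' W') Y U := by
  obtain ⟨d, d', e⟩ := h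
  obtain ⟨f, f', e'⟩ := k
  exact ⟨.app d f, .app d' f', fun γ γ' hγ => (e _ _ hγ).2 _ _ (e' _ _ hγ)⟩

theorem tryWith {ops : Finset L.Op} {E E' : Finset L.Exc}
    {Ne Ne' : {e : L.Exc // e ∈ E} → UTm L} (h : LogRelU m s Γ M M' X ⟨ops, E⟩)
    (hN : LogRelU m s (X :: Γ) N N' Y ⟨ops, E'⟩)
    (hE : ∀ e, LogRelU m s Γ (Ne e) (Ne' e) Y ⟨ops, E'⟩) :
    LogRelU m s Γ (.tryWith M N E Ne) (.tryWith M' N' E Ne') Y ⟨ops, E'⟩ := by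
  obtain ⟨d, d', e⟩ := h
  obtain ⟨dN, dN', eN⟩ := hN
  choose dE dE' eE using hE
  exact ⟨.tryWith d dN dE, .tryWith d' dN' dE', fun γ γ' hγ =>
    (e _ _ hγ).handleU (fun x x' hx => eN (x, γ) (x', γ') ⟨hx, hγ⟩) fun e => eE e _ _ hγ⟩

theorem matchPair (h : LogRelV m s Γ V V' (.prod X Y)) (hM : LogRelU m s (Y :: X :: Γ) M M' Z U) :
    LogRelU m s Γ (.matchPair V M) (.matchPair V' M') Z U := by
  obtain ⟨d, d', e⟩ := h
  obtain ⟨dM, dM', eM⟩ := hM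
  exact ⟨.matchPair d dM, .matchPair d' dM', fun γ γ' hγ =>
    eM (_, _, γ) (_, _, γ') ⟨(e _ _ hγ).2, (e _ _ hγ).1, hγ⟩⟩

theorem matchEmpty (h : LogRelV m s Γ V V' .empty) :
    LogRelU m s Γ (.matchEmpty Z V) (.matchEmpty Z V') Z U := by
  obtain ⟨d, d', e⟩ := h
  exact ⟨.matchEmpty d rfl, .matchEmpty d' rfl, fun γ γ' hγ => (d.den γ).elim⟩

theorem matchSum (h : LogRelV m s Γ V V' (.sum X Y)) (hM : LogRelU m s (X :: Γ) M M' Z U)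
    (hN : LogRelU m s (Y :: Γ) N N' Z U) :
    LogRelU m s Γ (.matchSum V M N) (.matchSum V' M' N') Z U := by
  obtain ⟨d, d', e⟩ := h
  obtain ⟨dM, dM', eM⟩ := hM
  obtain ⟨dN, dN', eN⟩ := hN
  exact ⟨.matchSum d dM dN, .matchSum d' dM' dN', fun γ γ' hγ =>
    sumElim_of_liftRel (e _ _ hγ) (fun x x' hx => eM (x, γ) (x', γ') ⟨hx, hγ⟩)
      fun x x' hx => eN (x, γ) (x', γ') ⟨hx, hγ⟩⟩

theorem op {o : L.Op} {Ne Ne' : L.OpExc o → UTm L} (ho : o ∈ U.ops)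
    (h : LogRelV m s Γ V V' (L.opPar o).toV)
    (hM : LogRelU m s ((L.opRes o).toV :: Γ) M M' X U)
    (hE : ∀ e, LogRelU m s Γ (Ne e) (Ne' e) X U) :
    LogRelU m s Γ (.op o X V M Ne) (.op o X V' M' Ne') X U := by
  obtain ⟨d, d', e⟩ := h
  obtain ⟨dM, dM', eM⟩ := hM
  choose dE dE' eE using hE
  refine ⟨.op d dM dE rfl, .op d' dM' dE' rfl, fun γ γ' hγ => ?_⟩
  simp only [SkU.den, GTy.logRel_iff.1 (e _ _ hγ)]
  exact .node ho (fun b => eM _ _ (hγ.cons_ground _)) fun e => eE e _ _ hγ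

theorem raise {e : L.Exc} (he : e ∈ U.exc) : LogRelU m s Γ (.raise X e) (.raise X e) X U :=
  ⟨.raise rfl, .raise rfl, fun _ _ _ => .ret ⟨rfl, he⟩⟩

theorem kernel {K K' : KTm L} {E E' : Finset L.Exc} {Ne Ne' : {e : L.Exc // e ∈ E} → UTm L}
    {S : Finset L.Sgn} {Ns Ns' : {s : L.Sgn // s ∈ S} → UTm L} {ops : Finset L.Op}
    {C : GTy L.Base} (hK : LogRelK m s Γ K K' X ⟨ops, E, S, C⟩) (hW : LogRelV m s Γ W W' C.toV)
    (hN : LogRelU m s (C.toV :: X :: Γ) N N' Y ⟨ops, E'⟩)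
    (hE : ∀ e, LogRelU m s (C.toV :: Γ) (Ne e) (Ne' e) Y ⟨ops, E'⟩)
    (hS : ∀ k, LogRelU m s Γ (Ns k) (Ns' k) Y ⟨ops, E'⟩) :
    LogRelU m s Γ (.kernel K W N E Ne S Ns) (.kernel K' W' N' E Ne' S Ns') Y ⟨ops, E'⟩ := by
  obtain ⟨dK, dK', eK⟩ := hK
  obtain ⟨dW, dW', eW⟩ := hW
  obtain ⟨dN, dN', eN⟩ := hN
  choose dE dE' eE using hE
  choose dS dS' eS using hS
  refine ⟨.kernel dK dW dN dE dS, .kernel dK' dW' dN' dE' dS', fun γ γ' hγ => ?_⟩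
  simp only [SkU.den, GTy.logRel_iff.1 (eW _ _ hγ)]
  exact KRel.finalise (eK _ _ hγ)
    (fun x x' c hx => eN (C.equiv m c, x, γ) (C.equiv m c, x', γ')
      ⟨GTy.logRel_iff.2 rfl, hx, hγ⟩)
    (fun e c => eE e _ _ (hγ.cons_ground (C.equiv m c))) (fun k => eS k _ _ hγ) _

theorem run {E E' : Finset L.Exc} {Ne Ne' : {e : L.Exc // e ∈ E} → UTm L}
    {S : Finset L.Sgn} {Ns Ns' : {s : L.Sgn // s ∈ S} → UTm L} {ops ops' : Finset L.Op}
    {C : GTy L.Base} (hV : LogRelV m s Γ V V' (.runner ops ops' S C))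
    (hW : LogRelV m s Γ W W' C.toV) (hM : LogRelU m s Γ M M' X ⟨ops, E⟩)
    (hN : LogRelU m s (C.toV :: X :: Γ) N N' Y ⟨ops', E'⟩)
    (hE : ∀ e, LogRelU m s (C.toV :: Γ) (Ne e) (Ne' e) Y ⟨ops', E'⟩)
    (hS : ∀ k, LogRelU m s Γ (Ns k) (Ns' k) Y ⟨ops', E'⟩) :
    LogRelU m s Γ (.run V W M N E Ne S Ns) (.run V' W' M' N' E Ne' S Ns') Y ⟨ops', E'⟩ := by
  obtain ⟨dV, dV', eV⟩ := hV
  obtain ⟨dW, dW', eW⟩ := hW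
  obtain ⟨dM, dM', eM⟩ := hM
  obtain ⟨dN, dN', eN⟩ := hN
  choose dE dE' eE using hE
  choose dS dS' eS using hS
  refine ⟨.run dV dW dM dN dE dS, .run dV' dW' dM' dN' dE' dS', fun γ γ' hγ => ?_⟩
  simp only [SkU.den, GTy.logRel_iff.1 (eW _ _ hγ)]
  exact ((eM _ _ hγ).runTree (eV _ _ hγ).2).finalise
    (fun x x' c hx => eN (C.equiv m c, x, γ) (C.equiv m c, x', γ')
      ⟨GTy.logRel_iff.2 rfl, hx, hγ⟩)
    (fun e c => eE e _ _ (hγ.cons_ground (C.equiv m c))) (fun k => eS k _ _ hγ) _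

end LogRelU

namespace LogRelK

variable {Γ : List (VTy L)} {V V' W W' : Val L} {K K' K'' N N' : KTm L} {X Y Z : VTy L}
  {F F' : KEff L} {ops : Finset L.Op} {E E' : Finset L.Exc} {S : Finset L.Sgn} {C : GTy L.Base}

theorem symm (h : LogRelK m s Γ K N X F) : LogRelK m s Γ N K X F := by
  obtain ⟨d, d', e⟩ := h
  exact ⟨d', d, fun γ γ' hγ => (e _ _ hγ.symm).symm fun _ _ => VTy.logRel_symm⟩

theorem trans (h : LogRelK m s Γ K K' X F) (h' : LogRelK m s Γ K' K'' X F) :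
    LogRelK m s Γ K K'' X F := by
  obtain ⟨d, d₁, e⟩ := h
  obtain ⟨d₂, d', e'⟩ := h'
  cases d₁.unique d₂
  exact ⟨d, d', fun γ γ' hγ =>
    (e _ _ hγ.left).trans (fun _ _ _ => VTy.logRel_trans) (e' _ _ hγ)⟩

theorem subsume (h : LogRelK m s Γ K N X F) (hs : SubK X F Y F') : LogRelK m s Γ K N Y F' := by
  obtain ⟨d, d', e⟩ := h
  obtain ⟨f, hf⟩ := d.exists_heq (m := m) hs.val.skel_eq hs.st
  obtain ⟨f', hf'⟩ := d'.exists_heq (m := m) hs.val.skel_eq hs.st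
  exact ⟨f, f', fun γ γ' hγ => (e _ _ hγ).heq (by rw [hs.st]) hs.val.den_eq hs.val.logRel
    hs.ops hs.exc hs.sgn (hf γ) (hf' γ')⟩

theorem congr_right (h : LogRelK m s Γ K K X F)
    (h' : DenEqK m (skelCtx Γ) K N X.skel F.st) : LogRelK m s Γ K N X F := by
  obtain ⟨d, d₁, e⟩ := h
  obtain ⟨d₂, d', e'⟩ := h'
  cases d₁.unique d₂
  exact ⟨d, d', fun γ γ' hγ => e' γ' ▸ e _ _ hγ⟩

theorem ret (h : LogRelV m s Γ V V' X) :
    LogRelK m s Γ (.ret C V) (.ret C V') X ⟨ops, E, S, C⟩ := by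
  obtain ⟨d, d', e⟩ := h
  exact ⟨.ret d, .ret d', fun γ γ' hγ _ => .ret ⟨e _ _ hγ, rfl⟩⟩

theorem app (h : LogRelV m s Γ V V' (.kfun X Y F)) (k : LogRelV m s Γ W W' X) :
    LogRelK m s Γ (.app V W) (.app V' W') Y F := by
  obtain ⟨d, d', e⟩ := h
  obtain ⟨f, f', e'⟩ := k
  exact ⟨.app d f, .app d' f', fun γ γ' hγ => (e _ _ hγ).2 _ _ (e' _ _ hγ)⟩

theorem tryWith {Ne Ne' : {e : L.Exc // e ∈ E} → KTm L}
    (h : LogRelK m s Γ K K' X ⟨ops, E, S, C⟩)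
    (hN : LogRelK m s (X :: Γ) N N' Y ⟨ops, E', S, C⟩)
    (hE : ∀ e, LogRelK m s Γ (Ne e) (Ne' e) Y ⟨ops, E', S, C⟩) :
    LogRelK m s Γ (.tryWith K N E Ne) (.tryWith K' N' E Ne') Y ⟨ops, E', S, C⟩ := by
  obtain ⟨d, d', e⟩ := h
  obtain ⟨dN, dN', eN⟩ := hN
  choose dE dE' eE using hE
  exact ⟨.tryWith d dN dE, .tryWith d' dN' dE', fun γ γ' hγ =>
    (e _ _ hγ).handleK (fun x x' hx => eN (x, γ) (x', γ') ⟨hx, hγ⟩) fun e => eE e _ _ hγ⟩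

theorem matchPair (h : LogRelV m s Γ V V' (.prod X Y)) (hK : LogRelK m s (Y :: X :: Γ) K K' Z F) :
    LogRelK m s Γ (.matchPair V K) (.matchPair V' K') Z F := by
  obtain ⟨d, d', e⟩ := h
  obtain ⟨dK, dK', eK⟩ := hK
  exact ⟨.matchPair d dK, .matchPair d' dK', fun γ γ' hγ =>
    eK (_, _, γ) (_, _, γ') ⟨(e _ _ hγ).2, (e _ _ hγ).1, hγ⟩⟩

theorem matchEmpty (h : LogRelV m s Γ V V' .empty) :
    LogRelK m s Γ (.matchEmpty Z C V) (.matchEmpty Z C V') Z ⟨ops, E, S, C⟩ := by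
  obtain ⟨d, d', e⟩ := h
  exact ⟨.matchEmpty d rfl, .matchEmpty d' rfl, fun γ γ' hγ => (d.den γ).elim⟩

theorem matchSum (h : LogRelV m s Γ V V' (.sum X Y)) (hK : LogRelK m s (X :: Γ) K K' Z F)
    (hN : LogRelK m s (Y :: Γ) N N' Z F) :
    LogRelK m s Γ (.matchSum V K N) (.matchSum V' K' N') Z F := by
  obtain ⟨d, d', e⟩ := h
  obtain ⟨dK, dK', eK⟩ := hK
  obtain ⟨dN, dN', eN⟩ := hN
  exact ⟨.matchSum d dK dN, .matchSum d' dK' dN', fun γ γ' hγ =>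
    sumElim_of_liftRel (e _ _ hγ) (fun x x' hx => eK (x, γ) (x', γ') ⟨hx, hγ⟩)
      fun x x' hx => eN (x, γ) (x', γ') ⟨hx, hγ⟩⟩

theorem op {o : L.Op} {Ne Ne' : L.OpExc o → KTm L} (ho : o ∈ F.ops)
    (h : LogRelV m s Γ V V' (L.opPar o).toV)
    (hK : LogRelK m s ((L.opRes o).toV :: Γ) K K' X F)
    (hE : ∀ e, LogRelK m s Γ (Ne e) (Ne' e) X F) :
    LogRelK m s Γ (.op o X V K Ne) (.op o X V' K' Ne') X F := by
  obtain ⟨d, d', e⟩ := h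
  obtain ⟨dK, dK', eK⟩ := hK
  choose dE dE' eE using hE
  refine ⟨.op d dK dE rfl, .op d' dK' dE' rfl, fun γ γ' hγ c => ?_⟩
  simp only [SkK.den, GTy.logRel_iff.1 (e _ _ hγ)]
  exact .node ho (fun b => eK _ _ (hγ.cons_ground _) c) fun e => eE e _ _ hγ c

theorem raise {e : L.Exc} (he : e ∈ E) :
    LogRelK m s Γ (.raise X C e) (.raise X C e) X ⟨ops, E, S, C⟩ :=
  ⟨.raise rfl, .raise rfl, fun _ _ _ _ => .ret ⟨rfl, he, rfl⟩⟩

theorem kill {k : L.Sgn} (hk : k ∈ S) :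
    LogRelK m s Γ (.kill X C k) (.kill X C k) X ⟨ops, E, S, C⟩ :=
  ⟨.kill rfl, .kill rfl, fun _ _ _ _ => .ret ⟨rfl, hk⟩⟩

theorem getenv (h : LogRelK m s (C.toV :: Γ) K K' X ⟨ops, E, S, C⟩) :
    LogRelK m s Γ (.getenv C K) (.getenv C K') X ⟨ops, E, S, C⟩ := by
  obtain ⟨d, d', e⟩ := h
  exact ⟨.getenv d, .getenv d', fun γ γ' hγ c => e _ _ (hγ.cons_ground _) c⟩

theorem setenv (h : LogRelV m s Γ V V' C.toV) (k : LogRelK m s Γ K K' X ⟨ops, E, S, C⟩) :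
    LogRelK m s Γ (.setenv V K) (.setenv V' K') X ⟨ops, E, S, C⟩ := by
  obtain ⟨d, d', e⟩ := h
  obtain ⟨f, f', e'⟩ := k
  refine ⟨.setenv d f, .setenv d' f', fun γ γ' hγ c => ?_⟩
  simp only [SkK.den, GTy.logRel_iff.1 (e _ _ hγ)]
  exact e' _ _ hγ _

theorem user {M M' : UTm L} {Ne Ne' : {e : L.Exc // e ∈ E} → KTm L}
    (h : LogRelU m s Γ M M' X ⟨ops, E⟩)
    (hN : LogRelK m s (X :: Γ) N N' Y ⟨ops, E', S, C⟩)
    (hE : ∀ e, LogRelK m s Γ (Ne e) (Ne' e) Y ⟨ops, E', S, C⟩) :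
    LogRelK m s Γ (.user M N E Ne) (.user M' N' E Ne') Y ⟨ops, E', S, C⟩ := by
  obtain ⟨d, d', e⟩ := h
  obtain ⟨dN, dN', eN⟩ := hN
  choose dE dE' eE using hE
  exact ⟨.user d dN dE, .user d' dN' dE', fun γ γ' hγ =>
    (e _ _ hγ).userK (fun x x' hx => eN (x, γ) (x', γ') ⟨hx, hγ⟩) fun e => eE e _ _ hγ⟩

end LogRelK

end Compatibility

/-! ## The fundamental lemma and soundness of the equational theory -/

section Soundness

variable (m : Model L) (s : Prop)

mutual

theorem HasV.logRel : {Γ : List (VTy L)} → {V : Val L} → {X : VTy L} →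
    HasV Γ V X → LogRelV m s Γ V V X
  | _, _, _, .var h => ⟨.var h.skel, .var h.skel, h.logRel⟩
  | _, _, _, .const h hX => hX ▸ LogRelV.const fun i => (h i).logRel
  | _, _, _, .unit => .unit
  | _, _, _, .pair h h' => .pair h.logRel h'.logRel
  | _, _, _, .inl h => .inl h.logRel
  | _, _, _, .inr h => .inr h.logRel
  | _, _, _, .ufun h => .ufun h.logRel fun _ => ⟨h.skel, h.skel, fun _ => rfl⟩
  | _, _, _, .kfun h => .kfun h.logRel fun _ => ⟨h.skel, h.skel, fun _ => rfl⟩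
  | _, _, _, .runner h => .runner fun o => (h o).logRel
  | _, _, _, .subsume h hs => h.logRel.subsume hs

theorem HasU.logRel : {Γ : List (VTy L)} → {M : UTm L} → {X : VTy L} → {U : UEff L} →
    HasU Γ M X U → LogRelU m s Γ M M X U
  | _, _, _, _, .ret h => .ret h.logRel
  | _, _, _, _, .app h h' => .app h.logRel h'.logRel
  | _, _, _, _, .tryWith h h' he => .tryWith h.logRel h'.logRel fun e => (he e).logRel
  | _, _, _, _, .matchPair h h' => .matchPair h.logRel h'.logRel
  | _, _, _, _, .matchEmpty h => .matchEmpty h.logRel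
  | _, _, _, _, .matchSum h h' h'' => .matchSum h.logRel h'.logRel h''.logRel
  | _, _, _, _, .op ho h h' he => .op ho h.logRel h'.logRel fun e => (he e).logRel
  | _, _, _, _, .raise he => .raise he
  | _, _, _, _, .run h h' hM hN he hs =>
      .run h.logRel h'.logRel hM.logRel hN.logRel (fun e => (he e).logRel) fun k => (hs k).logRel
  | _, _, _, _, .kernel h h' hN he hs =>
      .kernel h.logRel h'.logRel hN.logRel (fun e => (he e).logRel) fun k => (hs k).logRel
  | _, _, _, _, .subsume h hs => h.logRel.subsume hs

theorem HasK.logRel : {Γ : List (VTy L)} → {K : KTm L} → {X : VTy L} → {E : KEff L} →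
    HasK Γ K X E → LogRelK m s Γ K K X E
  | _, _, _, _, .ret h => .ret h.logRel
  | _, _, _, _, .app h h' => .app h.logRel h'.logRel
  | _, _, _, _, .tryWith h h' he => .tryWith h.logRel h'.logRel fun e => (he e).logRel
  | _, _, _, _, .matchPair h h' => .matchPair h.logRel h'.logRel
  | _, _, _, _, .matchEmpty h => .matchEmpty h.logRel
  | _, _, _, _, .matchSum h h' h'' => .matchSum h.logRel h'.logRel h''.logRel
  | _, _, _, _, .op ho h h' he => .op ho h.logRel h'.logRel fun e => (he e).logRel
  | _, _, _, _, .raise he => .raise he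
  | _, _, _, _, .kill hk => .kill hk
  | _, _, _, _, .getenv h => .getenv h.logRel
  | _, _, _, _, .setenv h h' => .setenv h.logRel h'.logRel
  | _, _, _, _, .user h h' he => .user h.logRel h'.logRel fun e => (he e).logRel
  | _, _, _, _, .subsume h hs => h.logRel.subsume hs

end

theorem HasU.tryWith_inv {Γ : List (VTy L)} {M N : UTm L} {E : Finset L.Exc}
    {Ne : {e : L.Exc // e ∈ E} → UTm L} : {Y : VTy L} → {U : UEff L} →
    HasU Γ (.tryWith M N E Ne) Y U → ∃ X ops, Nonempty (HasU Γ M X ⟨ops, E⟩)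
  | _, _, .tryWith h _ _ => ⟨_, _, ⟨h⟩⟩
  | _, _, .subsume h _ => h.tryWith_inv

theorem HasK.tryWith_inv {Γ : List (VTy L)} {K N : KTm L} {E : Finset L.Exc}
    {Ne : {e : L.Exc // e ∈ E} → KTm L} : {Y : VTy L} → {F : KEff L} →
    HasK Γ (.tryWith K N E Ne) Y F → ∃ X ops S C, Nonempty (HasK Γ K X ⟨ops, E, S, C⟩)
  | _, _, .tryWith h _ _ => ⟨_, _, _, _, ⟨h⟩⟩
  | _, _, .subsume h _ => h.tryWith_inv

variable {m s}

theorem URel.handleU_eta {P : Type u} {R : P → P → Prop} {ops : Finset L.Op} {E : Finset L.Exc}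
    {t t' : UMon m P} (h : URel R ⟨ops, E⟩ t t') :
    Coop.handleU (fun p => .ret (.inl p)) E (fun e => .ret (.inr e.1)) t = t := by
  refine Tree.Rel.bind_eq_self ?_ h
  rintro (x | e) (x' | e') h
  · rfl
  · exact h.elim
  · exact h.elim
  · exact clause_of_mem _ _ h.2

theorem KRel.handleK_eta {C P : Type u} {R : P → P → Prop} {ops : Finset L.Op}
    {E : Finset L.Exc} {S : Finset L.Sgn} {k k' : KMon m L.Exc C P}
    (h : KRel R ops {e | e ∈ E} S k k') :
    Coop.handleK (fun p c => .ret (.inl (.inl p, c))) E (fun e c => .ret (.inl (.inr e.1, c))) k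
      = k := by
  funext c
  refine Tree.Rel.bind_eq_self ?_ (h c)
  rintro (⟨x | e, d⟩ | s) (⟨x' | e', d'⟩ | s') h
  all_goals first
    | exact h.elim
    | rfl
    | simp only [clause_of_mem _ _ (show e ∈ E from h.2.1)]

theorem EtaU.logRel {Γ : List (VTy L)} {M N : UTm L} {X : VTy L} {U : UEff L} (h : EtaU M N)
    (D : HasU Γ M X U) (D' : HasU Γ N X U) : LogRelU m s Γ M N X U := by
  cases h with
  | tryEta _ E Z =>
  obtain ⟨X', ops, ⟨D₀⟩⟩ := D.tryWith_inv
  obtain ⟨d₀, d₀', e₀⟩ := D₀.logRel m s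
  have key : ∀ {P : STy L} (_ : X'.skel = P) (d : SkU (skelCtx Γ) N P) (γ γ'),
      CtxLogRel m s Γ γ γ' →
      handleU (fun p => .ret (.inl p)) E (fun e => .ret (.inr e.1)) (d.den γ) = d.den γ := by
    rintro P rfl d γ γ' hγ
    rw [d.unique d₀]
    exact (e₀ γ γ' hγ).handleU_eta
  obtain ⟨d, d', e⟩ := D'.logRel m s
  refine ⟨D.skel, d', fun γ γ' hγ => ?_⟩
  have : D.skel.den γ = d.den γ := by
    generalize D.skel = f
    cases f with
    | tryWith h hN hE =>
    cases hN with
    | ret hN =>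
    cases hN with
    | var hN =>
    cases hN
    rw [← key (d₀.type_unique d) d γ γ' hγ, h.unique d]
    simp only [SkU.den, SkV.den, Lookup.den]
    congr 1
    funext e
    cases hE e
    rfl
  rw [this]
  exact e γ γ' hγ

theorem EtaK.logRel {Γ : List (VTy L)} {K N : KTm L} {X : VTy L} {F : KEff L} (h : EtaK K N)
    (D : HasK Γ K X F) (D' : HasK Γ N X F) : LogRelK m s Γ K N X F := by
  cases h with
  | tryEta _ E Z C =>
  obtain ⟨X', ops, S, C', ⟨D₀⟩⟩ := D.tryWith_inv
  obtain ⟨d₀, d₀', e₀⟩ := D₀.logRel m s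
  have key : ∀ {P : STy L} {C₀ : GTy L.Base} (_ : X'.skel = P ∧ C' = C₀)
      (d : SkK (skelCtx Γ) N P C₀) (γ γ'), CtxLogRel m s Γ γ γ' →
      handleK (fun p c => .ret (.inl (.inl p, c))) E (fun e c => .ret (.inl (.inr e.1, c)))
        (d.den γ) = d.den γ := by
    rintro P C₀ ⟨rfl, rfl⟩ d γ γ' hγ
    rw [d.unique d₀]
    exact (e₀ γ γ' hγ).handleK_eta
  obtain ⟨d, d', e⟩ := D'.logRel m s
  refine ⟨D.skel, d', fun γ γ' hγ => ?_⟩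
  have : D.skel.den γ = d.den γ := by
    generalize D.skel = f
    cases F
    cases f with
    | tryWith h hN hE =>
    cases hN with
    | ret hN =>
    cases hN with
    | var hN =>
    cases hN
    rw [← key (d₀.type_unique d) d γ γ' hγ, h.unique d]
    simp only [SkK.den, SkV.den, Lookup.den]
    congr 1
    funext e
    cases hE e
    rfl
  rw [this]
  exact e γ γ' hγ

theorem Variant.body_ne_full {v : Variant} (hv : v ≠ .full) : v.body ≠ .full := by
  cases v <;> simp_all [Variant.body]

theorem Variant.body_eq_noTryEta {v : Variant} (hv : v ≠ .full) : v.body = .noTryEta := by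
  cases v <;> simp_all [Variant.body]

mutual

theorem EqV.logRel : {v : Variant} → {Γ : List (VTy L)} → {V W : Val L} → {X : VTy L} →
    EqV v Γ V W X → (s → v ≠ .full) → LogRelV m s Γ V W X
  | _, _, _, _, _, .refl D, _ => D.logRel m s
  | _, _, _, _, _, .symm h, hv => (h.logRel hv).symm
  | _, _, _, _, _, .trans h h', hv => (h.logRel hv).trans (h'.logRel hv)
  | _, _, _, _, _, .subsume h hs, hv => (h.logRel hv).subsume hs
  | _, _, _, _, _, .ax h D D', _ => (D.logRel m s).congr_right ⟨D.skel, D'.skel, h.den_eq _ _⟩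
  | _, _, _, _, _, .unitEta D, _ => (D.logRel m s).unitEta
  | _, _, _, _, _, .const h, hv => .const fun i => (h i).logRel hv
  | _, _, _, _, _, .pair h k, hv => .pair (h.logRel hv) (k.logRel hv)
  | _, _, _, _, _, .inl h, hv => .inl (h.logRel hv)
  | _, _, _, _, _, .inr h, hv => .inr (h.logRel hv)
  | _, _, _, _, _, .ufun h, hv => .ufun (h.logRel fun hs => Variant.body_ne_full (hv hs))
      fun hs => h.den_eq m (Variant.body_eq_noTryEta (hv hs))
  | _, _, _, _, _, .kfun h, hv => .kfun (h.logRel fun hs => Variant.body_ne_full (hv hs))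
      fun hs => h.den_eq m (Variant.body_eq_noTryEta (hv hs))
  | _, _, _, _, _, .runner h, hv => .runner fun o => (h o).logRel hv

theorem EqU.logRel : {v : Variant} → {Γ : List (VTy L)} → {M N : UTm L} → {X : VTy L} →
    {U : UEff L} → EqU v Γ M N X U → (s → v ≠ .full) → LogRelU m s Γ M N X U
  | _, _, _, _, _, _, .refl D, _ => D.logRel m s
  | _, _, _, _, _, _, .symm h, hv => (h.logRel hv).symm
  | _, _, _, _, _, _, .trans h h', hv => (h.logRel hv).trans (h'.logRel hv)
  | _, _, _, _, _, _, .subsume h hs, hv => (h.logRel hv).subsume hs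
  | _, _, _, _, _, _, .ax h D D', _ => (D.logRel m s).congr_right ⟨D.skel, D'.skel, h.den_eq _ _⟩
  | _, _, _, _, _, _, .eta _ h D D', _ => h.logRel D D'
  | _, _, _, _, _, _, .ret h, hv => .ret (h.logRel hv)
  | _, _, _, _, _, _, .app h k, hv => .app (h.logRel hv) (k.logRel hv)
  | _, _, _, _, _, _, .tryWith h hN hE, hv =>
      .tryWith (h.logRel hv) (hN.logRel hv) fun e => (hE e).logRel hv
  | _, _, _, _, _, _, .matchPair h hM, hv => .matchPair (h.logRel hv) (hM.logRel hv)
  | _, _, _, _, _, _, .matchEmpty h, hv => .matchEmpty (h.logRel hv)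
  | _, _, _, _, _, _, .matchSum h hM hN, hv =>
      .matchSum (h.logRel hv) (hM.logRel hv) (hN.logRel hv)
  | _, _, _, _, _, _, .op ho h hM hE, hv =>
      .op ho (h.logRel hv) (hM.logRel hv) fun e => (hE e).logRel hv
  | _, _, _, _, _, _, .run hV hW hM hN hE hS, hv =>
      .run (hV.logRel hv) (hW.logRel hv) (hM.logRel hv) (hN.logRel hv)
        (fun e => (hE e).logRel hv) fun k => (hS k).logRel hv
  | _, _, _, _, _, _, .kernel hK hW hN hE hS, hv =>
      .kernel (hK.logRel hv) (hW.logRel hv) (hN.logRel hv)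
        (fun e => (hE e).logRel hv) fun k => (hS k).logRel hv

theorem EqK.logRel : {v : Variant} → {Γ : List (VTy L)} → {K N : KTm L} → {X : VTy L} →
    {E : KEff L} → EqK v Γ K N X E → (s → v ≠ .full) → LogRelK m s Γ K N X E
  | _, _, _, _, _, _, .refl D, _ => D.logRel m s
  | _, _, _, _, _, _, .symm h, hv => (h.logRel hv).symm
  | _, _, _, _, _, _, .trans h h', hv => (h.logRel hv).trans (h'.logRel hv)
  | _, _, _, _, _, _, .subsume h hs, hv => (h.logRel hv).subsume hs
  | _, _, _, _, _, _, .ax h D D', _ => (D.logRel m s).congr_right ⟨D.skel, D'.skel, h.den_eq _ _⟩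
  | _, _, _, _, _, _, .eta _ h D D', _ => h.logRel D D'
  | _, _, _, _, _, _, .ret h, hv => .ret (h.logRel hv)
  | _, _, _, _, _, _, .app h k, hv => .app (h.logRel hv) (k.logRel hv)
  | _, _, _, _, _, _, .tryWith h hN hE, hv =>
      .tryWith (h.logRel hv) (hN.logRel hv) fun e => (hE e).logRel hv
  | _, _, _, _, _, _, .matchPair h hM, hv => .matchPair (h.logRel hv) (hM.logRel hv)
  | _, _, _, _, _, _, .matchEmpty h, hv => .matchEmpty (h.logRel hv)
  | _, _, _, _, _, _, .matchSum h hM hN, hv =>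
      .matchSum (h.logRel hv) (hM.logRel hv) (hN.logRel hv)
  | _, _, _, _, _, _, .op ho h hM hE, hv =>
      .op ho (h.logRel hv) (hM.logRel hv) fun e => (hE e).logRel hv
  | _, _, _, _, _, _, .getenv h, hv => .getenv (h.logRel hv)
  | _, _, _, _, _, _, .setenv h k, hv => .setenv (h.logRel hv) (k.logRel hv)
  | _, _, _, _, _, _, .user h hN hE, hv =>
      .user (h.logRel hv) (hN.logRel hv) fun e => (hE e).logRel hv

end

/-! ### Consequences for the meanings of derivations -/

theorem LogRelV.den {Γ : List (VTy L)} {V W : Val L} {X : VTy L} (h : LogRelV m s Γ V W X)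
    (D : HasV Γ V X) (D' : HasV Γ W X) {γ γ' : Env m (skelCtx Γ)} (hγ : CtxLogRel m s Γ γ γ') :
    X.logRel m s (D.den m γ) (D'.den m γ') := by
  obtain ⟨d, d', e⟩ := h
  rw [HasV.den, HasV.den, D.skel.unique d, D'.skel.unique d']
  exact e γ γ' hγ

theorem LogRelU.den {Γ : List (VTy L)} {M N : UTm L} {X : VTy L} {U : UEff L}
    (h : LogRelU m s Γ M N X U) (D : HasU Γ M X U) (D' : HasU Γ N X U)
    {γ γ' : Env m (skelCtx Γ)} (hγ : CtxLogRel m s Γ γ γ') :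
    URel (X.logRel m s) U (D.den m γ) (D'.den m γ') := by
  obtain ⟨d, d', e⟩ := h
  rw [HasU.den, HasU.den, D.skel.unique d, D'.skel.unique d']
  exact e γ γ' hγ

theorem LogRelK.den {Γ : List (VTy L)} {K N : KTm L} {X : VTy L} {E : KEff L}
    (h : LogRelK m s Γ K N X E) (D : HasK Γ K X E) (D' : HasK Γ N X E)
    {γ γ' : Env m (skelCtx Γ)} (hγ : CtxLogRel m s Γ γ γ') :
    KRel (X.logRel m s) E.ops {e | e ∈ E.exc} E.sgn (D.den m γ) (D'.den m γ') := by
  obtain ⟨d, d', e⟩ := h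
  rw [HasK.den, HasK.den, D.skel.unique d, D'.skel.unique d']
  exact e γ γ' hγ

theorem DenEqV.den {Γ : List (VTy L)} {V W : Val L} {X : VTy L}
    (h : DenEqV m (skelCtx Γ) V W X.skel) (D : HasV Γ V X) (D' : HasV Γ W X) :
    D.den m = D'.den m := by
  obtain ⟨d, d', e⟩ := h
  rw [HasV.den, HasV.den, D.skel.unique d, D'.skel.unique d']
  exact funext e

theorem DenEqU.den {Γ : List (VTy L)} {M N : UTm L} {X : VTy L} {U : UEff L}
    (h : DenEqU m (skelCtx Γ) M N X.skel) (D : HasU Γ M X U) (D' : HasU Γ N X U) :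
    D.den m = D'.den m := by
  obtain ⟨d, d', e⟩ := h
  rw [HasU.den, HasU.den, D.skel.unique d, D'.skel.unique d']
  exact funext e

theorem DenEqK.den {Γ : List (VTy L)} {K N : KTm L} {X : VTy L} {E : KEff L}
    (h : DenEqK m (skelCtx Γ) K N X.skel E.st) (D : HasK Γ K X E) (D' : HasK Γ N X E) :
    D.den m = D'.den m := by
  obtain ⟨d, d', e⟩ := h
  rw [HasK.den, HasK.den, D.skel.unique d, D'.skel.unique d']
  exact funext e

theorem CtxLogRel.refl_ground : (G : List (GTy L.Base)) → (γ : Env m (skelCtx (G.map GTy.toV))) →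
    CtxLogRel m s (G.map GTy.toV) γ γ
  | [], _ => trivial
  | _ :: G, γ => ⟨GTy.logRel_iff.2 rfl, CtxLogRel.refl_ground G γ.2⟩

end Soundness

end Coop

theorem theorem1 (L : Coop.Lang.{u}) (m : Coop.Model L) :
    -- Skeletal typing derivations are unique.
    ((∀ Γ (V : Coop.Val L) P, Subsingleton (Coop.SkV Γ V P)) ∧
      (∀ Γ (M : Coop.UTm L) P, Subsingleton (Coop.SkU Γ M P)) ∧
      (∀ Γ (K : Coop.KTm L) P C, Subsingleton (Coop.SkK Γ K P C))) ∧
    -- The meaning of a derivation restricts to the refinement subsets.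
    ((∀ Γ (V : Coop.Val L) X (D : Coop.HasV Γ V X),
        Set.MapsTo (D.den m) (Coop.CtxRef m Γ) (X.ref m)) ∧
      (∀ Γ (M : Coop.UTm L) X U (D : Coop.HasU Γ M X U),
        Set.MapsTo (D.den m) (Coop.CtxRef m Γ) (Coop.UTyRef m X U)) ∧
      (∀ Γ (K : Coop.KTm L) X E (D : Coop.HasK Γ K X E),
        Set.MapsTo (D.den m) (Coop.CtxRef m Γ) (Coop.KTyRef m X E))) ∧
    -- Coherence: the meaning of a derivation is the skeletal semantics of its judgement, and any
    -- two derivations of the same judgement have the same meaning.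
    ((∀ Γ (V : Coop.Val L) X (D : Coop.HasV Γ V X),
        (∀ S : Coop.SkV (Coop.skelCtx Γ) V X.skel, D.den m = S.den) ∧
        ∀ D' : Coop.HasV Γ V X, D.den m = D'.den m) ∧
      (∀ Γ (M : Coop.UTm L) X U (D : Coop.HasU Γ M X U),
        (∀ S : Coop.SkU (Coop.skelCtx Γ) M X.skel, D.den m = S.den) ∧
        ∀ D' : Coop.HasU Γ M X U, D.den m = D'.den m) ∧
      (∀ Γ (K : Coop.KTm L) X E (D : Coop.HasK Γ K X E),
        (∀ S : Coop.SkK (Coop.skelCtx Γ) K X.skel E.st, D.den m = S.den) ∧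
        ∀ D' : Coop.HasK Γ K X E, D.den m = D'.den m)) ∧
    -- Soundness for all equations, with congruence, where below a function abstraction the
    -- `η`-equations for exception handlers are not used: the two sides denote the same map on the
    -- refinement subset of environments.
    ((∀ Γ (V W : Coop.Val L) X, Coop.EqV .mild Γ V W X →
        ∀ (D : Coop.HasV Γ V X) (D' : Coop.HasV Γ W X),
          Set.EqOn (D.den m) (D'.den m) (Coop.CtxRef m Γ)) ∧
      (∀ Γ (M N : Coop.UTm L) X U, Coop.EqU .mild Γ M N X U →
        ∀ (D : Coop.HasU Γ M X U) (D' : Coop.HasU Γ N X U),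
          Set.EqOn (D.den m) (D'.den m) (Coop.CtxRef m Γ)) ∧
      (∀ Γ (K K' : Coop.KTm L) X E, Coop.EqK .mild Γ K K' X E →
        ∀ (D : Coop.HasK Γ K X E) (D' : Coop.HasK Γ K' X E),
          Set.EqOn (D.den m) (D'.den m) (Coop.CtxRef m Γ))) ∧
    -- Soundness without the `η`-equations for exception handlers: the two sides denote the same
    -- map on all skeletal environments.
    ((∀ Γ (V W : Coop.Val L) X, Coop.EqV .noTryEta Γ V W X →
        ∀ (D : Coop.HasV Γ V X) (D' : Coop.HasV Γ W X), D.den m = D'.den m) ∧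
      (∀ Γ (M N : Coop.UTm L) X U, Coop.EqU .noTryEta Γ M N X U →
        ∀ (D : Coop.HasU Γ M X U) (D' : Coop.HasU Γ N X U), D.den m = D'.den m) ∧
      (∀ Γ (K K' : Coop.KTm L) X E, Coop.EqK .noTryEta Γ K K' X E →
        ∀ (D : Coop.HasK Γ K X E) (D' : Coop.HasK Γ K' X E), D.den m = D'.den m)) ∧
    -- Soundness for all equations with unrestricted congruence, up to hereditary equality.
    ((∀ Γ (V W : Coop.Val L) X, Coop.EqV .full Γ V W X →
        ∀ (D : Coop.HasV Γ V X) (D' : Coop.HasV Γ W X) (γ γ'), Coop.CtxRel m Γ γ γ' →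
          X.rel m (D.den m γ) (D'.den m γ')) ∧
      (∀ Γ (M N : Coop.UTm L) X U, Coop.EqU .full Γ M N X U →
        ∀ (D : Coop.HasU Γ M X U) (D' : Coop.HasU Γ N X U) (γ γ'), Coop.CtxRel m Γ γ γ' →
          Coop.UTyRel m X U (D.den m γ) (D'.den m γ')) ∧
      (∀ Γ (K K' : Coop.KTm L) X E, Coop.EqK .full Γ K K' X E →
        ∀ (D : Coop.HasK Γ K X E) (D' : Coop.HasK Γ K' X E) (γ γ'), Coop.CtxRel m Γ γ γ' →
          Coop.KTyRel m X E (D.den m γ) (D'.den m γ'))) ∧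
    -- In particular, it is sound for all equations with unrestricted congruence, up to equality,
    -- at ground types in contexts of ground types.
    ((∀ (G : List (Coop.GTy L.Base)) (V W : Coop.Val L) (A : Coop.GTy L.Base),
        Coop.EqV .full (G.map Coop.GTy.toV) V W A.toV →
        ∀ (D : Coop.HasV (G.map Coop.GTy.toV) V A.toV)
          (D' : Coop.HasV (G.map Coop.GTy.toV) W A.toV), D.den m = D'.den m) ∧
      (∀ (G : List (Coop.GTy L.Base)) (M N : Coop.UTm L) (A : Coop.GTy L.Base) U,
        Coop.EqU .full (G.map Coop.GTy.toV) M N A.toV U →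
        ∀ (D : Coop.HasU (G.map Coop.GTy.toV) M A.toV U)
          (D' : Coop.HasU (G.map Coop.GTy.toV) N A.toV U), D.den m = D'.den m) ∧
      (∀ (G : List (Coop.GTy L.Base)) (K K' : Coop.KTm L) (A : Coop.GTy L.Base) E,
        Coop.EqK .full (G.map Coop.GTy.toV) K K' A.toV E →
        ∀ (D : Coop.HasK (G.map Coop.GTy.toV) K A.toV E)
          (D' : Coop.HasK (G.map Coop.GTy.toV) K' A.toV E), D.den m = D'.den m)) := by
  have ne : False → Coop.Variant.full ≠ Coop.Variant.full := False.elim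
  have ne' : True → Coop.Variant.mild ≠ Coop.Variant.full := fun _ => by simp
  refine ⟨⟨fun _ _ _ => ⟨Coop.SkV.unique⟩, fun _ _ _ => ⟨Coop.SkU.unique⟩,
    fun _ _ _ _ => ⟨Coop.SkK.unique⟩⟩, ⟨?_, ?_, ?_⟩, ⟨?_, ?_, ?_⟩, ⟨?_, ?_, ?_⟩,
    ⟨?_, ?_, ?_⟩, ⟨?_, ?_, ?_⟩, ?_, ?_, ?_⟩
  · intro Γ V X D γ hγ
    exact (Coop.VTy.logRel_true.1 ((D.logRel m True).den D D (.true_of_mem hγ))).2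
  · intro Γ M X U D γ hγ
    exact ((Coop.URel.iff_ref fun _ _ => Coop.VTy.logRel_true).1
      ((D.logRel m True).den D D (.true_of_mem hγ))).2
  · intro Γ K X E D γ hγ
    exact ((Coop.KRel.iff_ref fun _ _ => Coop.VTy.logRel_true).1
      ((D.logRel m True).den D D (.true_of_mem hγ))).2
  · exact fun Γ V X D => ⟨fun S => congrArg _ (D.skel.unique S),
      fun D' => congrArg Coop.SkV.den (D.skel.unique D'.skel)⟩
  · exact fun Γ M X U D => ⟨fun S => congrArg _ (D.skel.unique S),
      fun D' => congrArg Coop.SkU.den (D.skel.unique D'.skel)⟩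
  · exact fun Γ K X E D => ⟨fun S => congrArg _ (D.skel.unique S),
      fun D' => congrArg Coop.SkK.den (D.skel.unique D'.skel)⟩
  · intro Γ V W X h D D' γ hγ
    exact Coop.VTy.logRel_eq trivial ((h.logRel ne').den D D' (.true_of_mem hγ))
  · intro Γ M N X U h D D' γ hγ
    exact ((h.logRel ne').den D D' (.true_of_mem hγ)).eq fun _ _ => Coop.VTy.logRel_eq trivial
  · intro Γ K N X E h D D' γ hγ
    exact ((h.logRel ne').den D D' (.true_of_mem hγ)).eq fun _ _ => Coop.VTy.logRel_eq trivial
  · exact fun Γ V W X h D D' => (h.den_eq m rfl).den D D'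
  · exact fun Γ M N X U h D D' => (h.den_eq m rfl).den D D'
  · exact fun Γ K N X E h D D' => (h.den_eq m rfl).den D D'
  · intro Γ V W X h D D' γ γ' hγ
    rw [← Coop.VTy.logRel_false]
    exact (h.logRel ne).den D D' (Coop.CtxLogRel.false_iff.2 hγ)
  · intro Γ M N X U h D D' γ γ' hγ
    rw [Coop.UTyRel, ← Coop.VTy.logRel_false]
    exact (h.logRel ne).den D D' (Coop.CtxLogRel.false_iff.2 hγ)
  · intro Γ K N X E h D D' γ γ' hγ
    rw [Coop.KTyRel, ← Coop.VTy.logRel_false]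
    exact (h.logRel ne).den D D' (Coop.CtxLogRel.false_iff.2 hγ)
  · intro G V W A h D D'
    funext γ
    exact Coop.GTy.logRel_iff.1 ((h.logRel ne).den D D' (.refl_ground G γ))
  · intro G M N A U h D D'
    funext γ
    exact ((h.logRel ne).den D D' (.refl_ground G γ)).eq fun _ _ => Coop.GTy.logRel_iff.1
  · intro G K N A E h D D'
    funext γ
    exact ((h.logRel ne).den D D' (.refl_ground G γ)).eq fun _ _ => Coop.GTy.logRel_iff.1
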